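/- Let $\mathcal X\subset\mathbb R$ be countable, let $\mathcal X_2=\{(i,j)\in\mathcal X^2: i\ne j\}$ carry a strict total order $\prec$, and for $(i,j)\in\mathcal X_2$ let $\lambda_{ij}:[0,\infty)\to(0,\infty)$ be bounded and measurable. Write $\|\cdot\|_\infty$ for the $L^\infty([0,\infty))$ norm with respect to Lebesgue measure. Assume that $\sum_{(i,j)\in\mathcal X_2}\|\lambda_{ij}\|_\infty<\infty$ and that, for every $i\in\mathcal X$, $\lim_{y\to\infty}\int_0^y\sum_{j\ne i}\lambda_{ij}(s)\,ds=\infty$. Let $\tilde\lambda_{ij}\ge\lambda_{ij}$ be measurable functions on $[0,\infty)$ such that, for all $(i,j)\in\mathcal X_2$, $\tilde\lambda_{ij}(y)=\|\lambda_{ij}\|_\infty$ for almost every $y\ge0$, and put $$\Lambda_{ij}(y)=\Big(\sum_{(i',j')\prec(i,j)}\tilde\lambda_{i'j'}(y)\Big)+\big[0,\lambda_{ij}(y)\big),$$ $$h(i,y,v)=\sum_{j\ne i}(j-i)\mathbf 1_{\Lambda_{ij}(y)}(v),\qquad g(i,y,v)=y\sum_{j\ne i}\mathbf 1_{\Lambda_{ij}(y)}(v).$$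 Let $(\Omega,\mathcal F,P)$ be a probability space with a filtration $(\mathcal F_t)_{t\ge0}$ satisfying the usual hypotheses, and let $\wp$ be a Poisson random measure on $[0,\infty)\times\mathbb R$ whose intensity is Lebesgue measure, such that for every $t$ the restriction of $\wp$ to $(0,t]\times\mathbb R$ is $\mathcal F_t$-measurable and its restriction to $(t,\infty)\times\mathbb R$ is independent of $\mathcal F_t$. For $l=1,2$ let $(X^l,Y^l)$ be an adapted càdlàg solution with values in $\mathcal X\times[0,\infty)$, with arbitrary $\mathcal F_0$-measurable initial value, of $$X_t=X_0+\int_{(0,t]\times\mathbb R}h(X_{u-},Y_{u-},v)\,\wp(du,dv),\qquad Y_t=Y_0+t-\int_{(0,t]\times\mathbb R}g(X_{u-},Y_{u-},v)\,\wp(du,dv),$$ where the integrals converge absolutely; both solutions are driven by the same $\wp$. Let $T$ be a stopping time with values in $[0,\infty]$ and let $$\tau=\inf\{t>T:\ X^1_t=X^2_t,\ \min(Y^1_t,Y^2_t)=0\}$$ be the time of the next meeting after $T$. On $\{\tau<\infty\}$ let $k=X^1_\tau=X^2_\tau$ be the meeting state and let $y=\max(Y^1_\tau,Y^2_\tau)$,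 the age of the chain that arrived at $k$ earlier. Then the regular conditional probability, given $\tau<\infty$, the meeting state $k$ and the age $y$, of merging at the time $\tau$, that is, of the event $\{X^1_t=X^2_t\text{ for all }t\ge\tau\}$, is $$\mathcal P(k,y)=\int_0^\infty \exp\Big(-\int_0^{y'}\sum_{k'\ne k}\lambda_{kk'}(t)\vee\lambda_{kk'}(y+t)\,dt\Big)\Big[\sum_{k'\ne k}\lambda_{kk'}(y')\wedge\lambda_{kk'}(y+y')\Big]dy'$$ for almost every $(k,y)$ with respect to the conditional law of the pair (meeting state, age) given $\tau<\infty$. Here $a\vee b=\max(a,b)$ and $a\wedge b=\min(a,b)$. Moreover, for all $k\in\mathcal X$ and $y\ge0$ the two series converge at almost every argument, and the integrals in the formula converge. -/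

import Mathlib

open MeasureTheory ProbabilityTheory Set Filter Topology
open scoped NNReal ENNReal

noncomputable section

namespace SemiMarkovFlow

/-- The set of ordered pairs of distinct states. -/
def OffDiag (𝒳 : Set ℝ) : Type := {p : 𝒳 × 𝒳 // p.1 ≠ p.2}

/-- The pair `(k, k')` with `k' ≠ k`. -/
def pair {𝒳 : Set ℝ} (k : 𝒳) (k' : {j : 𝒳 // j ≠ k}) : OffDiag 𝒳 :=
  ⟨(k, k'.1), k'.2.symm⟩

/-- The `L^∞` norm of the function `f` on `[0, ∞)`. -/
def supNorm (f : ℝ → ℝ) : ℝ :=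
  (eLpNorm f ⊤ (volume.restrict (Ici (0 : ℝ)))).toReal

/-- The total rate of leaving `k` at age `y`, the sum of `λ_{kk'}(y)` over `k' ≠ k`. -/
def exitRate {𝒳 : Set ℝ} (lam : OffDiag 𝒳 → ℝ → ℝ) (k : 𝒳) (y : ℝ) : ℝ :=
  ∑' k' : {j : 𝒳 // j ≠ k}, lam (pair k k') y

/-- The assumptions on the transition rates. The rates are functions on `[0, ∞)`: their values at
negative arguments are never used. -/
structure IsRateMatrix {𝒳 : Set ℝ} (lam : OffDiag 𝒳 → ℝ → ℝ) : Prop where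
  measurable : ∀ p, Measurable (lam p)
  pos : ∀ p, ∀ y : ℝ, 0 ≤ y → 0 < lam p y
  bounded : ∀ p, ∃ B : ℝ, ∀ y : ℝ, 0 ≤ y → lam p y ≤ B
  summable_supNorm : Summable fun p => supNorm (lam p)
  tendsto_cumulative : ∀ k : 𝒳,
    Tendsto (fun y : ℝ => ∫ s in (0 : ℝ)..y, exitRate lam k s) atTop atTop

/-- The auxiliary functions `tlam` dominating the rates: the lengths by which the intervals
are spaced. -/
structure IsSpacing {𝒳 : Set ℝ} (lam tlam : OffDiag 𝒳 → ℝ → ℝ) : Prop where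
  measurable : ∀ p, Measurable (tlam p)
  le_tlam : ∀ p, ∀ y : ℝ, 0 ≤ y → lam p y ≤ tlam p y
  tlam_le : ∀ p, ∀ᵐ y ∂(volume.restrict (Ici (0 : ℝ))), tlam p y ≤ supNorm (lam p)

section Intervals

variable {𝒳 : Set ℝ}

/-- The interval `Λ_p(y)`: left-closed, right-open, of length `lam p y`, with left end point
the sum of `tlam q y` over all `q` preceding `p`. -/
def interval (prec : OffDiag 𝒳 → OffDiag 𝒳 → Prop) (lam tlam : OffDiag 𝒳 → ℝ → ℝ)
    (p : OffDiag 𝒳) (y : ℝ) : Set ℝ :=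
  Ico (∑' q : {q : OffDiag 𝒳 // prec q p}, tlam q.1 y)
    ((∑' q : {q : OffDiag 𝒳 // prec q p}, tlam q.1 y) + lam p y)

/-- The displacement of the state caused by a point with second coordinate `v`. -/
def hFun (prec : OffDiag 𝒳 → OffDiag 𝒳 → Prop) (lam tlam : OffDiag 𝒳 → ℝ → ℝ)
    (i : 𝒳) (y v : ℝ) : ℝ :=
  ∑' j : {j : 𝒳 // j ≠ i},
    ((j.1 : ℝ) - (i : ℝ)) * (interval prec lam tlam (pair i j) y).indicator (fun _ => (1 : ℝ)) v

/-- The reduction of the age caused by a point with second coordinate `v`. -/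
def gFun (prec : OffDiag 𝒳 → OffDiag 𝒳 → Prop) (lam tlam : OffDiag 𝒳 → ℝ → ℝ)
    (i : 𝒳) (y v : ℝ) : ℝ :=
  y * ∑' j : {j : 𝒳 // j ≠ i},
    (interval prec lam tlam (pair i j) y).indicator (fun _ => (1 : ℝ)) v

end Intervals

/-- Lebesgue measure on `[0, ∞)`. -/
def lebesgueHalfLine : Measure ℝ≥0 := Measure.comap ((↑) : ℝ≥0 → ℝ) volume

/-- Lebesgue measure on `[0, ∞) × ℝ`. -/
def lebesgueHalfPlane : Measure (ℝ≥0 × ℝ) := lebesgueHalfLine.prod volume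

/-- `N` is a Poisson random measure with intensity `ν`. -/
structure IsPoissonRandomMeasure {Ω E : Type*} [MeasurableSpace Ω] [MeasurableSpace E]
    (N : Ω → Measure E) (ν : Measure E) (P : Measure Ω) : Prop where
  measurable : Measurable N
  law : ∀ A : Set E, MeasurableSet A → ν A ≠ ⊤ →
    HasLaw (fun ω => N ω A)
      ((poissonMeasure (ν A).toNNReal).map (fun n : ℕ => (n : ℝ≥0∞))) P
  indep : ∀ (n : ℕ) (A : Fin n → Set E), (∀ i, MeasurableSet (A i)) →
    (∀ i j, i ≠ j → Disjoint (A i) (A j)) → iIndepFun (fun i ω => N ω (A i)) P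

/-- The random measure `N` on `[0, ∞) × ℝ` is compatible with the filtration `ℱ`: its restriction to
`(0, t] × ℝ` is known at time `t`, its restriction to `(t, ∞) × ℝ` is independent of `ℱ t`. -/
structure IsCompatible {Ω : Type*} [mΩ : MeasurableSpace Ω] (N : Ω → Measure (ℝ≥0 × ℝ))
    (ℱ : Filtration ℝ≥0 mΩ) (P : Measure Ω) : Prop where
  adapted : ∀ t : ℝ≥0, Measurable[ℱ t] fun ω => (N ω).restrict (Ioc 0 t ×ˢ univ)
  indep : ∀ t : ℝ≥0, Indep (ℱ t)
    (MeasurableSpace.comap (fun ω => (N ω).restrict (Ioi t ×ˢ univ)) inferInstance) P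

/-- Right-continuous with left limits. -/
def IsCadlag {E : Type*} [TopologicalSpace E] (f : ℝ≥0 → E) : Prop :=
  ∀ t : ℝ≥0, ContinuousWithinAt f (Ici t) t ∧ ∃ l : E, Tendsto f (𝓝[<] t) (𝓝 l)

/-- `(X, Y)` is a strong solution, with values in `𝒳 × [0, ∞)`, of the system
`X_t = X_0 + ∫_{(0,t] × ℝ} h(X_{u-}, Y_{u-}, v) N(du, dv)`,
`Y_t = Y_0 + t - ∫_{(0,t] × ℝ} g(X_{u-}, Y_{u-}, v) N(du, dv)`. -/
structure IsSolution {Ω : Type*} [mΩ : MeasurableSpace Ω] {𝒳 : Set ℝ}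
    (prec : OffDiag 𝒳 → OffDiag 𝒳 → Prop) (lam tlam : OffDiag 𝒳 → ℝ → ℝ)
    (N : Ω → Measure (ℝ≥0 × ℝ)) (ℱ : Filtration ℝ≥0 mΩ) (P : Measure Ω)
    (X : ℝ≥0 → Ω → 𝒳) (Y : ℝ≥0 → Ω → ℝ≥0) : Prop where
  adapted_X : Adapted ℱ X
  adapted_Y : Adapted ℱ Y
  cadlag : ∀ᵐ ω ∂P, IsCadlag (fun t => X t ω) ∧ IsCadlag (fun t => Y t ω)
  eq_X : ∀ᵐ ω ∂P, ∀ t : ℝ≥0,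
    IntegrableOn (fun z : ℝ≥0 × ℝ => hFun prec lam tlam
      (Function.leftLim (fun s => X s ω) z.1) (Function.leftLim (fun s => Y s ω) z.1) z.2)
      (Ioc 0 t ×ˢ univ) (N ω) ∧
    (X t ω : ℝ) = X 0 ω + ∫ z in Ioc 0 t ×ˢ univ, hFun prec lam tlam
      (Function.leftLim (fun s => X s ω) z.1) (Function.leftLim (fun s => Y s ω) z.1) z.2 ∂(N ω)
  eq_Y : ∀ᵐ ω ∂P, ∀ t : ℝ≥0,
    IntegrableOn (fun z : ℝ≥0 × ℝ => gFun prec lam tlam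
      (Function.leftLim (fun s => X s ω) z.1) (Function.leftLim (fun s => Y s ω) z.1) z.2)
      (Ioc 0 t ×ˢ univ) (N ω) ∧
    (Y t ω : ℝ) = Y 0 ω + t - ∫ z in Ioc 0 t ×ˢ univ, gFun prec lam tlam
      (Function.leftLim (fun s => X s ω) z.1) (Function.leftLim (fun s => Y s ω) z.1) z.2 ∂(N ω)

section Meeting

variable {Ω : Type*} {𝒳 : Set ℝ}

/-- The time of the next meeting after `T`; it is `⊤` if there is none. -/
def nextMeeting (X₁ X₂ : ℝ≥0 → Ω → 𝒳) (Y₁ Y₂ : ℝ≥0 → Ω → ℝ≥0) (T : Ω → WithTop ℝ≥0) :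
    Ω → WithTop ℝ≥0 := fun ω =>
  sInf ((fun t : ℝ≥0 => (t : WithTop ℝ≥0)) ''
    {t : ℝ≥0 | T ω < t ∧ X₁ t ω = X₂ t ω ∧ min (Y₁ t ω) (Y₂ t ω) = 0})

/-- The event that `X₁` and `X₂` coincide from the time `τ` onwards. -/
def MergedFrom (X₁ X₂ : ℝ≥0 → Ω → 𝒳) (τ : Ω → WithTop ℝ≥0) (ω : Ω) : Prop :=
  ∀ t : ℝ≥0, τ ω ≤ t → X₁ t ω = X₂ t ω

/-- The common state at time `τ`, together with the age of the chain that arrived there earlier,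
which is the larger of the two ages. -/
def meetingData (X₁ : ℝ≥0 → Ω → 𝒳) (Y₁ Y₂ : ℝ≥0 → Ω → ℝ≥0) (τ : Ω → WithTop ℝ≥0) (ω : Ω) :
    𝒳 × ℝ≥0 :=
  (stoppedValue X₁ τ ω, max (stoppedValue Y₁ τ ω) (stoppedValue Y₂ τ ω))

end Meeting

section Formula

variable {𝒳 : Set ℝ} (lam : OffDiag 𝒳 → ℝ → ℝ) (k : 𝒳) (y : ℝ)

/-- The sum over `k' ≠ k` of the maximum of `λ_{kk'}(t)` and `λ_{kk'}(y + t)`. -/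
def maxRate (t : ℝ) : ℝ :=
  ∑' k' : {j : 𝒳 // j ≠ k}, max (lam (pair k k') t) (lam (pair k k') (y + t))

/-- The sum over `k' ≠ k` of the minimum of `λ_{kk'}(t)` and `λ_{kk'}(y + t)`. -/
def minRate (t : ℝ) : ℝ :=
  ∑' k' : {j : 𝒳 // j ≠ k}, min (lam (pair k k') t) (lam (pair k k') (y + t))

/-- The density of the time until a simultaneous transition. -/
def mergeDensity (y' : ℝ) : ℝ :=
  Real.exp (-∫ t in (0 : ℝ)..y', maxRate lam k y t) * minRate lam k y y'

/-- The series and integrals in the formula for the merging probability converge. -/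
structure FormulaConverges : Prop where
  summable_max : ∀ᵐ t ∂(volume.restrict (Ici (0 : ℝ))),
    Summable fun k' : {j : 𝒳 // j ≠ k} => max (lam (pair k k') t) (lam (pair k k') (y + t))
  summable_min : ∀ᵐ t ∂(volume.restrict (Ici (0 : ℝ))),
    Summable fun k' : {j : 𝒳 // j ≠ k} => min (lam (pair k k') t) (lam (pair k k') (y + t))
  integrable_max : ∀ y' : ℝ, 0 ≤ y' → IntervalIntegrable (maxRate lam k y) volume 0 y'
  integrable_density : IntegrableOn (mergeDensity lam k y) (Ioi 0)

end Formula

end SemiMarkovFlow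

end

noncomputable section

namespace SemiMarkovFlow

/-! At the meeting time τ both chains are in a state k, one with age 0 and the other with age y.
Until one of them jumps, their ages at time τ + a are a and y + a. At almost every age the interval
attached to (k, k') has the same left end point, so the two intervals for k' are nested, while those
for different k' are disjoint. Hence some chain jumps at the rate m(a), the sum of the maxima, and
both jump together, necessarily to the same state, at the rate n(a), the sum of the minima. After a
joint jump both chains have the same state and age 0 and coincide forever; after a jump of one chain
alone the states differ. So merging means that the first hit is a joint one, which has probability ∫
exp(-∫ m) n.

The argument replaces the strong Markov property by an accounting identity. Let π(a) be the
conditional probability that the first hit is joint, given no hit before a. Then π' = mπ - n, that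
is, ∫₀ˣ mπ + π(0) = π(x) + ∫₀ˣ n (`lintegral_mul_successProb`). Take for x the random time from τ to
the first hit. Then π(x) is the integral of π(u - τ) over the hits up to that time, and ∫₀ˣ mπ is
the integral of the same integrand against Lebesgue measure. The compensation formula
`lintegral_compensation` equates their expectations, and in the same way E ∫₀ˣ n is the probability
of a joint first hit. On the event that the meeting data lie in A, what survives is E[π(0); A] =
P(merging; A) (`DrivenPair.lintegral_mergeWeight_eq`). As π(0) is the formula, this identifies the
conditional distribution.

Three points need care. The integrands have to be predictable, so the period from τ to the first hit
is described by `Window`, through left limits and events at countably many dense times, without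
mention of τ. The integral equations have to be read as paths that drift and jump
(`SolvesPath.chainPath`), which requires the ages just before the points of the noise to be typical
(`ae_leftLim_mem_goodAges`); this holds because the age has derivative one at almost every time.
Finally a first hit has to exist: the expected number of hits is at most one and equals the
expectation of ∫ m, which would be infinite if the chains never jumped. -/

lemma map_coe_lebesgueHalfLine :
    lebesgueHalfLine.map ((↑) : ℝ≥0 → ℝ) = volume.restrict (Ici 0) := by
  have h := (MeasurableEmbedding.subtype_coe (measurableSet_Ici (a := (0:ℝ)))).map_comap
    (volume : Measure ℝ)
  rw [Subtype.range_coe] at h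
  exact h

instance : SigmaFinite lebesgueHalfLine := by
  have h := map_coe_lebesgueHalfLine
  refine SigmaFinite.of_map _ (f := ((↑) : ℝ≥0 → ℝ)) measurable_coe_nnreal_real.aemeasurable ?_
  rw [h]; infer_instance

lemma lebesgueHalfLine_apply {A : Set ℝ} (hA : MeasurableSet A) :
    lebesgueHalfLine ((↑) ⁻¹' A) = volume (A ∩ Ici 0) := by
  rw [← Measure.restrict_apply hA, ← map_coe_lebesgueHalfLine,
    Measure.map_apply measurable_coe_nnreal_real hA]

lemma lebesgueHalfLine_Ioc (s t : ℝ≥0) :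
    lebesgueHalfLine (Ioc s t) = ENNReal.ofReal (t - s) := by
  have : (Ioc s t : Set ℝ≥0) = (↑) ⁻¹' (Ioc (s : ℝ) t) := by ext; simp
  rw [this, lebesgueHalfLine_apply measurableSet_Ioc, inter_eq_left.2, Real.volume_Ioc]
  intro x hx
  exact s.2.trans hx.1.le

instance : SigmaFinite lebesgueHalfPlane := by
  unfold lebesgueHalfPlane; infer_instance

lemma lebesgueHalfPlane_prod (A : Set ℝ≥0) (B : Set ℝ) :
    lebesgueHalfPlane (A ×ˢ B) = lebesgueHalfLine A * volume B :=
  Measure.prod_prod A B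

/-! ### Factorial moments of the Poisson distribution -/

lemma tsum_poisson_weights (r : ℝ≥0) :
    ∑' n : ℕ, ENNReal.ofReal (Real.exp (-r) * r ^ n / n.factorial) = 1 := by
  rw [← ENNReal.ofReal_tsum_of_nonneg (fun n => by positivity)
    (hasSum_one_poissonMeasure r).summable, (hasSum_one_poissonMeasure r).tsum_eq,
    ENNReal.ofReal_one]

lemma lintegral_poissonMeasure (r : ℝ≥0) (f : ℕ → ℝ≥0∞) :
    ∫⁻ n, f n ∂poissonMeasure r =
      ∑' n : ℕ, ENNReal.ofReal (Real.exp (-r) * r ^ n / n.factorial) * f n := by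
  rw [lintegral_countable']
  exact tsum_congr fun n => by rw [poissonMeasure_singleton, mul_comm]

lemma poisson_weight_succ (r : ℝ≥0) (n : ℕ) :
    ENNReal.ofReal (Real.exp (-r) * r ^ (n + 1) / (n + 1).factorial) * ((n + 1 : ℕ) : ℝ≥0∞) =
      r * ENNReal.ofReal (Real.exp (-r) * r ^ n / n.factorial) := by
  rw [← ENNReal.ofReal_natCast, ← ENNReal.ofReal_coe_nnreal,
    ← ENNReal.ofReal_mul (by positivity), ← ENNReal.ofReal_mul (by positivity)]
  congr 1
  rw [Nat.factorial_succ]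
  push_cast
  field_simp
  ring

lemma lintegral_natCast_poissonMeasure (r : ℝ≥0) :
    ∫⁻ n, (n : ℝ≥0∞) ∂poissonMeasure r = r := by
  rw [lintegral_poissonMeasure, tsum_eq_zero_add' ENNReal.summable]
  simp_rw [poisson_weight_succ]
  rw [ENNReal.tsum_mul_left, tsum_poisson_weights]
  simp

lemma lintegral_descFactorial_two_poissonMeasure (r : ℝ≥0) :
    ∫⁻ n, (n * (n - 1 : ℕ) : ℝ≥0∞) ∂poissonMeasure r = r ^ 2 := by
  rw [lintegral_poissonMeasure, tsum_eq_zero_add' ENNReal.summable]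
  have h : ∀ n : ℕ, ENNReal.ofReal (Real.exp (-r) * r ^ (n + 1) / (n + 1).factorial) *
      (((n + 1 : ℕ) : ℝ≥0∞) * ((n + 1 - 1 : ℕ) : ℝ≥0∞)) =
      r * (ENNReal.ofReal (Real.exp (-r) * r ^ n / n.factorial) * n) := by
    intro n
    rw [← mul_assoc, poisson_weight_succ, mul_assoc, Nat.add_sub_cancel]
  simp_rw [h]
  rw [ENNReal.tsum_mul_left, ← lintegral_poissonMeasure, lintegral_natCast_poissonMeasure]
  simp [sq]

section Poisson

variable {Ω E : Type*} [MeasurableSpace Ω] [MeasurableSpace E] {N : Ω → Measure E}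
  {ν : Measure E} {P : Measure Ω}

namespace IsPoissonRandomMeasure

lemma measurable_apply (hN : IsPoissonRandomMeasure N ν P) {A : Set E} (hA : MeasurableSet A) :
    Measurable fun ω => N ω A :=
  (Measure.measurable_coe hA).comp hN.measurable

lemma lintegral_apply (hN : IsPoissonRandomMeasure N ν P) {A : Set E} (hA : MeasurableSet A)
    (hA' : ν A ≠ ⊤) : ∫⁻ ω, N ω A ∂P = ν A := by
  have h := hN.law A hA hA'
  have h1 : ∫⁻ ω, N ω A ∂P = ∫⁻ x, x ∂(P.map fun ω => N ω A) :=
    (lintegral_map measurable_id (hN.measurable_apply hA)).symm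
  rw [h1, h.map_eq, lintegral_map (f := fun x => x) measurable_id (by fun_prop)]
  simp only [lintegral_natCast_poissonMeasure, ENNReal.coe_toNNReal hA']

lemma ae_exists_natCast (hN : IsPoissonRandomMeasure N ν P) {A : Set E} (hA : MeasurableSet A)
    (hA' : ν A ≠ ⊤) : ∀ᵐ ω ∂P, ∃ n : ℕ, N ω A = n := by
  have h := hN.law A hA hA'
  have hr : MeasurableSet (range ((↑) : ℕ → ℝ≥0∞)) := (countable_range _).measurableSet
  have h2 : ∀ᵐ x ∂(P.map fun ω => N ω A), x ∈ range ((↑) : ℕ → ℝ≥0∞) := by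
    rw [h.map_eq]
    refine (ae_map_iff (f := fun n : ℕ => (n : ℝ≥0∞)) (p := fun x => x ∈ range _)
      (measurable_of_countable _).aemeasurable hr).2 ?_
    exact ae_of_all _ fun n => mem_range_self n
  filter_upwards [ae_of_ae_map h.aemeasurable h2] with ω hω
  obtain ⟨n, hn⟩ := hω
  exact ⟨n, hn.symm⟩

/-- Markov's inequality for n(n - 1), which is at least one as soon as n ≥ 2 and has mean ν(A)². The
quadratic bound is what survives summation over a fine partition. -/
lemma measure_two_le (hN : IsPoissonRandomMeasure N ν P) {A : Set E} (hA : MeasurableSet A)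
    (hA' : ν A ≠ ⊤) : P {ω | 2 ≤ N ω A} ≤ ν A ^ 2 := by
  have h := hN.law A hA hA'
  have hm : MeasurableSet {x : ℝ≥0∞ | 2 ≤ x} := measurableSet_Ici
  rw [h.measure_eq hm, Measure.map_apply (measurable_of_countable _) hm]
  calc poissonMeasure (ν A).toNNReal ((fun n : ℕ => (n : ℝ≥0∞)) ⁻¹' {x | 2 ≤ x})
      = ∫⁻ n in ((fun n : ℕ => (n : ℝ≥0∞)) ⁻¹' {x | 2 ≤ x}), 1
          ∂poissonMeasure (ν A).toNNReal := by simp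
    _ ≤ ∫⁻ n in ((fun n : ℕ => (n : ℝ≥0∞)) ⁻¹' {x | 2 ≤ x}), (n * (n - 1 : ℕ) : ℝ≥0∞)
          ∂poissonMeasure (ν A).toNNReal := by
        refine setLIntegral_mono (measurable_of_countable _) fun n hn => ?_
        have h2 : 2 ≤ n := by
          have : ((2 : ℕ) : ℝ≥0∞) ≤ n := by simpa using hn
          exact_mod_cast this
        have : 1 ≤ n * (n - 1) := Nat.mul_pos (by omega) (by omega)
        exact_mod_cast this
    _ ≤ ∫⁻ n, (n * (n - 1 : ℕ) : ℝ≥0∞) ∂poissonMeasure (ν A).toNNReal :=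
        setLIntegral_le_lintegral _ _
    _ = ν A ^ 2 := by
        rw [lintegral_descFactorial_two_poissonMeasure, ENNReal.coe_toNNReal hA']

end IsPoissonRandomMeasure

end Poisson

/-! ### The noise as a set of points -/

section Atoms

variable {E : Type*} [MeasurableSpace E] {μ : Measure E}

/-- A finite measure that takes integer values on a basis of the topology is carried by finitely
many atoms, and an atom of mass less than two has mass at most one. -/
lemma exists_finset_atoms [TopologicalSpace E] [SecondCountableTopology E]
    [TopologicalSpace.PseudoMetrizableSpace E] [T1Space E] [BorelSpace E] [IsFiniteMeasure μ]
    {B : Set (Set E)} (hB : TopologicalSpace.IsTopologicalBasis B)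
    (hint : ∀ U ∈ B, ∃ n : ℕ, μ U = n) :
    ∃ F : Finset E, μ (↑F)ᶜ = 0 ∧ (∀ z ∈ F, 1 ≤ μ {z}) ∧ ∀ z, μ {z} < 2 → μ {z} ≤ 1 := by
  let _ := TopologicalSpace.pseudoMetrizableSpacePseudoMetric E
  -- By outer regularity a point of mass below n + 1 has a basic neighbourhood of mass below n + 1,
  -- hence at most n by integrality. The case n = 0 makes the complement of the atoms locally null,
  -- the case n = 1 bounds the mass of an atom.
  have key : ∀ (z : E) (n : ℕ), μ {z} < n + 1 → ∃ U ∈ B, z ∈ U ∧ μ U ≤ n := by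
    intro z n hz
    obtain ⟨U, hzU, hU, hlt⟩ := Set.exists_isOpen_lt_of_lt {z} _ hz
    obtain ⟨V, hV, hzV, hVU⟩ := hB.exists_subset_of_mem_open (hzU rfl) hU
    obtain ⟨k, hk⟩ := hint V hV
    refine ⟨V, hV, hzV, ?_⟩
    have : (k : ℝ≥0∞) < (n + 1 : ℕ) := by
      rw [← hk]; push_cast; exact (measure_mono hVU).trans_lt hlt
    rw [hk]
    exact_mod_cast Nat.lt_succ_iff.1 (by exact_mod_cast this)
  have hfin : {z : E | 1 ≤ μ {z}}.Finite :=
    Measure.finite_const_le_meas_of_disjoint_iUnion μ one_pos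
      (fun z => measurableSet_singleton z) (fun a b hab => by simpa using hab)
      (measure_ne_top _ _)
  refine ⟨hfin.toFinset, ?_, fun z hz => by simpa using hz, fun z hz => ?_⟩
  · refine measure_null_of_locally_null _ fun z hz => ?_
    simp only [Finite.coe_toFinset, mem_compl_iff, mem_ofPred_eq, not_le] at hz
    obtain ⟨U, hU, hzU, h0⟩ := key z 0 (by simpa using hz)
    exact ⟨U, mem_nhdsWithin_of_mem_nhds (hB.isOpen hU |>.mem_nhds hzU), by simpa using h0⟩
  · obtain ⟨U, hU, hzU, h1⟩ := key z 1 (by rw [Nat.cast_one, one_add_one_eq_two]; exact hz)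
    exact (measure_mono (singleton_subset_iff.2 hzU)).trans (by simpa using h1)

lemma eq_count_restrict [MeasurableSingletonClass E] {S : Set E} (hS : S.Countable)
    (hnull : μ Sᶜ = 0) (hone : ∀ z ∈ S, μ {z} = 1) : μ = Measure.count.restrict S := by
  ext A hA
  have h1 : μ A = μ (A ∩ S) := by
    refine (measure_eq_measure_of_null_sdiff inter_subset_left ?_).symm
    exact measure_mono_null (fun z hz => by simp_all) hnull
  rw [h1, Measure.restrict_apply hA]
  have hc : (A ∩ S).Countable := hS.mono inter_subset_right
  rw [← biUnion_of_singleton (A ∩ S),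
    measure_biUnion hc (fun a _ b _ hab => by simpa using hab) fun z _ => measurableSet_singleton z,
    measure_biUnion hc (fun a _ b _ hab => by simpa using hab) fun z _ => measurableSet_singleton z]
  exact tsum_congr fun z => by rw [hone z z.2.2, Measure.count_singleton]

end Atoms

/-- `S` is the set of points of the point measure `μ` in the strip `(0, ∞) × [0, C]`: it is locally
finite, and no two points have the same time. -/
structure IsStripPoints (μ : Measure (ℝ≥0 × ℝ)) (C : ℝ) (S : Set (ℝ≥0 × ℝ)) : Prop where
  subset : S ⊆ Ioi 0 ×ˢ Icc 0 C
  finite : ∀ t : ℝ≥0, (S ∩ Ioc 0 t ×ˢ univ).Finite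
  injOn : InjOn Prod.fst S
  restrict_eq : μ.restrict (Ioi 0 ×ˢ Icc 0 C) = Measure.count.restrict S

section HalfPlane

variable {Ω : Type*} [MeasurableSpace Ω] {P : Measure Ω} {N : Ω → Measure (ℝ≥0 × ℝ)}

lemma lebesgueHalfPlane_box_ne_top (s t : ℝ≥0) {B : Set ℝ} (hB : volume B ≠ ⊤) :
    lebesgueHalfPlane (Ioc s t ×ˢ B) ≠ ⊤ := by
  rw [lebesgueHalfPlane_prod, lebesgueHalfLine_Ioc]
  exact ENNReal.mul_ne_top ENNReal.ofReal_ne_top hB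

lemma ae_atoms_of_box (hN : IsPoissonRandomMeasure N lebesgueHalfPlane P) (t : ℝ≥0) {B : Set ℝ}
    (hB : MeasurableSet B) (hB' : volume B ≠ ⊤) :
    ∀ᵐ ω ∂P, ∃ F : Finset (ℝ≥0 × ℝ), N ω ((Ioc 0 t ×ˢ B) \ F) = 0 ∧
      (∀ z ∈ F, z ∈ Ioc 0 t ×ˢ B ∧ 1 ≤ N ω {z}) ∧
      ∀ z ∈ Ioc 0 t ×ˢ B, N ω {z} < 2 → N ω {z} ≤ 1 := by
  have hbox : MeasurableSet (Ioc 0 t ×ˢ B) := measurableSet_Ioc.prod hB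
  have h1 : ∀ᵐ ω ∂P, ∀ U ∈ TopologicalSpace.countableBasis (ℝ≥0 × ℝ),
      ∃ n : ℕ, N ω (U ∩ Ioc 0 t ×ˢ B) = n := by
    refine (ae_ball_iff (TopologicalSpace.countable_countableBasis _)).2 fun U hU => ?_
    refine hN.ae_exists_natCast
      ((TopologicalSpace.isOpen_of_mem_countableBasis hU).measurableSet.inter hbox) ?_
    exact measure_ne_top_of_subset inter_subset_right (lebesgueHalfPlane_box_ne_top 0 t hB')
  filter_upwards [h1, hN.ae_exists_natCast hbox (lebesgueHalfPlane_box_ne_top 0 t hB')]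
    with ω h2 h3
  obtain ⟨k, hk⟩ := h3
  have : IsFiniteMeasure ((N ω).restrict (Ioc 0 t ×ˢ B)) := by
    refine ⟨?_⟩
    rw [Measure.restrict_apply_univ, hk]
    exact ENNReal.natCast_lt_top k
  obtain ⟨F, hF0, hF1, hF2⟩ := exists_finset_atoms (μ := (N ω).restrict (Ioc 0 t ×ˢ B))
    (TopologicalSpace.isBasis_countableBasis (ℝ≥0 × ℝ)) fun U hU => by
      rw [Measure.restrict_apply
        (TopologicalSpace.isOpen_of_mem_countableBasis hU).measurableSet]
      exact h2 U hU
  have hsing : ∀ z ∈ Ioc 0 t ×ˢ B, (N ω).restrict (Ioc 0 t ×ˢ B) {z} = N ω {z} := fun z hz => by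
    rw [Measure.restrict_apply (measurableSet_singleton z),
      inter_eq_left.2 (singleton_subset_iff.2 hz)]
  have hmem : ∀ z ∈ F, z ∈ Ioc 0 t ×ˢ B := by
    intro z hz
    by_contra hn
    have := hF1 z hz
    rw [Measure.restrict_apply (measurableSet_singleton z),
      (disjoint_singleton_left.2 hn).inter_eq, measure_empty] at this
    simp at this
  refine ⟨F, ?_, fun z hz => ⟨hmem z hz, ?_⟩, fun z hz => ?_⟩
  · rw [Measure.restrict_apply F.measurableSet.compl] at hF0
    rwa [sdiff_eq, inter_comm]
  · rw [← hsing z (hmem z hz)]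
    exact hF1 z hz
  · rw [← hsing z hz]
    exact hF2 z

/-- Cut (0, n] into n(m + 1) pieces of length 1 / (m + 1). A time slice of mass at least two lies in
one of the pieces, and by `measure_two_le` the probabilities add up to at most n |B|² / (m + 1),
which tends to zero as m grows. -/
lemma ae_time_slice_lt_two (hN : IsPoissonRandomMeasure N lebesgueHalfPlane P) (n : ℕ) {B : Set ℝ}
    (hB : MeasurableSet B) (hB' : volume B ≠ ⊤) :
    ∀ᵐ ω ∂P, ∀ u ∈ Ioc (0 : ℝ≥0) n, N ω ({u} ×ˢ B) < 2 := by
  have key : ∀ m : ℕ, P {ω | ¬ ∀ u ∈ Ioc (0 : ℝ≥0) n, N ω ({u} ×ˢ B) < 2} ≤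
      ENNReal.ofReal (n * (volume B).toReal ^ 2 * (1 / ((m : ℝ) + 1))) := by
    intro m
    have hm : (0 : ℝ≥0) < m + 1 := by positivity
    have hpiece : ∀ i : ℕ, lebesgueHalfPlane (Ioc (i / (m + 1) : ℝ≥0) ((i + 1) / (m + 1)) ×ˢ B) =
        ENNReal.ofReal ((volume B).toReal * (1 / ((m : ℝ) + 1))) := by
      intro i
      rw [lebesgueHalfPlane_prod, lebesgueHalfLine_Ioc, mul_comm, ENNReal.ofReal_mul (by simp),
        ENNReal.ofReal_toReal hB']
      congr 2
      push_cast
      field_simp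
      ring
    calc P {ω | ¬ ∀ u ∈ Ioc (0 : ℝ≥0) n, N ω ({u} ×ˢ B) < 2}
        ≤ P (⋃ i ∈ Finset.range (n * (m + 1)),
            {ω | 2 ≤ N ω (Ioc (i / (m + 1) : ℝ≥0) ((i + 1) / (m + 1)) ×ˢ B)}) := by
          refine measure_mono fun ω hω => ?_
          simp only [mem_ofPred_eq, not_forall, not_lt] at hω
          obtain ⟨u, hu, h2⟩ := hω
          -- The pieces are open on the left and closed on the right, so the index of the one that
          -- contains u is a ceiling minus one.
          obtain ⟨i, hi⟩ : ∃ i, ⌈u * (m + 1)⌉₊ = i + 1 :=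
            Nat.exists_eq_succ_of_ne_zero (Nat.ceil_pos.2 (mul_pos hu.1 hm)).ne'
          have h3 := (Nat.ceil_eq_iff (Nat.succ_ne_zero i)).1 hi
          simp only [mem_iUnion, mem_ofPred_eq, Finset.mem_range]
          refine ⟨i, ?_, h2.trans (measure_mono (prod_mono (singleton_subset_iff.2 ⟨?_, ?_⟩)
            le_rfl))⟩
          · have : ((i : ℕ) : ℝ≥0) < (n * (m + 1) : ℕ) := by
              push_cast
              have := h3.1
              simp only [Nat.succ_sub_one] at this
              exact this.trans_le (by gcongr; exact hu.2)
            exact_mod_cast this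
          · rw [div_lt_iff₀ hm]
            simpa using h3.1
          · rw [le_div_iff₀ hm]
            exact_mod_cast h3.2
      _ ≤ ∑ i ∈ Finset.range (n * (m + 1)),
            P {ω | 2 ≤ N ω (Ioc (i / (m + 1) : ℝ≥0) ((i + 1) / (m + 1)) ×ˢ B)} :=
          measure_biUnion_finset_le _ _
      _ ≤ ∑ i ∈ Finset.range (n * (m + 1)),
            ENNReal.ofReal ((volume B).toReal * (1 / ((m : ℝ) + 1))) ^ 2 := by
          refine Finset.sum_le_sum fun i _ => ?_
          rw [← hpiece i]
          exact hN.measure_two_le (measurableSet_Ioc.prod hB) (lebesgueHalfPlane_box_ne_top _ _ hB')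
      _ = ENNReal.ofReal (n * (volume B).toReal ^ 2 * (1 / ((m : ℝ) + 1))) := by
          rw [Finset.sum_const, Finset.card_range, nsmul_eq_mul,
            ← ENNReal.ofReal_pow (by positivity), ← ENNReal.ofReal_natCast,
            ← ENNReal.ofReal_mul (by positivity)]
          congr 1
          push_cast
          field_simp
  have hlim : Tendsto (fun m : ℕ =>
      ENNReal.ofReal (n * (volume B).toReal ^ 2 * (1 / ((m : ℝ) + 1)))) atTop (𝓝 0) := by
    have := (tendsto_one_div_add_atTop_nhds_zero_nat (𝕜 := ℝ)).const_mul
      (n * (volume B).toReal ^ 2)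
    rw [mul_zero] at this
    simpa using ENNReal.tendsto_ofReal this
  exact le_antisymm (ge_of_tendsto' hlim key) zero_le

/-- The points are the atoms of mass at least one. Slices of mass below two force each atom to have
mass exactly one and forbid two atoms at one time. A strip of finite height suffices because all
intervals at typical ages lie below the total rate. -/
lemma ae_exists_strip_points (hN : IsPoissonRandomMeasure N lebesgueHalfPlane P) (C : ℝ) :
    ∀ᵐ ω ∂P, ∃ S, IsStripPoints (N ω) C S := by
  have hC : volume (Icc 0 C) ≠ ⊤ := by simp
  have h1 := ae_all_iff.2 fun n : ℕ => ae_atoms_of_box hN n measurableSet_Icc hC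
  have h2 := ae_all_iff.2 fun n : ℕ => ae_time_slice_lt_two hN n measurableSet_Icc hC
  filter_upwards [h1, h2] with ω h1 h2
  choose F hF0 hF1 hF2 using h1
  set S : Set (ℝ≥0 × ℝ) := {z | z ∈ Ioi 0 ×ˢ Icc 0 C ∧ 1 ≤ N ω {z}} with hS
  have hle : ∀ z ∈ Ioi (0 : ℝ≥0) ×ˢ Icc 0 C, ∃ n : ℕ, z ∈ Ioc (0 : ℝ≥0) n ×ˢ Icc 0 C := by
    intro z hz
    obtain ⟨n, hn⟩ := exists_nat_ge z.1
    exact ⟨n, ⟨hz.1, hn⟩, hz.2⟩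
  have hSF : ∀ n : ℕ, S ∩ Ioc 0 (n : ℝ≥0) ×ˢ univ ⊆ F n := by
    rintro n z ⟨⟨hz, hz1⟩, hzn⟩
    by_contra hnot
    have : N ω {z} ≤ 0 := by
      rw [← hF0 n]
      exact measure_mono (singleton_subset_iff.2 ⟨⟨hzn.1, hz.2⟩, hnot⟩)
    simp [le_zero_iff.1 this] at hz1
  have hfin : ∀ t : ℝ≥0, (S ∩ Ioc 0 t ×ˢ univ).Finite := by
    intro t
    obtain ⟨n, hn⟩ := exists_nat_ge t
    refine (F n).finite_toSet.subset (Subset.trans ?_ (hSF n))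
    exact inter_subset_inter_right _ (prod_mono (Ioc_subset_Ioc_right hn) le_rfl)
  have hcount : S.Countable := by
    have : S = ⋃ n : ℕ, S ∩ Ioc 0 (n : ℝ≥0) ×ˢ univ := by
      rw [← inter_iUnion]
      refine (inter_eq_left.2 fun z hz => ?_).symm
      obtain ⟨n, hn⟩ := hle z hz.1
      exact mem_iUnion.2 ⟨n, hn.1, mem_univ _⟩
    rw [this]
    exact countable_iUnion fun n => (hfin n).countable
  have hslice : ∀ z ∈ Ioi (0 : ℝ≥0) ×ˢ Icc 0 C, N ω ({z.1} ×ˢ Icc 0 C) < 2 := by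
    intro z hz
    obtain ⟨n, hn⟩ := hle z hz
    exact h2 n z.1 hn.1
  have hone : ∀ z ∈ S, N ω {z} = 1 := by
    rintro z ⟨hz, hz1⟩
    obtain ⟨n, hn⟩ := hle z hz
    refine le_antisymm (hF2 n z hn ((measure_mono ?_).trans_lt (hslice z hz))) hz1
    exact singleton_subset_iff.2 ⟨rfl, hz.2⟩
  refine ⟨S, fun z hz => hz.1, hfin, ?_, ?_⟩
  · rintro z hz w hw hzw
    by_contra hne
    have : (2 : ℝ≥0∞) ≤ N ω ({z.1} ×ˢ Icc 0 C) := by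
      calc (2 : ℝ≥0∞) = N ω {z} + N ω {w} := by rw [hone z hz, hone w hw, one_add_one_eq_two]
        _ = N ω ({z} ∪ {w}) :=
          (measure_union (by simpa using hne) (measurableSet_singleton w)).symm
        _ ≤ N ω ({z.1} ×ˢ Icc 0 C) := measure_mono (union_subset
          (singleton_subset_iff.2 ⟨rfl, hz.1.2⟩) (singleton_subset_iff.2 ⟨hzw.symm, hw.1.2⟩))
    exact absurd this (not_le.2 (hslice z hz.1))
  · refine eq_count_restrict hcount ?_ fun z hz => ?_
    · rw [Measure.restrict_apply hcount.measurableSet.compl]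
      refine measure_mono_null (t := ⋃ n : ℕ, (Ioc 0 (n : ℝ≥0) ×ˢ Icc 0 C) \ F n) ?_
        (measure_iUnion_null hF0)
      rintro z ⟨hzS, hz⟩
      obtain ⟨n, hn⟩ := hle z hz
      exact mem_iUnion.2 ⟨n, hn, fun h => hzS ⟨hz, (hF1 n z h).2⟩⟩
    · rw [Measure.restrict_apply (measurableSet_singleton z),
        inter_eq_left.2 (singleton_subset_iff.2 hz.1), hone z hz]

/-- No strip can be used here: at an atypical age the intervals may lie at any height. This weaker
fact is what is available before such ages are excluded. -/
lemma ae_exists_countable_times (hN : IsPoissonRandomMeasure N lebesgueHalfPlane P) :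
    ∀ᵐ ω ∂P, ∃ D : Set ℝ≥0, D.Countable ∧ N ω ((Ioi 0 \ D) ×ˢ univ) = 0 := by
  have h1 := ae_all_iff.2 fun n : ℕ => ae_atoms_of_box hN n
    (measurableSet_Icc (a := -(n : ℝ)) (b := n)) (by simp)
  filter_upwards [h1] with ω h1
  choose F hF0 hF1 hF2 using h1
  refine ⟨⋃ n : ℕ, Prod.fst '' (F n : Set (ℝ≥0 × ℝ)),
    countable_iUnion fun n => ((F n).countable_toSet.image _), ?_⟩
  refine measure_mono_null (t := ⋃ n : ℕ, (Ioc 0 (n : ℝ≥0) ×ˢ Icc (-(n : ℝ)) n) \ F n) ?_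
    (measure_iUnion_null hF0)
  rintro z ⟨⟨hz0, hzD⟩, -⟩
  obtain ⟨n, hn⟩ := exists_nat_ge z.1
  obtain ⟨k, hk⟩ := exists_nat_ge |z.2|
  have h2 : |z.2| ≤ (max n k : ℕ) := hk.trans (by exact_mod_cast le_max_right n k)
  refine mem_iUnion.2 ⟨max n k, ⟨⟨hz0, hn.trans (by exact_mod_cast le_max_left n k)⟩,
    abs_le.1 h2⟩, fun h => hzD (mem_iUnion.2 ⟨_, z, h, rfl⟩)⟩

end HalfPlane

/-! ### The predictable σ-algebra and its generating rectangles -/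

section Predictable

variable {Ω : Type*} [mΩ : MeasurableSpace Ω]

/-- The σ-algebra on `([0, ∞) × Ω) × ℝ` for which predictable integrands are measurable. -/
abbrev predProd (ℱ : Filtration ℝ≥0 mΩ) : MeasurableSpace ((ℝ≥0 × Ω) × ℝ) :=
  @Prod.instMeasurableSpace _ _ ℱ.predictable inferInstance

/-- The rectangles generating the predictable σ-algebra. -/
def predRect (ℱ : Filtration ℝ≥0 mΩ) : Set (Set (ℝ≥0 × Ω)) :=
  {s | ∃ A, MeasurableSet[ℱ ⊥] A ∧ s = {⊥} ×ˢ A} ∪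
    {s | ∃ i A, MeasurableSet[ℱ i] A ∧ s = Set.Ioi i ×ˢ A}

lemma isPiSystem_predRect (ℱ : Filtration ℝ≥0 mΩ) : IsPiSystem (predRect ℱ) := by
  rintro _ (⟨A, hA, rfl⟩ | ⟨i, A, hA, rfl⟩) _ (⟨B, hB, rfl⟩ | ⟨j, B, hB, rfl⟩) hne
  · exact Or.inl ⟨A ∩ B, hA.inter hB, by rw [prod_inter_prod, inter_self]⟩
  · obtain ⟨z, hz, hz'⟩ := hne
    have h1 : z.1 = ⊥ := hz.1
    have h2 : j < z.1 := hz'.1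
    exact absurd (h1 ▸ h2) not_lt_bot
  · obtain ⟨z, hz', hz⟩ := hne
    have h1 : z.1 = ⊥ := hz.1
    have h2 : i < z.1 := hz'.1
    exact absurd (h1 ▸ h2) not_lt_bot
  · refine Or.inr ⟨i ⊔ j, A ∩ B, ?_, by rw [prod_inter_prod, Ioi_inter_Ioi]⟩
    exact (ℱ.mono le_sup_left _ hA).inter (ℱ.mono le_sup_right _ hB)

lemma isCountablySpanning_predRect (ℱ : Filtration ℝ≥0 mΩ) : IsCountablySpanning (predRect ℱ) := by
  refine ⟨fun n => if n = 0 then {⊥} ×ˢ univ else Ioi 0 ×ˢ univ, fun n => ?_, ?_⟩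
  · dsimp only
    split_ifs
    · exact Or.inl ⟨univ, MeasurableSet.univ, rfl⟩
    · exact Or.inr ⟨0, univ, MeasurableSet.univ, rfl⟩
  · refine eq_univ_of_forall fun z => ?_
    rcases eq_or_ne z.1 0 with h | h
    · exact mem_iUnion.2 ⟨0, by simp [h]⟩
    · exact mem_iUnion.2 ⟨1, by simp [pos_iff_ne_zero.2 h]⟩

lemma predProd_eq_generateFrom (ℱ : Filtration ℝ≥0 mΩ) :
    predProd ℱ = MeasurableSpace.generateFrom
      (image2 (· ×ˢ ·) (predRect ℱ) {t : Set ℝ | MeasurableSet t}) := by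
  rw [← generateFrom_prod_eq (isCountablySpanning_predRect ℱ) isCountablySpanning_measurableSet,
    MeasurableSpace.generateFrom_measurableSet]
  rfl

lemma isPiSystem_predProd (ℱ : Filtration ℝ≥0 mΩ) :
    IsPiSystem (image2 (· ×ˢ ·) (predRect ℱ) {t : Set ℝ | MeasurableSet t}) :=
  (isPiSystem_predRect ℱ).prod MeasurableSpace.isPiSystem_measurableSet

lemma predictable_le (ℱ : Filtration ℝ≥0 mΩ) :
    ℱ.predictable ≤ (inferInstance : MeasurableSpace (ℝ≥0 × Ω)) :=
  measurableSpace_le_predictable_of_measurableSet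
    (fun _ hA => (measurableSet_singleton _).prod (ℱ.le _ _ hA))
    (fun _ _ hA => measurableSet_Ioi.prod (ℱ.le _ _ hA))

lemma predProd_le (ℱ : Filtration ℝ≥0 mΩ) :
    predProd ℱ ≤ (inferInstance : MeasurableSpace ((ℝ≥0 × Ω) × ℝ)) :=
  sup_le_sup (MeasurableSpace.comap_mono (predictable_le ℱ)) le_rfl

end Predictable

/-! ### The compensation formula -/

section Compensation

variable {Ω : Type*} [mΩ : MeasurableSpace Ω] {P : Measure Ω}
  {ℱ : Filtration ℝ≥0 mΩ} {N : Ω → Measure (ℝ≥0 × ℝ)}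

lemma measurableSet_apply_eq (hN : IsPoissonRandomMeasure N lebesgueHalfPlane P)
    {A : Set (ℝ≥0 × ℝ)} (hA : MeasurableSet A) (m : ℕ) : MeasurableSet {ω | N ω A = m} :=
  hN.measurable_apply hA (measurableSet_singleton (m : ℝ≥0∞))

/-- The restriction of the random measure to the set `A` if its mass there is `m`, and zero
otherwise. -/
def levelKernel (hN : IsPoissonRandomMeasure N lebesgueHalfPlane P) {A : Set (ℝ≥0 × ℝ)}
    (hA : MeasurableSet A) (m : ℕ) : Kernel Ω (ℝ≥0 × ℝ) :=
  Kernel.piecewise (measurableSet_apply_eq hN hA m) (Kernel.restrict ⟨N, hN.measurable⟩ hA) 0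

instance (hN : IsPoissonRandomMeasure N lebesgueHalfPlane P) {A : Set (ℝ≥0 × ℝ)}
    (hA : MeasurableSet A) (m : ℕ) : IsFiniteKernel (levelKernel hN hA m) := by
  refine ⟨⟨m, ENNReal.natCast_lt_top m, fun ω => ?_⟩⟩
  rw [levelKernel, Kernel.piecewise_apply]
  split_ifs with h
  · rw [Kernel.restrict_apply, Measure.restrict_apply_univ]
    exact le_of_eq h
  · simp

/-- The restriction of the random measure to the box `(s, t] × B`, as a kernel. -/
def boxKernel (hN : IsPoissonRandomMeasure N lebesgueHalfPlane P) (s t : ℝ≥0) {B : Set ℝ}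
    (hB : MeasurableSet B) : Kernel Ω (ℝ≥0 × ℝ) :=
  Kernel.sum (levelKernel hN (measurableSet_Ioc.prod hB : MeasurableSet (Ioc s t ×ˢ B)))

instance (hN : IsPoissonRandomMeasure N lebesgueHalfPlane P) (s t : ℝ≥0) {B : Set ℝ}
    (hB : MeasurableSet B) : IsSFiniteKernel (boxKernel hN s t hB) := by
  unfold boxKernel; infer_instance

/-- A composition product needs a kernel that is s-finite at every ω, whereas the noise has finite
mass on a box only almost surely. Summing over the possible integer masses discards the exceptional
null set. -/
lemma boxKernel_ae_eq (hN : IsPoissonRandomMeasure N lebesgueHalfPlane P) (s t : ℝ≥0) {B : Set ℝ}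
    (hB : MeasurableSet B) (hB' : volume B ≠ ⊤) :
    ∀ᵐ ω ∂P, boxKernel hN s t hB ω = (N ω).restrict (Ioc s t ×ˢ B) := by
  filter_upwards [hN.ae_exists_natCast (measurableSet_Ioc.prod hB)
    (lebesgueHalfPlane_box_ne_top s t hB')] with ω ⟨m, hm⟩
  ext A hA
  rw [boxKernel, Kernel.sum_apply, Measure.sum_apply _ hA, tsum_eq_single m]
  · rw [levelKernel, Kernel.piecewise_apply, 
      if_pos (show ω ∈ {ω | N ω (Ioc s t ×ˢ B) = m} from hm), Kernel.restrict_apply]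
    rfl
  · intro k hk
    have hne : ω ∉ {ω | N ω (Ioc s t ×ˢ B) = k} := by
      intro h
      have h' : N ω (Ioc s t ×ˢ B) = k := h
      rw [hm] at h'
      exact hk (by exact_mod_cast h'.symm)
    rw [levelKernel, Kernel.piecewise_apply, if_neg hne]
    simp

lemma setLIntegral_apply_of_indep (hN : IsPoissonRandomMeasure N lebesgueHalfPlane P)
    (hNℱ : IsCompatible N ℱ P) {r : ℝ≥0} {A : Set Ω} (hA : MeasurableSet[ℱ r] A)
    {D : Set (ℝ≥0 × ℝ)} (hD : MeasurableSet D) (hDr : D ⊆ Ioi r ×ˢ univ)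
    (hD' : lebesgueHalfPlane D ≠ ⊤) :
    ∫⁻ ω in A, N ω D ∂P = P A * lebesgueHalfPlane D := by
  have hrestr : ∀ ω, N ω D = (N ω).restrict (Ioi r ×ˢ univ) D := fun ω => by
    rw [Measure.restrict_apply hD, inter_eq_left.2 hDr]
  have hmeas : Measurable fun ω => (N ω).restrict (Ioi r ×ˢ univ) :=
    (Kernel.restrict ⟨N, hN.measurable⟩ (measurableSet_Ioi.prod .univ)).measurable
  have hg : Measurable[MeasurableSpace.comap (fun ω => (N ω).restrict (Ioi r ×ˢ univ))
      inferInstance] fun ω => N ω D := by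
    simp_rw [hrestr]
    exact (Measure.measurable_coe hD).comp (comap_measurable _)
  have hf : Measurable[ℱ r] (A.indicator fun _ => (1 : ℝ≥0∞)) := measurable_const.indicator hA
  have h := lintegral_mul_eq_lintegral_mul_lintegral_of_independent_measurableSpace
    (ℱ.le r) hmeas.comap_le (hNℱ.indep r) hf hg
  rw [hN.lintegral_apply hD hD', lintegral_indicator_const (ℱ.le r _ hA), one_mul] at h
  rw [← h, ← lintegral_indicator (ℱ.le r _ hA)]
  exact lintegral_congr fun ω => by by_cases hω : ω ∈ A <;> simp [hω]

/-- Regrouping of the coordinates. -/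
def regroup (p : Ω × (ℝ≥0 × ℝ)) : (ℝ≥0 × Ω) × ℝ := ((p.2.1, p.1), p.2.2)

lemma measurable_regroup : Measurable (regroup : Ω × (ℝ≥0 × ℝ) → (ℝ≥0 × Ω) × ℝ) := by
  unfold regroup; fun_prop

variable [IsProbabilityMeasure P]

/-- Both measures are finite, so it suffices to compare them on generating rectangles. For (i, ∞) ×
A with A known at time i, the noise after i is independent of A and the expected mass factors;
rectangles at time zero miss the box. The comparison is made only on predictable sets, where this
independence is available. -/
lemma trim_map_boxKernel (hN : IsPoissonRandomMeasure N lebesgueHalfPlane P)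
    (hNℱ : IsCompatible N ℱ P) (s t : ℝ≥0) {B : Set ℝ} (hB : MeasurableSet B)
    (hB' : volume B ≠ ⊤) :
    ((P ⊗ₘ boxKernel hN s t hB).map regroup).trim (predProd_le ℱ) =
      ((P.prod (lebesgueHalfPlane.restrict (Ioc s t ×ˢ B))).map regroup).trim (predProd_le ℱ) := by
  have hbox : MeasurableSet (Ioc s t ×ˢ B) := measurableSet_Ioc.prod hB
  have hae := boxKernel_ae_eq hN s t hB hB'
  have hrect : ∀ (A : Set Ω), MeasurableSet A → ∀ D : Set (ℝ≥0 × ℝ), MeasurableSet D →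
      (P ⊗ₘ boxKernel hN s t hB) (A ×ˢ D) = ∫⁻ ω in A, N ω (D ∩ Ioc s t ×ˢ B) ∂P := by
    intro A hA D hD
    rw [Measure.compProd_apply_prod hA hD]
    refine setLIntegral_congr_fun_ae hA ?_
    filter_upwards [hae] with ω hω _
    rw [hω, Measure.restrict_apply hD]
  have huniv : (P ⊗ₘ boxKernel hN s t hB) univ = lebesgueHalfPlane (Ioc s t ×ˢ B) := by
    rw [← univ_prod_univ, hrect univ .univ univ .univ, univ_inter, setLIntegral_univ,
      hN.lintegral_apply hbox (lebesgueHalfPlane_box_ne_top s t hB')]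
  have hfin : IsFiniteMeasure (P ⊗ₘ boxKernel hN s t hB) := by
    refine ⟨?_⟩
    rw [huniv]
    exact (lebesgueHalfPlane_box_ne_top s t hB').lt_top
  have key : ∀ E ∈ image2 (· ×ˢ ·) (predRect ℱ) {t : Set ℝ | MeasurableSet t},
      (P ⊗ₘ boxKernel hN s t hB) (regroup ⁻¹' E) =
        (P.prod (lebesgueHalfPlane.restrict (Ioc s t ×ˢ B))) (regroup ⁻¹' E) := by
    rintro _ ⟨_, ⟨A, hA, rfl⟩ | ⟨i, A, hA, rfl⟩, B', hB'm, rfl⟩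
    · have hpre : (regroup ⁻¹' (({⊥} ×ˢ A) ×ˢ B') : Set (Ω × (ℝ≥0 × ℝ))) =
          A ×ˢ ({⊥} ×ˢ B') := by ext; simp [regroup]; tauto
      have hD : MeasurableSet (({⊥} : Set ℝ≥0) ×ˢ B') := (measurableSet_singleton _).prod hB'm
      have hempty : ({⊥} : Set ℝ≥0) ×ˢ B' ∩ Ioc s t ×ˢ B = ∅ := by
        rw [prod_inter_prod, disjoint_iff_inter_eq_empty.1, empty_prod]
        exact disjoint_singleton_left.2 fun h => not_lt_bot h.1
      dsimp only
      rw [hpre, hrect A (ℱ.le _ _ hA) _ hD, Measure.prod_prod, Measure.restrict_apply hD, hempty]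
      simp
    · have hpre : (regroup ⁻¹' ((Ioi i ×ˢ A) ×ˢ B') : Set (Ω × (ℝ≥0 × ℝ))) =
          A ×ˢ (Ioi i ×ˢ B') := by ext; simp [regroup]; tauto
      have hD : MeasurableSet ((Ioi i : Set ℝ≥0) ×ˢ B') := measurableSet_Ioi.prod hB'm
      dsimp only
      rw [hpre, hrect A (ℱ.le _ _ hA) _ hD, Measure.prod_prod, Measure.restrict_apply hD]
      refine setLIntegral_apply_of_indep hN hNℱ hA (hD.inter hbox)
        (inter_subset_left.trans (prod_mono le_rfl (subset_univ _))) ?_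
      exact measure_ne_top_of_subset inter_subset_right (lebesgueHalfPlane_box_ne_top s t hB')
  have hmap : ∀ (μ : Measure (Ω × (ℝ≥0 × ℝ))) (E : Set ((ℝ≥0 × Ω) × ℝ)),
      MeasurableSet[predProd ℱ] E →
      ((μ.map regroup).trim (predProd_le ℱ)) E = μ (regroup ⁻¹' E) := fun μ E hE => by
    rw [trim_measurableSet_eq _ hE, Measure.map_apply measurable_regroup (predProd_le ℱ _ hE)]
  have : IsFiniteMeasure ((P ⊗ₘ boxKernel hN s t hB).map regroup) :=
    Measure.isFiniteMeasure_map _ _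
  refine ext_of_generate_finite _ (predProd_eq_generateFrom ℱ) (isPiSystem_predProd ℱ)
    (fun E hE => ?_) ?_
  · have hEm : MeasurableSet[predProd ℱ] E := by
      rw [predProd_eq_generateFrom]
      exact MeasurableSpace.measurableSet_generateFrom hE
    rw [hmap _ E hEm, hmap _ E hEm]
    exact key E hE
  · rw [hmap _ _ MeasurableSet.univ, hmap _ _ MeasurableSet.univ, preimage_univ, huniv,
      ← univ_prod_univ, Measure.prod_prod]
    simp

lemma lintegral_compensation_box (hN : IsPoissonRandomMeasure N lebesgueHalfPlane P)
    (hNℱ : IsCompatible N ℱ P) {H : (ℝ≥0 × Ω) × ℝ → ℝ≥0∞} (hH : Measurable[predProd ℱ] H)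
    (s t : ℝ≥0) {B : Set ℝ} (hB : MeasurableSet B) (hB' : volume B ≠ ⊤) :
    AEMeasurable (fun ω => ∫⁻ z in Ioc s t ×ˢ B, H ((z.1, ω), z.2) ∂(N ω)) P ∧
      ∫⁻ ω, ∫⁻ z in Ioc s t ×ˢ B, H ((z.1, ω), z.2) ∂(N ω) ∂P =
        ∫⁻ ω, ∫⁻ z in Ioc s t ×ˢ B, H ((z.1, ω), z.2) ∂lebesgueHalfPlane ∂P := by
  have hH' : Measurable H := hH.mono (predProd_le ℱ) le_rfl
  have hHr : Measurable fun p : Ω × (ℝ≥0 × ℝ) => H (regroup p) := hH'.comp measurable_regroup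
  have hae : (fun ω => ∫⁻ z, H (regroup (ω, z)) ∂(boxKernel hN s t hB ω)) =ᵐ[P]
      fun ω => ∫⁻ z in Ioc s t ×ˢ B, H ((z.1, ω), z.2) ∂(N ω) := by
    filter_upwards [boxKernel_ae_eq hN s t hB hB'] with ω hω
    rw [hω]
    rfl
  refine ⟨⟨_, Measurable.lintegral_kernel_prod_right' hHr, hae.symm⟩, ?_⟩
  rw [← lintegral_congr_ae hae, ← Measure.lintegral_compProd hHr,
    ← lintegral_map hH' measurable_regroup, ← lintegral_trim (predProd_le ℱ) hH,
    trim_map_boxKernel hN hNℱ s t hB hB', lintegral_trim (predProd_le ℱ) hH,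
    lintegral_map hH' measurable_regroup, lintegral_prod _ hHr.aemeasurable]
  rfl

/-- The compensation formula: a predictable integrand has the same expected integral with respect
to the Poisson random measure and with respect to its intensity. -/
theorem lintegral_compensation (hN : IsPoissonRandomMeasure N lebesgueHalfPlane P)
    (hNℱ : IsCompatible N ℱ P) {H : (ℝ≥0 × Ω) × ℝ → ℝ≥0∞} (hH : Measurable[predProd ℱ] H) :
    AEMeasurable (fun ω => ∫⁻ z in Ioi 0 ×ˢ univ, H ((z.1, ω), z.2) ∂(N ω)) P ∧
      ∫⁻ ω, ∫⁻ z in Ioi 0 ×ˢ univ, H ((z.1, ω), z.2) ∂(N ω) ∂P =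
        ∫⁻ ω, ∫⁻ z in Ioi 0 ×ˢ univ, H ((z.1, ω), z.2) ∂lebesgueHalfPlane ∂P := by
  set box : ℕ × ℤ → Set (ℝ≥0 × ℝ) := fun b =>
    Ioc (b.1 : ℝ≥0) (b.1 + 1) ×ˢ Ioc (b.2 : ℝ) (b.2 + 1) with hbox
  have hmeas : ∀ b, MeasurableSet (box b) := fun b => measurableSet_Ioc.prod measurableSet_Ioc
  have hdisj : Pairwise (Function.onFun Disjoint box) := by
    rintro ⟨a, b⟩ ⟨c, d⟩ hne
    rw [Function.onFun, Set.disjoint_left]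
    rintro ⟨x, y⟩ ⟨⟨h1, h2⟩, h3, h4⟩ ⟨⟨h5, h6⟩, h7, h8⟩
    refine hne (Prod.ext ?_ ?_)
    · have h9 : (a : ℝ≥0) < ((c + 1 : ℕ) : ℝ≥0) := by push_cast; exact h1.trans_le h6
      have h10 : (c : ℝ≥0) < ((a + 1 : ℕ) : ℝ≥0) := by push_cast; exact h5.trans_le h2
      have := Nat.cast_lt.1 h9
      have := Nat.cast_lt.1 h10
      dsimp only
      omega
    · have h9 : (b : ℝ) < ((d + 1 : ℤ) : ℝ) := by push_cast; exact h3.trans_le h8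
      have h10 : (d : ℝ) < ((b + 1 : ℤ) : ℝ) := by push_cast; exact h7.trans_le h4
      have := Int.cast_lt.1 h9
      have := Int.cast_lt.1 h10
      dsimp only
      omega
  have hunion : (Ioi (0 : ℝ≥0)) ×ˢ (univ : Set ℝ) = ⋃ b, box b := by
    ext z
    simp only [mem_prod, mem_Ioi, mem_univ, and_true, mem_iUnion, hbox, mem_Ioc, Prod.exists]
    constructor
    · intro hz
      obtain ⟨i, hi⟩ : ∃ i, ⌈z.1⌉₊ = i + 1 :=
        Nat.exists_eq_succ_of_ne_zero (Nat.ceil_pos.2 hz).ne'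
      have h3 := (Nat.ceil_eq_iff (Nat.succ_ne_zero i)).1 hi
      refine ⟨i, ⌈z.2⌉ - 1, ⟨by simpa using h3.1, by exact_mod_cast h3.2⟩, ?_, ?_⟩
      · push_cast
        linarith [Int.ceil_lt_add_one z.2]
      · push_cast
        linarith [Int.le_ceil z.2]
    · rintro ⟨a, b, ⟨h1, -⟩, -⟩
      exact (zero_le).trans_lt h1
  have hb := fun b : ℕ × ℤ => lintegral_compensation_box hN hNℱ hH b.1 (b.1 + 1)
    (measurableSet_Ioc (a := (b.2 : ℝ)) (b := b.2 + 1)) (by simp)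
  have hsplit : ∀ (μ : Measure (ℝ≥0 × ℝ)) (ω : Ω),
      ∫⁻ z in Ioi 0 ×ˢ univ, H ((z.1, ω), z.2) ∂μ =
        ∑' b, ∫⁻ z in box b, H ((z.1, ω), z.2) ∂μ := fun μ ω => by
    rw [hunion, lintegral_iUnion hmeas hdisj]
  have hH' : Measurable H := hH.mono (predProd_le ℱ) le_rfl
  have hHr : Measurable fun p : Ω × (ℝ≥0 × ℝ) => H ((p.2.1, p.1), p.2.2) :=
    hH'.comp measurable_regroup
  simp_rw [hsplit]
  refine ⟨AEMeasurable.tsum fun b => (hb b).1, ?_⟩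
  rw [lintegral_tsum fun b => (hb b).1, lintegral_tsum fun b => ?_]
  · exact tsum_congr fun b => (hb b).2
  · exact (Measurable.lintegral_prod_right' (ν := lebesgueHalfPlane.restrict (box b))
      hHr).aemeasurable

end Compensation

/-! ### Processes of left limits are predictable -/

section LeftProcess

variable {Ω E : Type*}

open Classical in
/-- The process of left limits of `Z`, on the event `G`. -/
def leftProcess [TopologicalSpace E] (Z : ℝ≥0 → Ω → E) (G : Set Ω) (p : ℝ≥0 × Ω) : E :=
  if p.2 ∈ G then Function.leftLim (fun s => Z s p.2) p.1 else Z 0 p.2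

lemma leftProcess_of_mem [TopologicalSpace E] {Z : ℝ≥0 → Ω → E} {G : Set Ω} {ω : Ω} (hω : ω ∈ G)
    (u : ℝ≥0) : leftProcess Z G (u, ω) = Function.leftLim (fun s => Z s ω) u := by
  simp [leftProcess, hω]

end LeftProcess

section LeftLimits

variable {Ω : Type*} [mΩ : MeasurableSpace Ω] {ℱ : Filtration ℝ≥0 mΩ} {E : Type*}

/-- The last point strictly before `u` of the grid of mesh `1 / (n + 1)`. -/
def gridBefore (n : ℕ) (u : ℝ≥0) : ℝ≥0 := ((⌈u * (n + 1)⌉₊ - 1 : ℕ) : ℝ≥0) / (n + 1)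

lemma gridBefore_zero (n : ℕ) : gridBefore n 0 = 0 := by simp [gridBefore]

lemma gridBefore_lt (n : ℕ) {u : ℝ≥0} (hu : 0 < u) : gridBefore n u < u := by
  have hn : (0 : ℝ≥0) < n + 1 := by positivity
  have h0 : ⌈u * (n + 1)⌉₊ ≠ 0 := (Nat.ceil_pos.2 (mul_pos hu hn)).ne'
  rw [gridBefore, div_lt_iff₀ hn]
  exact ((Nat.ceil_eq_iff h0).1 rfl).1

lemma le_gridBefore_add (n : ℕ) (u : ℝ≥0) : u ≤ gridBefore n u + 1 / (n + 1) := by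
  have hn : (0 : ℝ≥0) < n + 1 := by positivity
  rw [gridBefore, ← add_div, le_div_iff₀ hn]
  refine (Nat.le_ceil _).trans ?_
  have : ⌈u * (n + 1)⌉₊ ≤ (⌈u * (n + 1)⌉₊ - 1 : ℕ) + 1 := by omega
  exact_mod_cast this

lemma tendsto_gridBefore {u : ℝ≥0} (hu : 0 < u) :
    Tendsto (fun n => gridBefore n u) atTop (𝓝[<] u) := by
  refine tendsto_nhdsWithin_iff.2 ⟨?_, Eventually.of_forall fun n => gridBefore_lt n hu⟩
  rw [← NNReal.tendsto_coe]
  have h1 : Tendsto (fun n : ℕ => (u : ℝ) - 1 / ((n : ℝ) + 1)) atTop (𝓝 u) := by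
    simpa using (tendsto_const_nhds (x := (u : ℝ))).sub
      (tendsto_one_div_add_atTop_nhds_zero_nat (𝕜 := ℝ))
  refine tendsto_of_tendsto_of_tendsto_of_le_of_le h1 tendsto_const_nhds (fun n => ?_)
    fun n => (gridBefore_lt n hu).le
  have h2 : (u : ℝ) ≤ gridBefore n u + 1 / ((n : ℝ) + 1) := by
    exact_mod_cast le_gridBefore_add n u
  simpa [sub_le_iff_le_add] using h2

/-- On each interval between consecutive grid points, open on the left, the sampled process is
frozen at a value known at the left end point. -/
lemma measurable_comp_gridBefore [MeasurableSpace E] {Z : ℝ≥0 → Ω → E} (hZ : Adapted ℱ Z)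
    (n : ℕ) : Measurable[ℱ.predictable] fun p : ℝ≥0 × Ω => Z (gridBefore n p.1) p.2 := by
  intro A hA
  have hn : (0 : ℝ≥0) < n + 1 := by positivity
  have : (fun p : ℝ≥0 × Ω => Z (gridBefore n p.1) p.2) ⁻¹' A =
      {⊥} ×ˢ (Z 0 ⁻¹' A) ∪ ⋃ k : ℕ, Ioc ((k : ℝ≥0) / (n + 1)) ((k + 1 : ℕ) / (n + 1)) ×ˢ
        (Z ((k : ℝ≥0) / (n + 1)) ⁻¹' A) := by
    ext ⟨u, ω⟩
    simp only [mem_preimage, mem_union, mem_prod, mem_singleton_iff, mem_iUnion]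
    rcases eq_or_lt_of_le (zero_le (a := u)) with rfl | hu
    · simp [gridBefore_zero]
    · have h0 : ⌈u * (n + 1)⌉₊ ≠ 0 := (Nat.ceil_pos.2 (mul_pos hu hn)).ne'
      have key : ∀ k : ℕ, u ∈ Ioc ((k : ℝ≥0) / (n + 1)) ((k + 1 : ℕ) / (n + 1)) ↔
          ⌈u * (n + 1)⌉₊ - 1 = k := by
        intro k
        have h1 : ⌈u * (n + 1)⌉₊ - 1 = k ↔ ⌈u * (n + 1)⌉₊ = k + 1 := by omega
        rw [h1, Nat.ceil_eq_iff (Nat.succ_ne_zero k), mem_Ioc, div_lt_iff₀ hn, le_div_iff₀ hn]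
        simp
      simp only [key, bot_eq_zero, hu.ne', false_and, false_or, exists_eq_left', gridBefore]
  rw [this]
  refine MeasurableSet.union (measurableSet_predictable_singleton_bot_prod (hZ 0 hA))
    (MeasurableSet.iUnion fun k => ?_)
  exact measurableSet_predictable_Ioc_prod _ _ (hZ _ hA)

open Classical in
-- The left limit is the limit of the values sampled on ever finer grids. Outside `G` the process is
-- frozen at its initial value, so that the limit exists at every ω.
lemma measurable_leftProcess [TopologicalSpace E] [TopologicalSpace.PseudoMetrizableSpace E]
    [MeasurableSpace E] [BorelSpace E] {Z : ℝ≥0 → Ω → E} (hZ : Adapted ℱ Z) {G : Set Ω}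
    (hG : MeasurableSet[ℱ 0] G) (hlim : ∀ ω ∈ G, ∀ t, ∃ l, Tendsto (fun s => Z s ω) (𝓝[<] t) (𝓝 l)) :
    Measurable[ℱ.predictable] (leftProcess Z G) := by
  set Z' : ℝ≥0 → Ω → E := fun t ω => if ω ∈ G then Z t ω else Z 0 ω with hZ'
  have hZ'a : Adapted ℱ Z' := fun t =>
    Measurable.ite (ℱ.mono (zero_le (a := t)) _ hG) (hZ t)
      ((hZ 0).mono (ℱ.mono (zero_le (a := t))) le_rfl)
  refine @measurable_of_tendsto_metrizable _ _ (ℱ.predictable) _ _ _ _ _ _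
    (fun n => measurable_comp_gridBefore hZ'a n) ?_
  rw [tendsto_pi_nhds]
  rintro ⟨u, ω⟩
  by_cases hω : ω ∈ G
  · simp only [leftProcess, hZ', hω, if_true]
    rcases eq_or_lt_of_le (zero_le (a := u)) with rfl | hu
    · simp only [gridBefore_zero]
      -- At time zero nothing lies to the left, and `leftLim` takes its default value, that of the
      -- process at zero; the grid samples give the same value.
      rw [leftLim_eq_of_eq_bot]
      · exact tendsto_const_nhds
      · have : Iio (0 : ℝ≥0) = ∅ := by ext; simp
        rw [this, nhdsWithin_empty]
    · exact (tendsto_leftLim_of_tendsto (hlim ω hω u)).comp (tendsto_gridBefore hu)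
  · simp only [leftProcess, hZ', hω, if_false]
    exact tendsto_const_nhds

end LeftLimits

/-! ### The age avoids a given null set at almost every time -/

section SingularDrift

open Function in
/-- A function with derivative one almost everywhere pulls null sets back to null sets. -/
lemma measure_preimage_null_of_ae_hasDerivAt {f : ℝ → ℝ} {s : Set ℝ}
    (hf : ∀ᵐ x, x ∈ s → HasDerivAt f 1 x) {B : Set ℝ} (hB : volume B = 0) :
    volume (s ∩ f ⁻¹' B) = 0 := by
  set t : Set ℝ := {x | x ∈ s ∧ HasDerivAt f 1 x ∧ f x ∈ B} with ht
  suffices h : volume t = 0 by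
    refine measure_mono_null (t := t ∪ {x | ¬ (x ∈ s → HasDerivAt f 1 x)}) ?_
      (measure_union_null h hf)
    rintro x ⟨hx, hxB⟩
    by_cases hd : HasDerivAt f 1 x
    · exact Or.inl ⟨hx, hd, hxB⟩
    · exact Or.inr fun h => hd (h hx)
  -- On a set where f is close enough to a linear map of determinant 1, it shrinks measure by at
  -- most the factor 1/2. Countably many such sets cover t, and their images lie in the null set B.
  have hδ := (mul_le_addHaar_image_of_lt_det (volume : Measure ℝ)
    (ContinuousLinearMap.toSpanSingleton ℝ (1 : ℝ)) (m := 1 / 2) (by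
      have : (ContinuousLinearMap.toSpanSingleton ℝ (1 : ℝ)).det = 1 := by
        simp [ContinuousLinearMap.det]
      rw [this]
      norm_num)).and self_mem_nhdsWithin
  obtain ⟨δ, hδ, hδ0⟩ := hδ.exists
  obtain ⟨u, A, -, -, hcover, happrox, hA⟩ :=
    exists_partition_approximatesLinearOn_of_hasFDerivWithinAt f t
      (fun _ => ContinuousLinearMap.toSpanSingleton ℝ (1 : ℝ))
      (fun x hx => hx.2.1.hasFDerivAt.hasFDerivWithinAt) (fun _ => δ) (fun _ => (ne_of_gt hδ0))
  rcases t.eq_empty_or_nonempty with h0 | hne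
  · rw [h0, measure_empty]
  refine measure_mono_null (t := ⋃ n, t ∩ u n) ?_ (measure_iUnion_null fun n => ?_)
  · rw [← inter_iUnion]
    exact subset_inter le_rfl hcover
  · obtain ⟨y, -, hy⟩ := hA hne n
    have h1 := hδ (t ∩ u n) f (hy ▸ happrox n)
    have h2 : volume (f '' (t ∩ u n)) = 0 := by
      refine measure_mono_null ?_ hB
      rintro _ ⟨x, hx, rfl⟩
      exact hx.1.2.2
    rw [h2] at h1
    simpa using h1

/-- A nondecreasing function whose increments are given by a finite measure carried by a countable
set has derivative zero almost everywhere. -/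
lemma ae_hasDerivAt_zero_of_countable {F : ℝ → ℝ} {α : Measure ℝ} [IsFiniteMeasure α]
    {D : Set ℝ} (hD : D.Countable) (hα : α Dᶜ = 0) {s : Set ℝ} (hs : IsOpen s)
    (hF : ∀ x ∈ s, ∀ y ∈ s, x ≤ y → F x ≤ F y ∧ F y - F x ≤ (α (Ioc x y)).toReal) :
    ∀ᵐ x, x ∈ s → HasDerivAt F 0 x := by
  -- A measure carried by a countable set is singular, so its density relative to Lebesgue measure,
  -- computed on small balls, vanishes almost everywhere. The difference quotients of F are at most
  -- twice these ball quotients, since a ball of radius r has length 2r.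
  have hsing : α ⟂ₘ volume := ⟨Dᶜ, hD.measurableSet.compl, hα, by
    rw [compl_compl]; exact hD.measure_zero _⟩
  filter_upwards [Besicovitch.ae_tendsto_rnDeriv α volume, hsing.rnDeriv_ae_eq_zero] with x hx h0 hxs
  rw [h0] at hx
  have h1 : Tendsto (fun r : ℝ => (α (Metric.closedBall x r)).toReal / (2 * r)) (𝓝[>] 0) (𝓝 0) := by
    have h2 := (ENNReal.tendsto_toReal ENNReal.zero_ne_top).comp hx
    refine h2.congr' ?_
    filter_upwards [self_mem_nhdsWithin] with r hr
    have hr' : (0 : ℝ) < r := hr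
    simp only [Function.comp, Real.volume_closedBall, ENNReal.toReal_div]
    rw [ENNReal.toReal_ofReal (by positivity)]
  have h3 : Tendsto (fun y : ℝ => |y - x|) (𝓝[≠] x) (𝓝[>] 0) := by
    refine tendsto_nhdsWithin_iff.2 ⟨?_, ?_⟩
    · have : Tendsto (fun y : ℝ => |y - x|) (𝓝 x) (𝓝 |x - x|) :=
        (continuous_abs.comp (continuous_id.sub continuous_const)).tendsto x
      rw [sub_self, abs_zero] at this
      exact this.mono_left nhdsWithin_le_nhds
    · filter_upwards [self_mem_nhdsWithin] with y hy
      exact abs_pos.2 (sub_ne_zero.2 hy)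
  have h4 := (h1.comp h3).const_mul 2
  rw [mul_zero] at h4
  rw [hasDerivAt_iff_tendsto_slope]
  refine squeeze_zero_norm' ?_ h4
  filter_upwards [mem_nhdsWithin_of_mem_nhds (hs.mem_nhds hxs), self_mem_nhdsWithin] with y hys hy
  have hpos : 0 < |y - x| := abs_pos.2 (sub_ne_zero.2 hy)
  have h5 : |F y - F x| ≤ (α (Metric.closedBall x |y - x|)).toReal := by
    rcases le_total x y with h | h
    · obtain ⟨h6, h7⟩ := hF x hxs y hys h
      rw [abs_of_nonneg (sub_nonneg.2 h6)]
      refine h7.trans (ENNReal.toReal_mono (measure_ne_top _ _) (measure_mono ?_))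
      rw [abs_of_nonneg (sub_nonneg.2 h), Real.closedBall_eq_Icc]
      intro w hw
      exact ⟨by linarith [hw.1], by linarith [hw.2]⟩
    · obtain ⟨h6, h7⟩ := hF y hys x hxs h
      rw [abs_sub_comm, abs_of_nonneg (sub_nonneg.2 h6)]
      refine h7.trans (ENNReal.toReal_mono (measure_ne_top _ _) (measure_mono ?_))
      rw [abs_sub_comm, abs_of_nonneg (sub_nonneg.2 h), Real.closedBall_eq_Icc]
      intro w hw
      exact ⟨by linarith [hw.1], by linarith [hw.2]⟩
  rw [slope_def_field, Real.norm_eq_abs, abs_div]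
  simp only [Function.comp]
  rw [← mul_div_assoc, mul_div_mul_left _ _ two_ne_zero]
  gcongr

/-- If `Y` is unit drift minus an integral with respect to a measure carried by countably many
times, then the left limits of `Y` avoid any given null set at almost every time. -/
lemma ae_leftLim_notMem {μ : Measure (ℝ≥0 × ℝ)} {D : Set ℝ≥0} (hD : D.Countable)
    (hμ : μ ((Ioi 0 \ D) ×ˢ univ) = 0) {g : ℝ≥0 × ℝ → ℝ} (hg : ∀ z, 0 ≤ g z) {Y : ℝ≥0 → ℝ≥0}
    (hint : ∀ t : ℝ≥0, IntegrableOn g (Ioc 0 t ×ˢ univ) μ)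
    (hY : ∀ t : ℝ≥0, (Y t : ℝ) = Y 0 + t - ∫ z in Ioc 0 t ×ˢ univ, g z ∂μ)
    {B : Set ℝ} (hB : volume B = 0) :
    ∀ᵐ u ∂lebesgueHalfLine, 0 < u → ((Function.leftLim Y u : ℝ≥0) : ℝ) ∉ B := by
  set Yr : ℝ → ℝ := fun x => Y x.toNNReal with hYr
  set F : ℝ → ℝ := fun x => ∫ z in Ioc 0 x.toNNReal ×ˢ univ, g z ∂μ with hF
  have hderiv : ∀ n : ℕ, ∀ᵐ x : ℝ, x ∈ Ioo (0 : ℝ) n → HasDerivAt Yr 1 x := by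
    intro n
    set box : Set (ℝ≥0 × ℝ) := Ioc 0 (n : ℝ≥0) ×ˢ univ with hbox
    have hboxm : MeasurableSet box := measurableSet_Ioc.prod .univ
    -- On (0, n] the jump part of Y is the distribution function of this finite measure projected to
    -- the time axis, where it is carried by D.
    set κ : Measure (ℝ≥0 × ℝ) := (μ.restrict box).withDensity fun z => ENNReal.ofReal (g z) with hκ
    have hκfin : IsFiniteMeasure κ := isFiniteMeasure_withDensity_ofReal (hint n).2
    have hfst : Measurable fun z : ℝ≥0 × ℝ => (z.1 : ℝ) := by fun_prop
    have hsub : ∀ s t : ℝ≥0, t ≤ n →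
        (κ.map fun z => (z.1 : ℝ)) (Ioc s t) = ∫⁻ z in Ioc s t ×ˢ univ, ENNReal.ofReal (g z) ∂μ := by
      intro s t ht
      have hpre : (fun z : ℝ≥0 × ℝ => (z.1 : ℝ)) ⁻¹' Ioc (s : ℝ) t = Ioc s t ×ˢ univ := by
        ext z; simp
      rw [Measure.map_apply hfst measurableSet_Ioc, hpre,
        withDensity_apply _ (measurableSet_Ioc.prod .univ),
        Measure.restrict_restrict (measurableSet_Ioc.prod .univ), inter_eq_left.2]
      exact prod_mono (Ioc_subset_Ioc zero_le ht) le_rfl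
    have h0 : (κ.map fun z => (z.1 : ℝ)) ((↑) '' D)ᶜ = 0 := by
      rw [Measure.map_apply hfst (hD.image _).measurableSet.compl]
      refine withDensity_absolutelyContinuous _ _ ?_
      rw [Measure.restrict_apply (hfst (hD.image _).measurableSet.compl)]
      refine measure_mono_null ?_ hμ
      rintro z ⟨hz, hz'⟩
      exact ⟨⟨hz'.1.1, fun h => hz ⟨z.1, h, rfl⟩⟩, mem_univ _⟩
    have hFderiv := ae_hasDerivAt_zero_of_countable (F := F) (α := κ.map fun z => (z.1 : ℝ))
      (hD.image ((↑) : ℝ≥0 → ℝ)) h0 (isOpen_Ioo (a := (0 : ℝ)) (b := n)) (by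
        intro x hx y hy hxy
        obtain ⟨s, rfl⟩ : ∃ s : ℝ≥0, (s : ℝ) = x := ⟨⟨x, hx.1.le⟩, rfl⟩
        obtain ⟨t, rfl⟩ : ∃ s : ℝ≥0, (s : ℝ) = y := ⟨⟨y, hy.1.le⟩, rfl⟩
        have hst : s ≤ t := by exact_mod_cast hxy
        have htn : t ≤ n := by exact_mod_cast hy.2.le
        have hdiff : F t - F s = ∫ z in Ioc s t ×ˢ univ, g z ∂μ := by
          simp only [hF, Real.toNNReal_coe]
          rw [sub_eq_iff_eq_add', ← setIntegral_union]
          · rw [← union_prod, Ioc_union_Ioc_eq_Ioc zero_le hst]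
          · exact Set.disjoint_prod.2 (Or.inl (Ioc_disjoint_Ioc_of_le le_rfl))
          · exact measurableSet_Ioc.prod .univ
          · exact hint s
          · exact (hint t).mono_set (prod_mono (Ioc_subset_Ioc_left zero_le) le_rfl)
        rw [hsub s t htn, hdiff]
        have h1 : 0 ≤ ∫ z in Ioc s t ×ˢ univ, g z ∂μ := integral_nonneg hg
        refine ⟨by linarith, le_of_eq ?_⟩
        exact integral_eq_lintegral_of_nonneg_ae (Eventually.of_forall hg)
          ((hint t).mono_set (prod_mono (Ioc_subset_Ioc_left zero_le) le_rfl)).1)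
    filter_upwards [hFderiv] with x hx hxn
    have h2 : HasDerivAt (fun w => (Y 0 : ℝ) + w - F w) (1 - 0) x :=
      ((hasDerivAt_id x).const_add _).sub (hx hxn)
    rw [sub_zero] at h2
    refine h2.congr_of_eventuallyEq ?_
    filter_upwards [Ioi_mem_nhds hxn.1] with w hw
    simp only [hYr, hF]
    rw [hY, Real.coe_toNNReal _ (le_of_lt hw)]
  have hae : ∀ᵐ x : ℝ, 0 < x → ((Function.leftLim Y x.toNNReal : ℝ≥0) : ℝ) ∉ B := by
    have h1 : ∀ᵐ x : ℝ, ∀ n : ℕ, x ∉ Ioo (0 : ℝ) n ∩ Yr ⁻¹' B := ae_all_iff.2 fun n =>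
      measure_eq_zero_iff_ae_notMem.1 (measure_preimage_null_of_ae_hasDerivAt (hderiv n) hB)
    filter_upwards [h1, ae_all_iff.2 hderiv] with x hx hd hx0
    obtain ⟨n, hn⟩ := exists_nat_gt x
    -- Where a derivative exists the path is continuous, so the left limit is the value itself.
    have hcont : ContinuousAt Yr x := (hd n ⟨hx0, hn⟩).continuousAt
    have hleft : Function.leftLim Y x.toNNReal = Y x.toNNReal := by
      refine ContinuousWithinAt.leftLim_eq (ContinuousAt.continuousWithinAt ?_)
      have h3 : ContinuousAt (fun u : ℝ≥0 => Yr u) x.toNNReal := by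
        refine ContinuousAt.comp (g := Yr) (f := fun u : ℝ≥0 => (u : ℝ)) ?_
          NNReal.continuous_coe.continuousAt
        rwa [Real.coe_toNNReal _ hx0.le]
      have h4 : (fun u : ℝ≥0 => Yr u) = fun u => (Y u : ℝ) := by
        ext u; simp [hYr]
      rw [h4] at h3
      exact NNReal.tendsto_coe.1 h3
    rw [hleft]
    exact fun hB' => hx n ⟨⟨hx0, hn⟩, hB'⟩
  have hmap : ∀ᵐ x ∂(lebesgueHalfLine.map ((↑) : ℝ≥0 → ℝ)),
      0 < x → ((Function.leftLim Y x.toNNReal : ℝ≥0) : ℝ) ∉ B := by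
    rw [map_coe_lebesgueHalfLine]
    exact ae_restrict_of_ae hae
  filter_upwards [ae_of_ae_map measurable_coe_nnreal_real.aemeasurable hmap] with u hu hu0
  simpa using hu (by exact_mod_cast hu0)

end SingularDrift

/-! ### The probability of success and its differential equation -/

section Hazard

/-- The rate `m` of a first event, and the part `n` of it that counts as a success. -/
structure IsHazardPair (m n : ℝ → ℝ) (C : ℝ) : Prop where
  measurable_left : Measurable m
  measurable_right : Measurable n
  bounds : ∀ᵐ a ∂(volume.restrict (Ici (0 : ℝ))), 0 ≤ n a ∧ n a ≤ m a ∧ m a ≤ C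

/-- The probability that there is no event before `x`. -/
def survival (m : ℝ → ℝ) (x : ℝ) : ℝ := Real.exp (-∫ t in (0 : ℝ)..x, m t)

/-- The probability of success given that there is no event before `a`. -/
def successProb (m n : ℝ → ℝ) (a : ℝ) : ℝ :=
  (∫ s in Ioi a, survival m s * n s) * Real.exp (∫ t in (0 : ℝ)..a, m t)

namespace IsHazardPair

variable {m n : ℝ → ℝ} {C : ℝ} (h : IsHazardPair m n C)
include h

lemma ae_bounds : ∀ᵐ a : ℝ, 0 ≤ a → 0 ≤ n a ∧ n a ≤ m a ∧ m a ≤ C :=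
  (ae_restrict_iff' measurableSet_Ici).1 h.bounds

lemma nonneg_const : 0 ≤ C := by
  have : (volume.restrict (Ici (0 : ℝ))) ≠ 0 := by
    simp [Measure.restrict_eq_zero]
  have : (ae (volume.restrict (Ici (0 : ℝ)))).NeBot := ae_neBot.2 this
  obtain ⟨a, h1, h2, h3⟩ := h.bounds.exists
  linarith

lemma intervalIntegrable {x : ℝ} (hx : 0 ≤ x) : IntervalIntegrable m volume 0 x := by
  rw [intervalIntegrable_iff_integrableOn_Ioc_of_le hx]
  refine Measure.integrableOn_of_bounded (M := C) (by simp) h.measurable_left.aestronglyMeasurable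
    ((ae_restrict_iff' measurableSet_Ioc).2 ?_)
  filter_upwards [h.ae_bounds] with a ha hax
  obtain ⟨h1, h2, h3⟩ := ha hax.1.le
  rw [Real.norm_eq_abs, abs_of_nonneg (h1.trans h2)]
  exact h3

lemma intervalIntegrable' {a b : ℝ} (ha : 0 ≤ a) (hb : 0 ≤ b) : IntervalIntegrable m volume a b :=
  (h.intervalIntegrable ha).symm.trans (h.intervalIntegrable hb)

lemma intervalIntegrable_right {x : ℝ} (hx : 0 ≤ x) : IntervalIntegrable n volume 0 x := by
  refine (h.intervalIntegrable hx).mono_fun' h.measurable_right.aestronglyMeasurable ?_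
  rw [uIoc_of_le hx]
  refine (ae_restrict_iff' measurableSet_Ioc).2 ?_
  filter_upwards [h.ae_bounds] with a ha hax
  obtain ⟨h1, h2, h3⟩ := ha hax.1.le
  rwa [Real.norm_eq_abs, abs_of_nonneg h1]

lemma cumulative_sub {a b : ℝ} (ha : 0 ≤ a) (hab : a ≤ b) :
    0 ≤ (∫ t in (0 : ℝ)..b, m t) - ∫ t in (0 : ℝ)..a, m t ∧
      (∫ t in (0 : ℝ)..b, m t) - ∫ t in (0 : ℝ)..a, m t ≤ C * (b - a) := by
  rw [intervalIntegral.integral_interval_sub_left (h.intervalIntegrable (ha.trans hab))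
    (h.intervalIntegrable ha)]
  have hae : ∀ᵐ t ∂(volume.restrict (Icc a b)), 0 ≤ m t ∧ m t ≤ C := by
    refine (ae_restrict_iff' measurableSet_Icc).2 ?_
    filter_upwards [h.ae_bounds] with t ht htx
    obtain ⟨h1, h2, h3⟩ := ht (ha.trans htx.1)
    exact ⟨h1.trans h2, h3⟩
  constructor
  · exact intervalIntegral.integral_nonneg_of_ae_restrict hab (hae.mono fun t ht => ht.1)
  · have := intervalIntegral.integral_mono_ae_restrict hab (h.intervalIntegrable' ha (ha.trans hab))
      (intervalIntegrable_const (c := C)) (hae.mono fun t ht => ht.2)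
    rw [intervalIntegral.integral_const, smul_eq_mul] at this
    linarith [mul_comm C (b - a)]

lemma cumulative_nonneg {b : ℝ} (hb : 0 ≤ b) : 0 ≤ ∫ t in (0 : ℝ)..b, m t := by
  simpa using (h.cumulative_sub le_rfl hb).1

lemma lipschitzOnWith_cumulative (x : ℝ) (hx : 0 ≤ x) :
    LipschitzOnWith C.toNNReal (fun x => ∫ t in (0 : ℝ)..x, m t) (uIcc 0 x) := by
  rw [uIcc_of_le hx]
  refine LipschitzOnWith.of_dist_le_mul fun a ha b hb => ?_
  rw [Real.coe_toNNReal _ h.nonneg_const, Real.dist_eq, Real.dist_eq]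
  rcases le_total a b with hab | hab
  · obtain ⟨h1, h2⟩ := h.cumulative_sub ha.1 hab
    rw [abs_sub_comm, abs_of_nonneg h1, abs_sub_comm, abs_of_nonneg (sub_nonneg.2 hab)]
    exact h2
  · obtain ⟨h1, h2⟩ := h.cumulative_sub hb.1 hab
    rw [abs_of_nonneg h1, abs_of_nonneg (sub_nonneg.2 hab)]
    exact h2

/-- The cumulative rate is Lipschitz with constant C, and the exponential is Lipschitz on its range,
which lies in [0, Cx]. As m is merely measurable, derivatives exist only almost everywhere, and
absolute continuity is what justifies integrating them. -/
lemma absolutelyContinuous_exp (c : ℝ) {x : ℝ} (hx : 0 ≤ x) :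
    AbsolutelyContinuousOnInterval (fun x => Real.exp (c * ∫ t in (0 : ℝ)..x, m t)) 0 x := by
  have hexp : ContDiffOn ℝ 1 (fun y => Real.exp (c * y)) (Icc 0 (C * x)) :=
    (Real.contDiff_exp.comp (contDiff_const.mul contDiff_id)).contDiffOn
  obtain ⟨K, hK⟩ := hexp.exists_lipschitzOnWith (by decide) (convex_Icc _ _) isCompact_Icc
  refine LipschitzOnWith.absolutelyContinuousOnInterval
    (hK.comp (h.lipschitzOnWith_cumulative x hx) fun a ha => ?_)
  rw [uIcc_of_le hx] at ha
  refine ⟨h.cumulative_nonneg ha.1, ?_⟩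
  have h1 := (h.cumulative_sub le_rfl ha.1).2
  simp only [intervalIntegral.integral_same, sub_zero] at h1
  exact h1.trans (mul_le_mul_of_nonneg_left ha.2 h.nonneg_const)

lemma ae_hasDerivAt_exp (c : ℝ) {x : ℝ} (hx : 0 ≤ x) :
    ∀ᵐ a : ℝ, a ∈ uIcc 0 x → HasDerivAt (fun x => Real.exp (c * ∫ t in (0 : ℝ)..x, m t))
      (Real.exp (c * ∫ t in (0 : ℝ)..a, m t) * (c * m a)) a := by
  filter_upwards [(h.intervalIntegrable hx).ae_hasDerivAt_integral] with a ha hax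
  exact ((ha hax 0 left_mem_uIcc).const_mul c).exp

lemma integral_survival_mul {x : ℝ} (hx : 0 ≤ x) :
    ∫ t in (0 : ℝ)..x, survival m t * m t = 1 - survival m x := by
  have h1 := (h.absolutelyContinuous_exp (-1) hx).integral_deriv_eq_sub
  have h2 : ∫ t in (0 : ℝ)..x, deriv (fun x => Real.exp (-1 * ∫ t in (0 : ℝ)..x, m t)) t =
      ∫ t in (0 : ℝ)..x, -(survival m t * m t) := by
    refine intervalIntegral.integral_congr_ae ?_
    filter_upwards [h.ae_hasDerivAt_exp (-1) hx] with a ha hax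
    rw [(ha (uIoc_subset_uIcc hax)).deriv, survival]
    ring_nf
  rw [h2, intervalIntegral.integral_neg] at h1
  simp only [intervalIntegral.integral_same, mul_zero, Real.exp_zero, neg_one_mul] at h1
  rw [survival]
  linarith

omit h in
lemma survival_pos (x : ℝ) : 0 < survival m x := Real.exp_pos _

lemma survival_le_one {x : ℝ} (hx : 0 ≤ x) : survival m x ≤ 1 :=
  Real.exp_le_one_iff.2 (neg_nonpos.2 (h.cumulative_nonneg hx))

lemma continuousOn_survival {x : ℝ} (hx : 0 ≤ x) : ContinuousOn (survival m) (uIcc 0 x) := by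
  have := (h.absolutelyContinuous_exp (-1) hx).continuousOn
  refine this.congr fun a _ => ?_
  simp only [neg_one_mul, survival]

lemma integrable_survival_mul {x : ℝ} (hx : 0 ≤ x) :
    IntervalIntegrable (fun t => survival m t * m t) volume 0 x :=
  (h.intervalIntegrable hx).continuousOn_mul (h.continuousOn_survival hx)

lemma integrable_survival_mul_right {x : ℝ} (hx : 0 ≤ x) :
    IntervalIntegrable (fun t => survival m t * n t) volume 0 x :=
  (h.intervalIntegrable_right hx).continuousOn_mul (h.continuousOn_survival hx)

/-- Successes are among the events (n ≤ m), and the density of events integrates to the loss of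
survival. This yields both the integrability of the density on the half-line and the bound by one
for the probability of success. -/
lemma intervalIntegral_density_le {a b : ℝ} (ha : 0 ≤ a) (hab : a ≤ b) :
    ∫ t in a..b, survival m t * n t ≤ survival m a := by
  have hi : ∀ x, 0 ≤ x → IntervalIntegrable (fun t => survival m t * m t) volume 0 x :=
    fun x hx => h.integrable_survival_mul hx
  have hi' : ∀ x, 0 ≤ x → IntervalIntegrable (fun t => survival m t * n t) volume 0 x :=
    fun x hx => h.integrable_survival_mul_right hx
  have hb := ha.trans hab
  calc ∫ t in a..b, survival m t * n t ≤ ∫ t in a..b, survival m t * m t := by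
        refine intervalIntegral.integral_mono_ae_restrict hab ((hi' a ha).symm.trans (hi' b hb))
          ((hi a ha).symm.trans (hi b hb)) ((ae_restrict_iff' measurableSet_Icc).2 ?_)
        filter_upwards [h.ae_bounds] with t ht htx
        obtain ⟨h1, h2, h3⟩ := ht (ha.trans htx.1)
        exact mul_le_mul_of_nonneg_left h2 (survival_pos t).le
    _ = survival m a - survival m b := by
        rw [← intervalIntegral.integral_interval_sub_left (hi b hb) (hi a ha),
          h.integral_survival_mul hb, h.integral_survival_mul ha]
        ring
    _ ≤ survival m a := by linarith [survival_pos (m := m) b]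

lemma integrableOn_density : IntegrableOn (fun t => survival m t * n t) (Ioi 0) := by
  refine integrableOn_Ioi_of_intervalIntegral_norm_bounded (l := atTop) (b := fun x : ℝ => max x 0)
    1 0 (fun x => ?_) (tendsto_atTop_mono (fun x => le_max_left x 0) tendsto_id)
    (Eventually.of_forall fun x => ?_)
  · rw [← intervalIntegrable_iff_integrableOn_Ioc_of_le (le_max_right x 0)]
    exact h.integrable_survival_mul_right (le_max_right x 0)
  · have h0 : (0 : ℝ) ≤ max x 0 := le_max_right x 0
    have : ∫ t in (0 : ℝ)..max x 0, ‖survival m t * n t‖ =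
        ∫ t in (0 : ℝ)..max x 0, survival m t * n t := by
      refine intervalIntegral.integral_congr_ae ?_
      filter_upwards [h.ae_bounds] with t ht htx
      rw [uIoc_of_le h0] at htx
      rw [Real.norm_eq_abs, abs_of_nonneg (mul_nonneg (survival_pos t).le (ht htx.1.le).1)]
    rw [this]
    refine (h.intervalIntegral_density_le le_rfl h0).trans (h.survival_le_one le_rfl)

lemma integral_Ioi_density {a : ℝ} (ha : 0 ≤ a) :
    ∫ s in Ioi a, survival m s * n s =
      (∫ s in Ioi 0, survival m s * n s) - ∫ s in (0 : ℝ)..a, survival m s * n s := by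
  rw [← intervalIntegral.integral_Ioi_sub_Ioi h.integrableOn_density ha]
  ring

lemma successProb_nonneg {a : ℝ} (ha : 0 ≤ a) : 0 ≤ successProb m n a := by
  refine mul_nonneg (setIntegral_nonneg_of_ae_restrict ?_) (Real.exp_pos _).le
  refine (ae_restrict_iff' measurableSet_Ioi).2 ?_
  filter_upwards [h.ae_bounds] with t ht hta
  exact mul_nonneg (survival_pos t).le (ht (ha.trans (le_of_lt hta))).1

lemma successProb_le_one {a : ℝ} (ha : 0 ≤ a) : successProb m n a ≤ 1 := by
  have h1 : ∫ s in Ioi a, survival m s * n s ≤ survival m a := by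
    refine le_of_tendsto (intervalIntegral_tendsto_integral_Ioi a
      (h.integrableOn_density.mono_set (Ioi_subset_Ioi ha)) tendsto_id) ?_
    filter_upwards [eventually_ge_atTop a] with b hb
    exact h.intervalIntegral_density_le ha hb
  calc successProb m n a ≤ survival m a * Real.exp (∫ t in (0 : ℝ)..a, m t) :=
        mul_le_mul_of_nonneg_right h1 (Real.exp_pos _).le
    _ = 1 := by rw [survival, ← Real.exp_add]; simp

omit h in
lemma successProb_zero : successProb m n 0 = ∫ s in Ioi 0, survival m s * n s := by
  simp [successProb]

lemma absolutelyContinuous_successProb {x : ℝ} (hx : 0 ≤ x) :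
    AbsolutelyContinuousOnInterval (fun a =>
      ((∫ s in Ioi 0, survival m s * n s) - ∫ s in (0 : ℝ)..a, survival m s * n s) *
        Real.exp (1 * ∫ t in (0 : ℝ)..a, m t)) 0 x := by
  have h1 := (h.integrable_survival_mul_right hx).absolutelyContinuousOnInterval_intervalIntegral
    (c := 0) left_mem_uIcc
  have h2 : AbsolutelyContinuousOnInterval (fun _ : ℝ => ∫ s in Ioi 0, survival m s * n s) 0 x :=
    (LipschitzWith.const _).lipschitzOnWith.absolutelyContinuousOnInterval (K := 0)
  exact (h2.sub h1).mul (h.absolutelyContinuous_exp 1 hx)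

lemma successProb_eq {a : ℝ} (ha : 0 ≤ a) : successProb m n a =
      ((∫ s in Ioi 0, survival m s * n s) - ∫ s in (0 : ℝ)..a, survival m s * n s) *
        Real.exp (1 * ∫ t in (0 : ℝ)..a, m t) := by
  rw [successProb, h.integral_Ioi_density ha, one_mul]

/-- The survival probability times the exponential of the cumulative rate is 1, so the product rule
gives π' = mπ - n almost everywhere for the probability of success π; absolute continuity allows
integration. -/
lemma integral_mul_successProb {x : ℝ} (hx : 0 ≤ x) :
    IntervalIntegrable (fun t => m t * successProb m n t) volume 0 x ∧
    ∫ t in (0 : ℝ)..x, m t * successProb m n t =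
      successProb m n x - successProb m n 0 + ∫ t in (0 : ℝ)..x, n t := by
  have hac := h.absolutelyContinuous_successProb hx
  have hint : IntervalIntegrable (fun t => m t * successProb m n t) volume 0 x := by
    refine ((h.intervalIntegrable hx).mul_continuousOn hac.continuousOn).congr_ae ?_
    refine (ae_restrict_iff' measurableSet_uIoc).2 (Eventually.of_forall fun t ht => ?_)
    rw [uIoc_of_le hx] at ht
    dsimp only
    rw [h.successProb_eq ht.1.le]
  refine ⟨hint, ?_⟩
  have h1 := hac.integral_deriv_eq_sub
  rw [← h.successProb_eq hx, ← h.successProb_eq le_rfl] at h1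
  have h2 : ∫ t in (0 : ℝ)..x, deriv (fun a =>
      ((∫ s in Ioi 0, survival m s * n s) - ∫ s in (0 : ℝ)..a, survival m s * n s) *
        Real.exp (1 * ∫ t in (0 : ℝ)..a, m t)) t =
      ∫ t in (0 : ℝ)..x, (m t * successProb m n t - n t) := by
    refine intervalIntegral.integral_congr_ae ?_
    filter_upwards [h.ae_hasDerivAt_exp 1 hx,
      (h.integrable_survival_mul_right hx).ae_hasDerivAt_integral] with a ha1 ha2 hax
    have hax' := uIoc_subset_uIcc hax
    rw [uIoc_of_le hx] at hax
    have h3 := ((ha2 hax' 0 left_mem_uIcc).const_sub (∫ s in Ioi 0, survival m s * n s)).mul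
      (ha1 hax')
    have h4 : survival m a * Real.exp (1 * ∫ t in (0 : ℝ)..a, m t) = 1 := by
      rw [survival, ← Real.exp_add]; simp
    refine h3.deriv.trans ?_
    rw [h.successProb_eq hax.1.le]
    linear_combination (-n a) * h4
  rw [h2, intervalIntegral.integral_sub hint (h.intervalIntegrable_right hx)] at h1
  linarith

/-- The integrated form of the differential equation for the probability of success. -/
lemma lintegral_mul_successProb {x : ℝ} (hx : 0 ≤ x) :
    (∫⁻ t in Ioc 0 x, ENNReal.ofReal (m t * successProb m n t)) +
        ENNReal.ofReal (successProb m n 0) =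
      ENNReal.ofReal (successProb m n x) + ∫⁻ t in Ioc 0 x, ENNReal.ofReal (n t) := by
  obtain ⟨h1, h2⟩ := h.integral_mul_successProb hx
  have h3 := h.intervalIntegrable_right hx
  rw [intervalIntegrable_iff_integrableOn_Ioc_of_le hx] at h1 h3
  have hb : ∀ᵐ t ∂(volume.restrict (Ioc (0 : ℝ) x)), 0 ≤ n t ∧ n t ≤ m t :=
    (ae_restrict_iff' measurableSet_Ioc).2 (by
      filter_upwards [h.ae_bounds] with t ht htx
      exact ⟨(ht htx.1.le).1, (ht htx.1.le).2.1⟩)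
  have hb' : 0 ≤ᵐ[volume.restrict (Ioc (0 : ℝ) x)] fun t => m t * successProb m n t := by
    filter_upwards [hb, ae_restrict_mem measurableSet_Ioc] with t ht htx
    exact mul_nonneg (ht.1.trans ht.2) (h.successProb_nonneg htx.1.le)
  rw [← ofReal_integral_eq_lintegral_ofReal h1 hb',
    ← ofReal_integral_eq_lintegral_ofReal h3 (hb.mono fun t ht => ht.1),
    ← ENNReal.ofReal_add (integral_nonneg_of_ae hb') (h.successProb_nonneg le_rfl),
    ← ENNReal.ofReal_add (h.successProb_nonneg hx) (integral_nonneg_of_ae (hb.mono fun t ht => ht.1)),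
    ← intervalIntegral.integral_of_le hx, ← intervalIntegral.integral_of_le hx, h2]
  congr 1
  ring

end IsHazardPair

end Hazard

/-! ### The intervals at typical ages, and the rates as lengths -/

section Rates

variable {𝒳 : Set ℝ}

instance [Countable 𝒳] : Countable (OffDiag 𝒳) := by
  unfold OffDiag; infer_instance

/-- The left end point of the intervals attached to the pair `p`, at a typical age. -/
def offset (prec : OffDiag 𝒳 → OffDiag 𝒳 → Prop) (lam : OffDiag 𝒳 → ℝ → ℝ) (p : OffDiag 𝒳) : ℝ :=
  ∑' q : {q : OffDiag 𝒳 // prec q p}, supNorm (lam q.1)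

/-- The sum of the norms of all rates. -/
def totalRate (lam : OffDiag 𝒳 → ℝ → ℝ) : ℝ := ∑' p, supNorm (lam p)

/-- The ages at which all spacings have their typical value. -/
def goodAges (lam tlam : OffDiag 𝒳 → ℝ → ℝ) : Set ℝ :=
  {y | 0 ≤ y ∧ ∀ p, tlam p y = supNorm (lam p)}

/-- A point at height `v` makes a chain of state `k` and age `y` jump to `k'`. -/
def Active (prec : OffDiag 𝒳 → OffDiag 𝒳 → Prop) (lam : OffDiag 𝒳 → ℝ → ℝ) (k : 𝒳)
    (k' : {j : 𝒳 // j ≠ k}) (y v : ℝ) : Prop :=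
  v ∈ Ico (offset prec lam (pair k k')) (offset prec lam (pair k k') + lam (pair k k') y)

lemma supNorm_nonneg (f : ℝ → ℝ) : 0 ≤ supNorm f := ENNReal.toReal_nonneg

lemma pair_injective (k : 𝒳) : Function.Injective (pair k) := by
  intro a b hab
  exact Subtype.ext (congrArg (fun p : OffDiag 𝒳 => p.1.2) hab)

variable {prec : OffDiag 𝒳 → OffDiag 𝒳 → Prop} {lam tlam : OffDiag 𝒳 → ℝ → ℝ}

lemma offset_nonneg (p : OffDiag 𝒳) : 0 ≤ offset prec lam p :=
  tsum_nonneg fun _ => supNorm_nonneg _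

open Classical in
lemma offset_add_eq (hsum : Summable fun p => supNorm (lam p)) (p : OffDiag 𝒳) :
    HasSum (fun r => {r | prec r p}.indicator (fun r => supNorm (lam r)) r +
      if r = p then supNorm (lam p) else 0) (offset prec lam p + supNorm (lam p)) := by
  refine HasSum.add ?_ (hasSum_ite_eq p _)
  have : offset prec lam p = ∑' r, {r | prec r p}.indicator (fun r => supNorm (lam r)) r :=
    tsum_subtype {r | prec r p} fun r => supNorm (lam r)
  rw [this]
  exact (hsum.indicator _).hasSum

/-- By transitivity everything before p is before q, and so is p itself, so the left side is a
partial sum of the right side. Consequently each pair owns a slot of heights, disjoint from all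
others and independent of the age. -/
lemma offset_add_le (hprec : IsStrictTotalOrder (OffDiag 𝒳) prec)
    (hsum : Summable fun p => supNorm (lam p)) {p q : OffDiag 𝒳} (hpq : prec p q) :
    offset prec lam p + supNorm (lam p) ≤ offset prec lam q := by
  classical
  have hq : offset prec lam q = ∑' r, {r | prec r q}.indicator (fun r => supNorm (lam r)) r :=
    tsum_subtype {r | prec r q} fun r => supNorm (lam r)
  rw [hq]
  refine hasSum_le (fun r => ?_) (offset_add_eq hsum p) (hsum.indicator _).hasSum
  by_cases hr : r = p
  · subst hr
    have : ¬ prec r r := irrefl r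
    simp [indicator, this, hpq]
  · by_cases hrp : prec r p
    · have : prec r q := _root_.trans hrp hpq
      simp [indicator, hr, hrp, this]
    · simp only [indicator, mem_ofPred_eq, hrp, if_false, hr, add_zero]
      split_ifs
      exacts [supNorm_nonneg _, le_rfl]

lemma offset_add_le_totalRate (hprec : IsStrictTotalOrder (OffDiag 𝒳) prec)
    (hsum : Summable fun p => supNorm (lam p)) (p : OffDiag 𝒳) :
    offset prec lam p + supNorm (lam p) ≤ totalRate lam := by
  classical
  refine hasSum_le (fun r => ?_) (offset_add_eq hsum p) hsum.hasSum
  by_cases hr : r = p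
  · subst hr
    have : ¬ prec r r := irrefl r
    simp [indicator, this]
  · simp only [indicator, hr, if_false, add_zero]
    split_ifs
    exacts [le_rfl, supNorm_nonneg _]

lemma eq_of_mem_Ico_offset (hprec : IsStrictTotalOrder (OffDiag 𝒳) prec)
    (hsum : Summable fun p => supNorm (lam p)) {p q : OffDiag 𝒳} {v : ℝ}
    (hp : v ∈ Ico (offset prec lam p) (offset prec lam p + supNorm (lam p)))
    (hq : v ∈ Ico (offset prec lam q) (offset prec lam q + supNorm (lam q))) : p = q := by
  rcases trichotomous_of prec p q with h | h | h
  · linarith [offset_add_le hprec hsum h, hp.2, hq.1]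
  · exact h
  · linarith [offset_add_le hprec hsum h, hq.2, hp.1]

lemma lam_le_supNorm (htlam : IsSpacing lam tlam) {y : ℝ} (hy : y ∈ goodAges lam tlam)
    (p : OffDiag 𝒳) : lam p y ≤ supNorm (lam p) :=
  hy.2 p ▸ htlam.le_tlam p y hy.1

lemma interval_eq_Ico {y : ℝ} (hy : y ∈ goodAges lam tlam) (p : OffDiag 𝒳) :
    interval prec lam tlam p y = Ico (offset prec lam p) (offset prec lam p + lam p y) := by
  have : (∑' q : {q : OffDiag 𝒳 // prec q p}, tlam q.1 y) = offset prec lam p :=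
    tsum_congr fun q => hy.2 q.1
  rw [interval, this]

lemma Active.mem_Ico (htlam : IsSpacing lam tlam) {k : 𝒳} {k' : {j : 𝒳 // j ≠ k}} {y v : ℝ}
    (hy : y ∈ goodAges lam tlam) (h : Active prec lam k k' y v) :
    v ∈ Ico (offset prec lam (pair k k'))
      (offset prec lam (pair k k') + supNorm (lam (pair k k'))) :=
  ⟨h.1, h.2.trans_le (by linarith [lam_le_supNorm htlam hy (pair k k')])⟩

/-- The ages may differ: at typical ages both intervals lie in the age-independent slots of their
pairs. Hence one point cannot send two chains in the same state to different states. -/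
lemma Active.unique (hprec : IsStrictTotalOrder (OffDiag 𝒳) prec)
    (hsum : Summable fun p => supNorm (lam p)) (htlam : IsSpacing lam tlam) {k : 𝒳}
    {k₁ k₂ : {j : 𝒳 // j ≠ k}} {y₁ y₂ v : ℝ} (hy₁ : y₁ ∈ goodAges lam tlam)
    (hy₂ : y₂ ∈ goodAges lam tlam) (h₁ : Active prec lam k k₁ y₁ v)
    (h₂ : Active prec lam k k₂ y₂ v) : k₁ = k₂ :=
  pair_injective k (eq_of_mem_Ico_offset hprec hsum (h₁.mem_Ico htlam hy₁) (h₂.mem_Ico htlam hy₂))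

lemma Active.mem_strip (hprec : IsStrictTotalOrder (OffDiag 𝒳) prec)
    (hsum : Summable fun p => supNorm (lam p)) (htlam : IsSpacing lam tlam) {k : 𝒳}
    {k' : {j : 𝒳 // j ≠ k}} {y v : ℝ} (hy : y ∈ goodAges lam tlam)
    (h : Active prec lam k k' y v) : v ∈ Icc 0 (totalRate lam) := by
  have h1 := h.mem_Ico htlam hy
  exact ⟨(offset_nonneg _).trans h1.1,
    h1.2.le.trans (offset_add_le_totalRate hprec hsum (pair k k'))⟩

lemma hFun_of_active (hprec : IsStrictTotalOrder (OffDiag 𝒳) prec)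
    (hsum : Summable fun p => supNorm (lam p)) (htlam : IsSpacing lam tlam) {k : 𝒳}
    {k' : {j : 𝒳 // j ≠ k}} {y v : ℝ} (hy : y ∈ goodAges lam tlam)
    (h : Active prec lam k k' y v) :
    hFun prec lam tlam k y v = (k'.1 : ℝ) - k ∧ gFun prec lam tlam k y v = y := by
  have hother : ∀ j : {j : 𝒳 // j ≠ k}, j ≠ k' →
      (interval prec lam tlam (pair k j) y).indicator (fun _ => (1 : ℝ)) v = 0 := by
    intro j hj
    refine indicator_of_notMem (fun hv => hj ?_) _
    rw [interval_eq_Ico hy] at hv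
    exact Active.unique hprec hsum htlam hy hy hv h
  have hself : (interval prec lam tlam (pair k k') y).indicator (fun _ => (1 : ℝ)) v = 1 := by
    rw [interval_eq_Ico hy]
    exact indicator_of_mem h _
  constructor
  · rw [hFun, tsum_eq_single k' fun j hj => by rw [hother j hj, mul_zero], hself, mul_one]
  · rw [gFun, tsum_eq_single k' hother, hself, mul_one]

lemma hFun_of_not_active {k : 𝒳} {y v : ℝ} (hy : y ∈ goodAges lam tlam)
    (h : ∀ k', ¬ Active prec lam k k' y v) :
    hFun prec lam tlam k y v = 0 ∧ gFun prec lam tlam k y v = 0 := by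
  have hall : ∀ j : {j : 𝒳 // j ≠ k},
      (interval prec lam tlam (pair k j) y).indicator (fun _ => (1 : ℝ)) v = 0 := fun j => by
    rw [interval_eq_Ico hy]
    exact indicator_of_notMem (h j) _
  simp [hFun, gFun, hall]

lemma gFun_nonneg (k : 𝒳) {y : ℝ} (hy : 0 ≤ y) (v : ℝ) : 0 ≤ gFun prec lam tlam k y v :=
  mul_nonneg hy (tsum_nonneg fun _ => indicator_nonneg (fun _ _ => zero_le_one) _)

lemma measurableSet_goodAges [Countable 𝒳] (htlam : IsSpacing lam tlam) :
    MeasurableSet (goodAges lam tlam) := by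
  have : goodAges lam tlam = Ici 0 ∩ ⋂ p, {y | tlam p y = supNorm (lam p)} := by
    ext y; simp [goodAges]
  rw [this]
  exact measurableSet_Ici.inter (MeasurableSet.iInter fun p =>
    measurableSet_eq_fun (htlam.measurable p) measurable_const)

lemma ae_mem_goodAges [Countable 𝒳]
    (hA3 : ∀ p, ∀ᵐ y ∂(volume.restrict (Ici (0 : ℝ))), tlam p y = supNorm (lam p)) :
    ∀ᵐ y : ℝ, 0 ≤ y → y ∈ goodAges lam tlam := by
  have := (ae_restrict_iff' measurableSet_Ici).1 (ae_all_iff.2 hA3)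
  filter_upwards [this] with y hy hy0
  exact ⟨hy0, hy hy0⟩

lemma ae_mem_goodAges_add [Countable 𝒳]
    (hA3 : ∀ p, ∀ᵐ y ∂(volume.restrict (Ici (0 : ℝ))), tlam p y = supNorm (lam p)) {y : ℝ}
    (hy : 0 ≤ y) :
    ∀ᵐ a : ℝ, 0 ≤ a → a ∈ goodAges lam tlam ∧ y + a ∈ goodAges lam tlam := by
  filter_upwards [ae_mem_goodAges hA3,
    (measurePreserving_add_left volume y).quasiMeasurePreserving.ae (ae_mem_goodAges hA3)]
    with a h1 h2 h0
  exact ⟨h1 h0, h2 (by positivity)⟩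

lemma volume_iUnion_Ico_offset [Countable 𝒳] (hprec : IsStrictTotalOrder (OffDiag 𝒳) prec)
    (hsum : Summable fun p => supNorm (lam p)) (k : 𝒳) {w : {j : 𝒳 // j ≠ k} → ℝ}
    (hw0 : ∀ k', 0 ≤ w k') (hw : ∀ k', w k' ≤ supNorm (lam (pair k k'))) :
    volume (⋃ k', Ico (offset prec lam (pair k k')) (offset prec lam (pair k k') + w k')) =
      ENNReal.ofReal (∑' k', w k') := by
  rw [measure_iUnion ?_ fun _ => measurableSet_Ico, ENNReal.ofReal_tsum_of_nonneg hw0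
    (Summable.of_nonneg_of_le hw0 hw (hsum.comp_injective (pair_injective k)))]
  · exact tsum_congr fun k' => by rw [Real.volume_Ico, add_sub_cancel_left]
  · intro a b hab
    refine Set.disjoint_left.2 fun v ha hb => hab (pair_injective k ?_)
    exact eq_of_mem_Ico_offset hprec hsum ⟨ha.1, ha.2.trans_le (by linarith [hw a])⟩
      ⟨hb.1, hb.2.trans_le (by linarith [hw b])⟩

/-- The intervals of k' at two typical ages share their left end point, so their union is the longer
one, and in `volume_active_and` their intersection is the shorter one. Disjointness of the slots
lets the lengths be added over k'. -/
lemma volume_active_or [Countable 𝒳] (hprec : IsStrictTotalOrder (OffDiag 𝒳) prec)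
    (hlam : IsRateMatrix lam) (htlam : IsSpacing lam tlam) (k : 𝒳) {y₁ y₂ : ℝ}
    (hy₁ : y₁ ∈ goodAges lam tlam) (hy₂ : y₂ ∈ goodAges lam tlam) :
    volume {v | ∃ k', Active prec lam k k' y₁ v ∨ Active prec lam k k' y₂ v} =
      ENNReal.ofReal (∑' k', max (lam (pair k k') y₁) (lam (pair k k') y₂)) := by
  rw [← volume_iUnion_Ico_offset hprec hlam.summable_supNorm k
    (fun k' => (hlam.pos _ _ hy₁.1).le.trans (le_max_left _ _))
    (fun k' => max_le (lam_le_supNorm htlam hy₁ _) (lam_le_supNorm htlam hy₂ _))]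
  congr 1
  ext v
  simp only [mem_ofPred_eq, mem_iUnion, Active, mem_Ico]
  refine exists_congr fun k' => ?_
  rw [← and_or_left, ← sub_lt_iff_lt_add', ← sub_lt_iff_lt_add', ← sub_lt_iff_lt_add', lt_max_iff]

lemma volume_active_and [Countable 𝒳] (hprec : IsStrictTotalOrder (OffDiag 𝒳) prec)
    (hlam : IsRateMatrix lam) (htlam : IsSpacing lam tlam) (k : 𝒳) {y₁ y₂ : ℝ}
    (hy₁ : y₁ ∈ goodAges lam tlam) (hy₂ : y₂ ∈ goodAges lam tlam) :
    volume {v | ∃ k', Active prec lam k k' y₁ v ∧ Active prec lam k k' y₂ v} =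
      ENNReal.ofReal (∑' k', min (lam (pair k k') y₁) (lam (pair k k') y₂)) := by
  rw [← volume_iUnion_Ico_offset hprec hlam.summable_supNorm k
    (fun k' => le_min (hlam.pos _ _ hy₁.1).le (hlam.pos _ _ hy₂.1).le)
    (fun k' => (min_le_left _ _).trans (lam_le_supNorm htlam hy₁ _))]
  congr 1
  ext v
  simp only [mem_ofPred_eq, mem_iUnion, Active, mem_Ico]
  refine exists_congr fun k' => ?_
  rw [← and_and_left, ← sub_lt_iff_lt_add', ← sub_lt_iff_lt_add', ← sub_lt_iff_lt_add',
    lt_min_iff]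

lemma summable_max (hlam : IsRateMatrix lam) (htlam : IsSpacing lam tlam) (k : 𝒳) {y₁ y₂ : ℝ}
    (hy₁ : y₁ ∈ goodAges lam tlam) (hy₂ : y₂ ∈ goodAges lam tlam) :
    Summable fun k' : {j : 𝒳 // j ≠ k} => max (lam (pair k k') y₁) (lam (pair k k') y₂) :=
  Summable.of_nonneg_of_le (fun _ => (hlam.pos _ _ hy₁.1).le.trans (le_max_left _ _))
    (fun _ => max_le (lam_le_supNorm htlam hy₁ _) (lam_le_supNorm htlam hy₂ _))
    (hlam.summable_supNorm.comp_injective (pair_injective k))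

lemma summable_min (hlam : IsRateMatrix lam) (htlam : IsSpacing lam tlam) (k : 𝒳) {y₁ y₂ : ℝ}
    (hy₁ : y₁ ∈ goodAges lam tlam) (hy₂ : y₂ ∈ goodAges lam tlam) :
    Summable fun k' : {j : 𝒳 // j ≠ k} => min (lam (pair k k') y₁) (lam (pair k k') y₂) :=
  Summable.of_nonneg_of_le (fun _ => le_min (hlam.pos _ _ hy₁.1).le (hlam.pos _ _ hy₂.1).le)
    (fun _ => (min_le_left _ _).trans (lam_le_supNorm htlam hy₁ _))
    (hlam.summable_supNorm.comp_injective (pair_injective k))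

lemma measurable_maxRate [Countable 𝒳] (hlam : IsRateMatrix lam) (k : 𝒳) :
    Measurable fun p : ℝ × ℝ => maxRate lam k p.1 p.2 := by
  refine Measurable.tsum fun k' => ?_
  exact ((hlam.measurable _).comp measurable_snd).max
    ((hlam.measurable _).comp (measurable_fst.add measurable_snd))

lemma measurable_minRate [Countable 𝒳] (hlam : IsRateMatrix lam) (k : 𝒳) :
    Measurable fun p : ℝ × ℝ => minRate lam k p.1 p.2 := by
  refine Measurable.tsum fun k' => ?_
  exact ((hlam.measurable _).comp measurable_snd).min
    ((hlam.measurable _).comp (measurable_fst.add measurable_snd))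

lemma isHazardPair_rates [Countable 𝒳] (hlam : IsRateMatrix lam) (htlam : IsSpacing lam tlam)
    (hA3 : ∀ p, ∀ᵐ y ∂(volume.restrict (Ici (0 : ℝ))), tlam p y = supNorm (lam p)) (k : 𝒳)
    {y : ℝ} (hy : 0 ≤ y) :
    IsHazardPair (maxRate lam k y) (minRate lam k y) (totalRate lam) where
  measurable_left := (measurable_maxRate hlam k).comp measurable_prodMk_left
  measurable_right := (measurable_minRate hlam k).comp measurable_prodMk_left
  bounds := by
    refine (ae_restrict_iff' measurableSet_Ici).2 ?_
    filter_upwards [ae_mem_goodAges_add hA3 hy] with a ha ha0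
    obtain ⟨h1, h2⟩ := ha ha0
    refine ⟨tsum_nonneg fun k' => le_min (hlam.pos _ _ h1.1).le (hlam.pos _ _ h2.1).le,
      (summable_min hlam htlam k h1 h2).tsum_le_tsum (fun k' => min_le_max)
        (summable_max hlam htlam k h1 h2), ?_⟩
    exact (summable_max hlam htlam k h1 h2).tsum_le_tsum_of_inj (pair k) (pair_injective k)
      (fun p _ => supNorm_nonneg _)
      (fun k' => max_le (lam_le_supNorm htlam h1 _) (lam_le_supNorm htlam h2 _))
      hlam.summable_supNorm

lemma formulaConverges [Countable 𝒳] (hlam : IsRateMatrix lam) (htlam : IsSpacing lam tlam)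
    (hA3 : ∀ p, ∀ᵐ y ∂(volume.restrict (Ici (0 : ℝ))), tlam p y = supNorm (lam p)) (k : 𝒳)
    {y : ℝ} (hy : 0 ≤ y) : FormulaConverges lam k y where
  summable_max := (ae_restrict_iff' measurableSet_Ici).2 (by
    filter_upwards [ae_mem_goodAges_add hA3 hy] with a ha ha0
    exact summable_max hlam htlam k (ha ha0).1 (ha ha0).2)
  summable_min := (ae_restrict_iff' measurableSet_Ici).2 (by
    filter_upwards [ae_mem_goodAges_add hA3 hy] with a ha ha0
    exact summable_min hlam htlam k (ha ha0).1 (ha ha0).2)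
  integrable_max := fun _ hy' => (isHazardPair_rates hlam htlam hA3 k hy).intervalIntegrable hy'
  integrable_density := (isHazardPair_rates hlam htlam hA3 k hy).integrableOn_density

/-- The sum of the maxima dominates the exit rate at the younger age, whose integral diverges by
assumption. This is what rules out that two chains stay together without ever jumping. -/
lemma lintegral_maxRate [Countable 𝒳] (hlam : IsRateMatrix lam) (htlam : IsSpacing lam tlam)
    (hA3 : ∀ p, ∀ᵐ y ∂(volume.restrict (Ici (0 : ℝ))), tlam p y = supNorm (lam p)) (k : 𝒳)
    {y : ℝ} (hy : 0 ≤ y) : ∫⁻ a in Ioi (0 : ℝ), ENNReal.ofReal (maxRate lam k y a) = ⊤ := by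
  by_contra hne
  have hh := isHazardPair_rates hlam htlam hA3 k hy
  have hb : ∀ᵐ a : ℝ, 0 ≤ a → exitRate lam k a ≤ maxRate lam k y a := by
    filter_upwards [ae_mem_goodAges_add hA3 hy] with a ha ha0
    obtain ⟨h1, h2⟩ := ha ha0
    have h3 := summable_max hlam htlam k h1 h1
    simp only [max_self] at h3
    exact h3.tsum_le_tsum (fun k' => le_max_left _ _) (summable_max hlam htlam k h1 h2)
  have hint : IntegrableOn (maxRate lam k y) (Ioi 0) := by
    refine ⟨hh.measurable_left.aestronglyMeasurable, ?_⟩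
    rw [hasFiniteIntegral_iff_ofReal]
    · exact lt_top_iff_ne_top.2 hne
    · refine (ae_restrict_iff' measurableSet_Ioi).2 ?_
      filter_upwards [hh.ae_bounds] with a ha ha0
      exact (ha (le_of_lt ha0)).1.trans (ha (le_of_lt ha0)).2.1
  have hexit : ∀ x : ℝ, 0 ≤ x → ∫ s in (0 : ℝ)..x, exitRate lam k s ≤
      ∫ a in Ioi (0 : ℝ), maxRate lam k y a := by
    intro x hx
    have hnn : ∀ᵐ a ∂(volume.restrict (Ioi (0 : ℝ))), 0 ≤ maxRate lam k y a := by
      refine (ae_restrict_iff' measurableSet_Ioi).2 ?_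
      filter_upwards [hh.ae_bounds] with a ha ha0
      exact (ha (le_of_lt ha0)).1.trans (ha (le_of_lt ha0)).2.1
    rw [intervalIntegral.integral_of_le hx]
    refine le_trans (integral_mono_of_nonneg ?_ (hint.mono_set Ioc_subset_Ioi_self) ?_)
      (setIntegral_mono_set hint hnn (Ioc_subset_Ioi_self.eventuallyLE))
    · refine (ae_restrict_iff' measurableSet_Ioc).2 (Eventually.of_forall fun a ha => ?_)
      exact tsum_nonneg fun k' => (hlam.pos _ _ ha.1.le).le
    · refine (ae_restrict_iff' measurableSet_Ioc).2 ?_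
      filter_upwards [hb] with a ha ha0
      exact ha ha0.1.le
  obtain ⟨x, hx1, hx2⟩ := ((hlam.tendsto_cumulative k).eventually_gt_atTop
    (∫ a in Ioi (0 : ℝ), maxRate lam k y a)).and (eventually_ge_atTop 0) |>.exists
  exact absurd hx1 (not_lt.2 (hexit x hx2))

end Rates

/-! ### From the integral equations to paths that drift and jump -/

section ChainPath

variable {𝒳 : Set ℝ}

/-- A path of state and age which evolves freely except at the points `S` that activate it. -/
structure ChainPath (prec : OffDiag 𝒳 → OffDiag 𝒳 → Prop) (lam tlam : OffDiag 𝒳 → ℝ → ℝ)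
    (S : Set (ℝ≥0 × ℝ)) (X : ℝ≥0 → 𝒳) (Y : ℝ≥0 → ℝ≥0) : Prop where
  dichotomy : ∀ s d : ℝ≥0, (X (s + d) = X s ∧ Y (s + d) = Y s + d) ∨ Y (s + d) < d
  right : ∀ t : ℝ≥0, ∃ ε > 0, ∀ d < ε, X (t + d) = X t ∧ Y (t + d) = Y t + d
  left : ∀ u : ℝ≥0, 0 < u → ∃ w < u, ∀ s, w < s → s < u →
    Function.leftLim X u = X s ∧ Function.leftLim Y u = Y s + (u - s)
  jump_active : ∀ u v, (u, v) ∈ S → ∀ k', Active prec lam (Function.leftLim X u) k'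
    ((Function.leftLim Y u : ℝ≥0) : ℝ) v → X u = k'.1 ∧ Y u = 0
  jump_inactive : ∀ u, 0 < u → (∀ v, (u, v) ∈ S → ∀ k', ¬ Active prec lam (Function.leftLim X u) k'
    ((Function.leftLim Y u : ℝ≥0) : ℝ) v) → X u = Function.leftLim X u ∧ Y u = Function.leftLim Y u
  good : ∀ u v, (u, v) ∈ S → ((Function.leftLim Y u : ℝ≥0) : ℝ) ∈ goodAges lam tlam

section StripSums

variable {μ : Measure (ℝ≥0 × ℝ)} {C : ℝ} {S : Set (ℝ≥0 × ℝ)}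

namespace IsStripPoints

lemma countable (hS : IsStripPoints μ C S) : S.Countable := by
  have : S ⊆ ⋃ n : ℕ, S ∩ Ioc 0 (n : ℝ≥0) ×ˢ univ := by
    intro z hz
    obtain ⟨n, hn⟩ := exists_nat_ge z.1
    exact mem_iUnion.2 ⟨n, hz, ⟨(hS.subset hz).1, hn⟩, mem_univ _⟩
  have h2 : (⋃ n : ℕ, S ∩ Ioc 0 (n : ℝ≥0) ×ˢ univ).Countable :=
    countable_iUnion fun n => (hS.finite n).countable
  exact h2.mono this

lemma setIntegral_eq_sum (hS : IsStripPoints μ C S) {H : ℝ≥0 × ℝ → ℝ} (s t : ℝ≥0)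
    (hH : ∀ᵐ z ∂μ, 0 < z.1 → z.2 ∉ Icc 0 C → H z = 0) (F : Finset (ℝ≥0 × ℝ))
    (hF : (F : Set (ℝ≥0 × ℝ)) = S ∩ Ioc s t ×ˢ univ) :
    ∫ z in Ioc s t ×ˢ univ, H z ∂μ = ∑ z ∈ F, H z := by
  have hm : MeasurableSet (Ioc s t ×ˢ (univ : Set ℝ)) := measurableSet_Ioc.prod .univ
  have h1 : ∫ z in Ioc s t ×ˢ univ, H z ∂μ = ∫ z in Ioc s t ×ˢ Icc 0 C, H z ∂μ := by
    refine setIntegral_eq_of_subset_of_ae_sdiff_eq_zero hm.nullMeasurableSet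
      (prod_mono le_rfl (subset_univ _)) ?_
    filter_upwards [hH] with z hz hzm
    exact hz (zero_le.trans_lt hzm.1.1.1) fun h => hzm.2 ⟨hzm.1.1, h⟩
  have h2 : μ.restrict (Ioc s t ×ˢ Icc 0 C) = Measure.count.restrict (F : Set (ℝ≥0 × ℝ)) := by
    have h3 : Ioc s t ×ˢ Icc 0 C = Ioc s t ×ˢ univ ∩ Ioi 0 ×ˢ Icc 0 C := by
      rw [prod_inter_prod, univ_inter, inter_eq_left.2]
      exact fun x hx => zero_le.trans_lt hx.1
    rw [h3, ← Measure.restrict_restrict hm, hS.restrict_eq, Measure.restrict_restrict hm, hF,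
      inter_comm]
  have h4 : IntegrableOn H (F : Set (ℝ≥0 × ℝ)) Measure.count := by
    have : (F : Set (ℝ≥0 × ℝ)) = ⋃ z ∈ F, {z} := by ext; simp
    rw [this]
    exact integrableOn_finset_iUnion.2 fun z _ => integrableOn_singleton
      (hx := by rw [Measure.count_singleton]; exact ENNReal.one_lt_top)
  rw [h1, h2, setIntegral_finset _ h4]
  simp

lemma eventually_isolated (hS : IsStripPoints μ C S) (u : ℝ≥0) :
    ∀ᶠ w in 𝓝 u, ∀ z ∈ S, z.1 = w → w = u := by
  have hfin : (Prod.fst '' (S ∩ Ioc 0 (u + 1) ×ˢ univ) \ {u}).Finite :=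
    ((hS.finite (u + 1)).image _).subset sdiff_subset
  have h1 : ∀ᶠ w in 𝓝 u, w ∉ Prod.fst '' (S ∩ Ioc 0 (u + 1) ×ˢ univ) \ {u} :=
    hfin.isClosed.isOpen_compl.mem_nhds (by simp)
  have h2 : ∀ᶠ w in 𝓝 u, w < u + 1 := Iio_mem_nhds (lt_add_one u)
  filter_upwards [h1, h2] with w hw1 hw2 z hz hzw
  by_contra hne
  exact hw1 ⟨⟨z, ⟨hz, ⟨(hS.subset hz).1, hzw ▸ hw2.le⟩, mem_univ _⟩, hzw⟩, hne⟩

end IsStripPoints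

end StripSums

/-- The two integral equations for a path, with the points of a measure. -/
structure SolvesPath (prec : OffDiag 𝒳 → OffDiag 𝒳 → Prop) (lam tlam : OffDiag 𝒳 → ℝ → ℝ)
    (μ : Measure (ℝ≥0 × ℝ)) (X : ℝ≥0 → 𝒳) (Y : ℝ≥0 → ℝ≥0) : Prop where
  eq_X : ∀ t : ℝ≥0,
    IntegrableOn (fun z : ℝ≥0 × ℝ => hFun prec lam tlam
      (Function.leftLim X z.1) ((Function.leftLim Y z.1 : ℝ≥0) : ℝ) z.2) (Ioc 0 t ×ˢ univ) μ ∧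
    (X t : ℝ) = X 0 + ∫ z in Ioc 0 t ×ˢ univ, hFun prec lam tlam
      (Function.leftLim X z.1) ((Function.leftLim Y z.1 : ℝ≥0) : ℝ) z.2 ∂μ
  eq_Y : ∀ t : ℝ≥0,
    IntegrableOn (fun z : ℝ≥0 × ℝ => gFun prec lam tlam
      (Function.leftLim X z.1) ((Function.leftLim Y z.1 : ℝ≥0) : ℝ) z.2) (Ioc 0 t ×ˢ univ) μ ∧
    (Y t : ℝ) = Y 0 + t - ∫ z in Ioc 0 t ×ˢ univ, gFun prec lam tlam
      (Function.leftLim X z.1) ((Function.leftLim Y z.1 : ℝ≥0) : ℝ) z.2 ∂μ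

namespace SolvesPath

variable {prec : OffDiag 𝒳 → OffDiag 𝒳 → Prop} {lam tlam : OffDiag 𝒳 → ℝ → ℝ}
  {μ : Measure (ℝ≥0 × ℝ)} {X : ℝ≥0 → 𝒳} {Y : ℝ≥0 → ℝ≥0} {S : Set (ℝ≥0 × ℝ)}

lemma setIntegral_Ioc {H : ℝ≥0 × ℝ → ℝ} (hH : ∀ t : ℝ≥0, IntegrableOn H (Ioc 0 t ×ˢ univ) μ)
    {s t : ℝ≥0} (hst : s ≤ t) :
    ∫ z in Ioc 0 t ×ˢ univ, H z ∂μ =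
      ∫ z in Ioc 0 s ×ˢ univ, H z ∂μ + ∫ z in Ioc s t ×ˢ univ, H z ∂μ := by
  rw [← setIntegral_union]
  · rw [← union_prod, Ioc_union_Ioc_eq_Ioc zero_le hst]
  · exact Set.disjoint_prod.2 (Or.inl (Ioc_disjoint_Ioc_of_le le_rfl))
  · exact measurableSet_Ioc.prod .univ
  · exact hH s
  · exact (hH t).mono_set (prod_mono (Ioc_subset_Ioc_left zero_le) le_rfl)

lemma increment (h : SolvesPath prec lam tlam μ X Y) {s t : ℝ≥0} (hst : s ≤ t) :
    (X t : ℝ) = X s + ∫ z in Ioc s t ×ˢ univ, hFun prec lam tlam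
      (Function.leftLim X z.1) ((Function.leftLim Y z.1 : ℝ≥0) : ℝ) z.2 ∂μ ∧
    (Y t : ℝ) = Y s + (t - s) - ∫ z in Ioc s t ×ˢ univ, gFun prec lam tlam
      (Function.leftLim X z.1) ((Function.leftLim Y z.1 : ℝ≥0) : ℝ) z.2 ∂μ := by
  rw [(h.eq_X t).2, (h.eq_X s).2, (h.eq_Y t).2, (h.eq_Y s).2,
    setIntegral_Ioc (fun t => (h.eq_X t).1) hst, setIntegral_Ioc (fun t => (h.eq_Y t).1) hst]
  constructor <;> ring

section

variable (h : SolvesPath prec lam tlam μ X Y) (hS : IsStripPoints μ (totalRate lam) S)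
  (hprec : IsStrictTotalOrder (OffDiag 𝒳) prec) (hsum : Summable fun p => supNorm (lam p))
  (htlam : IsSpacing lam tlam)
  (hgood : ∀ᵐ z ∂μ, 0 < z.1 → ((Function.leftLim Y z.1 : ℝ≥0) : ℝ) ∈ goodAges lam tlam)

include hprec hsum htlam hgood in
lemma ae_eq_zero_off_strip :
    (∀ᵐ z ∂μ, 0 < z.1 → z.2 ∉ Icc 0 (totalRate lam) → hFun prec lam tlam
      (Function.leftLim X z.1) ((Function.leftLim Y z.1 : ℝ≥0) : ℝ) z.2 = 0) ∧
    ∀ᵐ z ∂μ, 0 < z.1 → z.2 ∉ Icc 0 (totalRate lam) → gFun prec lam tlam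
      (Function.leftLim X z.1) ((Function.leftLim Y z.1 : ℝ≥0) : ℝ) z.2 = 0 := by
  constructor <;>
  · filter_upwards [hgood] with z hz h0 hstrip
    have := hFun_of_not_active (prec := prec) (k := Function.leftLim X z.1) (v := z.2) (hz h0)
      fun k' hk' => hstrip (hk'.mem_strip hprec hsum htlam (hz h0))
    first | exact this.1 | exact this.2

include hS hgood in
-- In the strip the noise is a counting measure, for which almost every point means every point.
lemma good_of_mem {u : ℝ≥0} {v : ℝ} (hz : (u, v) ∈ S) :
    ((Function.leftLim Y u : ℝ≥0) : ℝ) ∈ goodAges lam tlam := by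
  have h1 : ∀ᵐ z ∂(Measure.count.restrict S), 0 < z.1 →
      ((Function.leftLim Y z.1 : ℝ≥0) : ℝ) ∈ goodAges lam tlam := by
    rw [← hS.restrict_eq]
    exact ae_restrict_of_ae hgood
  rw [ae_restrict_iff' hS.countable.measurableSet, Measure.ae_count_iff] at h1
  exact h1 (u, v) hz (hS.subset hz).1

include h hS hprec hsum htlam hgood

/-- The integrals over (s, t] are finite sums over points of S, and every term vanishes, since at a
typical age the integrands see only the points that activate the chain. -/
lemma free_of_inactive {s t : ℝ≥0} (hst : s ≤ t)
    (hin : ∀ z ∈ S, z.1 ∈ Ioc s t → ∀ k', ¬ Active prec lam (Function.leftLim X z.1) k'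
      ((Function.leftLim Y z.1 : ℝ≥0) : ℝ) z.2) : X t = X s ∧ Y t = Y s + (t - s) := by
  obtain ⟨h1, h2⟩ := h.increment hst
  obtain ⟨h3, h4⟩ := ae_eq_zero_off_strip (X := X) hprec hsum htlam hgood
  have hfin : (S ∩ Ioc s t ×ˢ univ).Finite :=
    (hS.finite t).subset (inter_subset_inter_right _ (prod_mono (Ioc_subset_Ioc_left zero_le) le_rfl))
  rw [hS.setIntegral_eq_sum s t h3 hfin.toFinset (by simp), Finset.sum_eq_zero, add_zero] at h1
  · rw [hS.setIntegral_eq_sum s t h4 hfin.toFinset (by simp), Finset.sum_eq_zero, sub_zero,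
      ← NNReal.coe_sub hst, ← NNReal.coe_add] at h2
    · exact ⟨Subtype.ext h1, by exact_mod_cast h2⟩
    · intro z hz
      rw [Finite.mem_toFinset] at hz
      exact (hFun_of_not_active (good_of_mem hS hgood hz.1) (hin z hz.1 hz.2.1)).2
  · intro z hz
    rw [Finite.mem_toFinset] at hz
    exact (hFun_of_not_active (good_of_mem hS hgood hz.1) (hin z hz.1 hz.2.1)).1

/-- The times of points in the strip are locally finite, so some interval ending at u contains none
of them. The path drifts freely there, and its left limits can be read off. -/
lemma exists_left {u : ℝ≥0} (hu : 0 < u) : ∃ w < u, (∀ s, w < s → s < u →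
    Function.leftLim X u = X s ∧ Function.leftLim Y u = Y s + (u - s)) ∧
    ∀ z ∈ S, z.1 ∉ Ioo w u := by
  have hnhds : {w | ∀ z ∈ S, z.1 = w → w = u} ∈ 𝓝[<] u :=
    mem_nhdsWithin_of_mem_nhds (hS.eventually_isolated u)
  obtain ⟨w, hw, hiso⟩ := (mem_nhdsLT_iff_exists_Ioo_subset' hu).1 hnhds
  refine ⟨w, hw, fun s hws hsu => ?_, fun z hz hzm => ?_⟩
  · have hfree : ∀ t, s ≤ t → t < u → X t = X s ∧ Y t = Y s + (t - s) := by
      intro t hst htu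
      refine h.free_of_inactive hS hprec hsum htlam hgood hst fun z hz hzm => ?_
      exact absurd (hiso ⟨hws.trans hzm.1, hzm.2.trans_lt htu⟩ z hz rfl)
        (hzm.2.trans_lt htu).ne
    have hev : ∀ᶠ t in 𝓝[<] u, s ≤ t ∧ t < u :=
      (eventually_mem_nhdsWithin.and (mem_nhdsWithin_of_mem_nhds (Ioi_mem_nhds hsu))).mono
        fun t ht => ⟨le_of_lt ht.2, ht.1⟩
    have : (𝓝[<] u).NeBot := nhdsLT_neBot_of_exists_lt ⟨s, hsu⟩
    constructor
    · refine leftLim_eq_of_tendsto (tendsto_const_nhds.congr' ?_)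
      filter_upwards [hev] with t ht
      exact (hfree t ht.1 ht.2).1.symm
    · refine leftLim_eq_of_tendsto (Tendsto.congr' (f₁ := fun t => Y s + (t - s)) ?_ ?_)
      · filter_upwards [hev] with t ht
        exact (hfree t ht.1 ht.2).2.symm
      · have : Continuous fun t : ℝ≥0 => Y s + (t - s) := by fun_prop
        exact (this.tendsto u).mono_left nhdsWithin_le_nhds
  · exact hzm.2.ne (hiso hzm z hz rfl)

theorem chainPath : ChainPath prec lam tlam S X Y := by
  have hact : ∀ u v, (u, v) ∈ S → ∀ k', Active prec lam (Function.leftLim X u) k'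
      ((Function.leftLim Y u : ℝ≥0) : ℝ) v → X u = k'.1 ∧ Y u = 0 := by
    intro u v hz k' hk'
    have hu : 0 < u := (hS.subset hz).1
    obtain ⟨w, hw, hleft, hno⟩ := h.exists_left hS hprec hsum htlam hgood hu
    obtain ⟨s, hws, hsu⟩ := exists_between hw
    obtain ⟨hX, hY⟩ := hleft s hws hsu
    obtain ⟨h1, h2⟩ := h.increment hsu.le
    obtain ⟨h3, h4⟩ := ae_eq_zero_off_strip (X := X) hprec hsum htlam hgood
    -- Since S has isolated times and at most one point at each time, (u, v) is the only point of S
    -- in (s, u]; the increments are therefore single terms.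
    have hF : (({(u, v)} : Finset (ℝ≥0 × ℝ)) : Set (ℝ≥0 × ℝ)) = S ∩ Ioc s u ×ˢ univ := by
      ext z
      simp only [Finset.coe_singleton, mem_singleton_iff, mem_inter_iff, mem_prod, mem_univ,
        and_true]
      constructor
      · rintro rfl
        exact ⟨hz, hsu, le_rfl⟩
      · rintro ⟨hzS, hzm⟩
        refine hS.injOn hzS hz ?_
        by_contra hne
        exact hno z hzS ⟨hws.trans hzm.1, lt_of_le_of_ne hzm.2 hne⟩
    obtain ⟨h5, h6⟩ := hFun_of_active hprec hsum htlam (good_of_mem hS hgood hz) hk'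
    rw [hS.setIntegral_eq_sum s u h3 _ hF, Finset.sum_singleton, h5] at h1
    rw [hS.setIntegral_eq_sum s u h4 _ hF, Finset.sum_singleton, h6, hY] at h2
    push_cast [NNReal.coe_sub hsu.le] at h2
    refine ⟨Subtype.ext (by rw [h1, congrArg Subtype.val hX]; ring), ?_⟩
    rw [← NNReal.coe_eq_zero, h2]
    ring
  refine ⟨fun s d => ?_, fun t => ?_, fun u hu => ?_, hact, fun u hu hin => ?_,
    fun u v hz => good_of_mem hS hgood hz⟩
  · by_cases hin : ∀ z ∈ S, z.1 ∈ Ioc s (s + d) → ∀ k',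
      ¬ Active prec lam (Function.leftLim X z.1) k' ((Function.leftLim Y z.1 : ℝ≥0) : ℝ) z.2
    · left
      have := h.free_of_inactive hS hprec hsum htlam hgood (le_add_of_nonneg_right zero_le) hin
      rwa [add_tsub_cancel_left] at this
    -- An active point at u > s resets the age to zero. As g ≥ 0 the age then grows at most at unit
    -- speed, so at s + d it is at most s + d - u < d. In this way the age reveals whether a jump
    -- has occurred.
    · right
      push Not at hin
      obtain ⟨⟨u, v⟩, hz, hzm, k', hk'⟩ := hin
      have hY0 := (hact u v hz k' hk').2
      have h2 := (h.increment hzm.2).2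
      have h3 : 0 ≤ ∫ z in Ioc u (s + d) ×ˢ univ, gFun prec lam tlam
          (Function.leftLim X z.1) ((Function.leftLim Y z.1 : ℝ≥0) : ℝ) z.2 ∂μ :=
        integral_nonneg fun z => gFun_nonneg _ NNReal.zero_le_coe _
      have h4 : (s : ℝ) < u := by exact_mod_cast hzm.1
      rw [← NNReal.coe_lt_coe]
      rw [hY0] at h2
      push_cast at h2
      linarith
  · have hiso := hS.eventually_isolated t
    obtain ⟨ε, hε, hball⟩ := Metric.eventually_nhds_iff.1 hiso
    refine ⟨ε.toNNReal, Real.toNNReal_pos.2 hε, fun d hd => ?_⟩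
    have := h.free_of_inactive hS hprec hsum htlam hgood
      (le_add_of_nonneg_right zero_le : t ≤ t + d) fun z hz hzm => ?_
    · rwa [add_tsub_cancel_left] at this
    · refine absurd (hball ?_ z hz rfl) hzm.1.ne'
      have h1 : (t : ℝ) < z.1 := by exact_mod_cast hzm.1
      have h2 : (z.1 : ℝ) ≤ t + d := by exact_mod_cast hzm.2
      have h3 : (d : ℝ) < ε := by rw [← Real.coe_toNNReal ε hε.le]; exact_mod_cast hd
      rw [NNReal.dist_eq, abs_of_pos (by linarith)]
      linarith
  · obtain ⟨w, hw, hleft, -⟩ := h.exists_left hS hprec hsum htlam hgood hu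
    exact ⟨w, hw, hleft⟩
  · obtain ⟨w, hw, hleft, hno⟩ := h.exists_left hS hprec hsum htlam hgood hu
    obtain ⟨s, hws, hsu⟩ := exists_between hw
    obtain ⟨hX, hY⟩ := hleft s hws hsu
    rw [hX, hY]
    refine h.free_of_inactive hS hprec hsum htlam hgood hsu.le fun z hz hzm => ?_
    have hzu : z.1 = u := by
      by_contra hne
      exact hno z hz ⟨hws.trans hzm.1, lt_of_le_of_ne hzm.2 hne⟩
    rw [hzu]
    exact hin z.2 (hzu ▸ hz)

end

end SolvesPath

end ChainPath

/-! ### Meetings of two chains, recognized from countably many times -/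

section TwoChains

/-- Induction along `[s, ∞)`. -/
lemma forall_ge_of_forall_lt {p : ℝ≥0 → Prop} {s : ℝ≥0} (h0 : p s)
    (hright : ∀ t, s ≤ t → p t → ∃ ε > 0, ∀ d < ε, p (t + d))
    (hleft : ∀ t, s < t → (∀ r, s ≤ r → r < t → p r) → p t) : ∀ t, s ≤ t → p t := by
  by_contra! hne
  obtain ⟨t₁, hst₁, hpt₁⟩ := hne
  set B : Set ℝ≥0 := {t | s ≤ t ∧ ¬ p t} with hB
  have hBne : B.Nonempty := ⟨t₁, hst₁, hpt₁⟩
  have hsI : s ≤ sInf B := le_csInf hBne fun t ht => ht.1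
  have hlt : ∀ r, s ≤ r → r < sInf B → p r := fun r hsr hr => by
    by_contra hp
    exact absurd (csInf_le (OrderBot.bddBelow B) ⟨hsr, hp⟩) (not_le.2 hr)
  have hI : p (sInf B) := by
    rcases hsI.eq_or_lt with h | h
    · rwa [← h]
    · exact hleft _ h hlt
  obtain ⟨ε, hε, hε'⟩ := hright _ hsI hI
  obtain ⟨t, ht, htε⟩ := exists_lt_of_csInf_lt hBne (lt_add_of_pos_right (sInf B) hε)
  have hIt : sInf B ≤ t := csInf_le (OrderBot.bddBelow B) ht
  obtain ⟨d, rfl⟩ := exists_add_of_le hIt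
  exact ht.2 (hε' d (lt_of_add_lt_add_left htε))

variable {𝒳 : Set ℝ}

/-- There is no jump of the path after the time `τ` and before the time `u`. -/
def FreeOn (X : ℝ≥0 → 𝒳) (Y : ℝ≥0 → ℝ≥0) (τ u : ℝ≥0) : Prop :=
  ∀ s, τ ≤ s → s < u → X s = X τ ∧ Y s = Y τ + (s - τ)

lemma FreeOn.mono {X : ℝ≥0 → 𝒳} {Y : ℝ≥0 → ℝ≥0} {τ u u' : ℝ≥0} (h : FreeOn X Y τ u)
    (hu : u' ≤ u) : FreeOn X Y τ u' := fun s hs hsu => h s hs (hsu.trans_le hu)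

variable {prec : OffDiag 𝒳 → OffDiag 𝒳 → Prop} {lam tlam : OffDiag 𝒳 → ℝ → ℝ}
  {S : Set (ℝ≥0 × ℝ)}

namespace ChainPath

variable {X : ℝ≥0 → 𝒳} {Y : ℝ≥0 → ℝ≥0} (c : ChainPath prec lam tlam S X Y)

include c

lemma eq_of_le_age {s d : ℝ≥0} (h : d ≤ Y (s + d)) : X (s + d) = X s ∧ Y (s + d) = Y s + d :=
  (c.dichotomy s d).resolve_right (not_lt.2 h)

/-- A jump after τ would have reset the age and left it below u - τ. -/
lemma freeOn_of_le {τ u : ℝ≥0} (hu : u ≤ τ + Function.leftLim Y u) : FreeOn X Y τ u := by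
  intro s hτs hsu
  obtain ⟨w, hw, hleft⟩ := c.left u (zero_le.trans_lt hsu)
  obtain ⟨r, hr, hru⟩ := exists_between (max_lt hw hsu)
  have hsr : s < r := (le_max_right _ _).trans_lt hr
  have hY := (hleft r ((le_max_left _ _).trans_lt hr) hru).2
  have hYr : r ≤ τ + Y r := by
    rw [hY] at hu
    have : (u : ℝ) ≤ τ + (Y r + (u - r)) := by exact_mod_cast hu
    rw [← NNReal.coe_le_coe]
    push_cast
    linarith
  obtain ⟨d, rfl⟩ := exists_add_of_le hτs
  obtain ⟨e, rfl⟩ := exists_add_of_le hsr.le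
  have h1 : d + e ≤ Y (τ + d + e) := by
    rw [add_assoc] at hYr ⊢
    exact le_of_add_le_add_left hYr
  have h2 := c.eq_of_le_age ((le_add_of_nonneg_left zero_le).trans h1)
  have h3 := c.eq_of_le_age (s := τ) (d := d + e) (by rwa [← add_assoc])
  rw [← add_assoc] at h3
  refine ⟨h2.1.symm.trans h3.1, ?_⟩
  rw [add_tsub_cancel_left]
  have := h2.2.symm.trans h3.2
  rw [← add_assoc] at this
  exact add_right_cancel this

lemma leftLim_of_freeOn {τ u : ℝ≥0} (hτu : τ < u) (h : FreeOn X Y τ u) :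
    Function.leftLim X u = X τ ∧ Function.leftLim Y u = Y τ + (u - τ) := by
  obtain ⟨w, hw, hleft⟩ := c.left u (zero_le.trans_lt hτu)
  obtain ⟨r, hr, hru⟩ := exists_between (max_lt hw hτu)
  have hτr : τ ≤ r := ((le_max_right _ _).trans_lt hr).le
  obtain ⟨h1, h2⟩ := hleft r ((le_max_left _ _).trans_lt hr) hru
  obtain ⟨h3, h4⟩ := h r hτr hru
  refine ⟨h1.trans h3, ?_⟩
  rw [h2, h4, add_assoc, ← NNReal.coe_inj]
  push_cast [NNReal.coe_sub hτr, NNReal.coe_sub hru.le, NNReal.coe_sub hτu.le]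
  ring

end ChainPath

section

/-- The times of meeting after `T`. -/
def meetTimes (X₁ X₂ : ℝ≥0 → 𝒳) (Y₁ Y₂ : ℝ≥0 → ℝ≥0) (T : WithTop ℝ≥0) : Set ℝ≥0 :=
  {t | T < t ∧ X₁ t = X₂ t ∧ min (Y₁ t) (Y₂ t) = 0}

/-- The position at the time `q` shows that there was a meeting after `T` and before `q`. -/
def Seen (X₁ X₂ : ℝ≥0 → 𝒳) (Y₁ Y₂ : ℝ≥0 → ℝ≥0) (T : WithTop ℝ≥0) (q : ℝ≥0) : Prop :=
  X₁ q = X₂ q ∧ ∃ n : ℕ, T ≤ (TopologicalSpace.denseSeq ℝ≥0 n : ℝ≥0) ∧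
    TopologicalSpace.denseSeq ℝ≥0 n + min (Y₁ q) (Y₂ q) < q

/-- The time `u`, at which the smaller left-limit age is `a`, belongs to the first period in which
the chains stay together. -/
def Window (X₁ X₂ : ℝ≥0 → 𝒳) (Y₁ Y₂ : ℝ≥0 → ℝ≥0) (T : WithTop ℝ≥0) (a u : ℝ≥0) : Prop :=
  (∃ n, TopologicalSpace.denseSeq ℝ≥0 n < u ∧
    Seen X₁ X₂ Y₁ Y₂ T (TopologicalSpace.denseSeq ℝ≥0 n)) ∧
  ∀ n, TopologicalSpace.denseSeq ℝ≥0 n + a < u →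
    ¬ Seen X₁ X₂ Y₁ Y₂ T (TopologicalSpace.denseSeq ℝ≥0 n)

lemma exists_denseSeq_between {a b : ℝ≥0} (h : a < b) :
    ∃ n, a < TopologicalSpace.denseSeq ℝ≥0 n ∧ TopologicalSpace.denseSeq ℝ≥0 n < b := by
  obtain ⟨x, hx, h1, h2⟩ := (TopologicalSpace.denseRange_denseSeq ℝ≥0).exists_between h
  obtain ⟨n, rfl⟩ := hx
  exact ⟨n, h1, h2⟩

variable {X₁ X₂ : ℝ≥0 → 𝒳} {Y₁ Y₂ : ℝ≥0 → ℝ≥0} {T : WithTop ℝ≥0}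
  (c₁ : ChainPath prec lam tlam S X₁ Y₁) (c₂ : ChainPath prec lam tlam S X₂ Y₂)

include c₁ c₂

/-- Go back from q by the smaller of the two ages: by the dichotomy neither chain has jumped since,
so the states agreed then as well and the smaller age was zero. The dense time in `Seen` lies
strictly before that moment and not before T, which certifies that the meeting comes after T. -/
lemma Seen.exists_meetTimes {q : ℝ≥0} (h : Seen X₁ X₂ Y₁ Y₂ T q) :
    ∃ t ∈ meetTimes X₁ X₂ Y₁ Y₂ T, t ≤ q ∧ t + min (Y₁ q) (Y₂ q) = q := by
  obtain ⟨hX, n, hTn, hn⟩ := h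
  set a := min (Y₁ q) (Y₂ q) with ha
  obtain ⟨s, hs⟩ : ∃ s, q = s + a :=
    ⟨q - a, (tsub_add_cancel_of_le ((le_add_of_nonneg_left zero_le).trans hn.le)).symm⟩
  have h1 := c₁.eq_of_le_age (s := s) (d := a) (by rw [← hs]; exact min_le_left _ _)
  have h2 := c₂.eq_of_le_age (s := s) (d := a) (by rw [← hs]; exact min_le_right _ _)
  rw [← hs] at h1 h2
  refine ⟨s, ⟨?_, h1.1.symm.trans (hX.trans h2.1), ?_⟩, hs ▸ le_add_of_nonneg_right zero_le,
    hs.symm⟩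
  · refine hTn.trans_lt ?_
    rw [hs] at hn
    exact_mod_cast lt_of_add_lt_add_right hn
  · rw [h1.2, h2.2, min_add_add_right] at ha
    exact (add_eq_right.1 ha.symm)

lemma exists_seen_of_mem {t : ℝ≥0} (ht : t ∈ meetTimes X₁ X₂ Y₁ Y₂ T) :
    ∃ ε > 0, ∀ d < ε, Seen X₁ X₂ Y₁ Y₂ T (t + d) := by
  obtain ⟨hT, hX, hY⟩ := ht
  obtain ⟨ε₁, hε₁, h1⟩ := c₁.right t
  obtain ⟨ε₂, hε₂, h2⟩ := c₂.right t
  refine ⟨min ε₁ ε₂, lt_min hε₁ hε₂, fun d hd => ?_⟩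
  obtain ⟨hX1, hY1⟩ := h1 d (hd.trans_le (min_le_left _ _))
  obtain ⟨hX2, hY2⟩ := h2 d (hd.trans_le (min_le_right _ _))
  refine ⟨by rw [hX1, hX2, hX], ?_⟩
  obtain ⟨T₀, rfl⟩ := WithTop.ne_top_iff_exists.1 (hT.trans (WithTop.coe_lt_top t)).ne
  obtain ⟨n, hn1, hn2⟩ := exists_denseSeq_between (WithTop.coe_lt_coe.1 hT)
  refine ⟨n, WithTop.coe_le_coe.2 hn1.le, ?_⟩
  rw [hY1, hY2, min_add_add_right, hY, zero_add]
  exact add_lt_add_left hn2 d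

/-- Just after any time both ages grow by the elapsed time d, so the smaller one can vanish only for
d = 0. Meeting times therefore cannot accumulate at their infimum from the right. -/
lemma isLeast_sInf_meetTimes (hne : (meetTimes X₁ X₂ Y₁ Y₂ T).Nonempty) :
    IsLeast (meetTimes X₁ X₂ Y₁ Y₂ T) (sInf (meetTimes X₁ X₂ Y₁ Y₂ T)) := by
  set M := meetTimes X₁ X₂ Y₁ Y₂ T with hM
  refine ⟨?_, fun t ht => csInf_le (OrderBot.bddBelow M) ht⟩
  obtain ⟨ε₁, hε₁, h1⟩ := c₁.right (sInf M)
  obtain ⟨ε₂, hε₂, h2⟩ := c₂.right (sInf M)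
  obtain ⟨t, ht, htε⟩ := exists_lt_of_csInf_lt hne
    (lt_add_of_pos_right (sInf M) (lt_min hε₁ hε₂))
  obtain ⟨d, rfl⟩ := exists_add_of_le (csInf_le (OrderBot.bddBelow M) ht)
  have hd := lt_of_add_lt_add_left htε
  have h3 := ht.2.2
  rw [(h1 d (hd.trans_le (min_le_left _ _))).2, (h2 d (hd.trans_le (min_le_right _ _))).2,
    min_add_add_right] at h3
  rw [(add_eq_zero.1 h3).2, add_zero] at ht
  exact ht

lemma meetTimes_nonempty_iff :
    (meetTimes X₁ X₂ Y₁ Y₂ T).Nonempty ↔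
      ∃ n, Seen X₁ X₂ Y₁ Y₂ T (TopologicalSpace.denseSeq ℝ≥0 n) := by
  constructor
  · rintro ⟨t, ht⟩
    obtain ⟨ε, hε, h⟩ := exists_seen_of_mem c₁ c₂ ht
    obtain ⟨n, hn1, hn2⟩ := exists_denseSeq_between (lt_add_of_pos_right t hε)
    refine ⟨n, ?_⟩
    obtain ⟨d, hd⟩ := exists_add_of_le hn1.le
    rw [hd] at hn2 ⊢
    exact h d (lt_of_add_lt_add_left hn2)
  · rintro ⟨n, hn⟩
    obtain ⟨t, ht, -⟩ := hn.exists_meetTimes c₁ c₂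
    exact ⟨t, ht⟩

variable {τ : ℝ≥0} (hτ : IsLeast (meetTimes X₁ X₂ Y₁ Y₂ T) τ)

include hτ

/-- Let a be the smaller left-limit age at u. A meeting seen before u gives τ < u. Dense times just
after τ have seen the meeting, so if none before u - a has seen one, then u - a ≤ τ, and neither
chain has jumped in between. Conversely, without jumps a = u - τ, and no time before τ sees a
meeting. The point is that `Window` does not mention τ. -/
lemma window_iff (u : ℝ≥0) :
    Window X₁ X₂ Y₁ Y₂ T (min (Function.leftLim Y₁ u) (Function.leftLim Y₂ u)) u ↔
      τ < u ∧ FreeOn X₁ Y₁ τ u ∧ FreeOn X₂ Y₂ τ u := by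
  obtain ⟨ε, hε, hseen⟩ := exists_seen_of_mem c₁ c₂ hτ.1
  constructor
  · rintro ⟨⟨n, hnu, hn⟩, hno⟩
    have hτu : τ < u := by
      obtain ⟨t, ht, htn, -⟩ := hn.exists_meetTimes c₁ c₂
      exact (hτ.2 ht).trans_lt (htn.trans_lt hnu)
    have hle : u ≤ τ + min (Function.leftLim Y₁ u) (Function.leftLim Y₂ u) := by
      by_contra! hlt
      set a := min (Function.leftLim Y₁ u) (Function.leftLim Y₂ u)
      obtain ⟨e, he⟩ := exists_add_of_le hlt.le
      have he0 : 0 < e := by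
        rw [he] at hlt
        exact pos_of_lt_add_right hlt
      obtain ⟨m, hm1, hm2⟩ := exists_denseSeq_between (lt_add_of_pos_right τ (lt_min hε he0))
      obtain ⟨d, hd⟩ := exists_add_of_le hm1.le
      rw [hd] at hm2
      have hd' := lt_of_add_lt_add_left hm2
      refine hno m ?_ (hd ▸ hseen d (hd'.trans_le (min_le_left _ _)))
      rw [hd, he, add_right_comm]
      exact add_lt_add_right (hd'.trans_le (min_le_right _ _)) _
    exact ⟨hτu, c₁.freeOn_of_le (hle.trans (by gcongr; exact min_le_left _ _)),
      c₂.freeOn_of_le (hle.trans (by gcongr; exact min_le_right _ _))⟩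
  · rintro ⟨hτu, hf₁, hf₂⟩
    rw [(c₁.leftLim_of_freeOn hτu hf₁).2, (c₂.leftLim_of_freeOn hτu hf₂).2, min_add_add_right,
      hτ.1.2.2, zero_add]
    constructor
    · obtain ⟨m, hm1, hm2⟩ := exists_denseSeq_between
        (lt_min hτu (lt_add_of_pos_right τ hε))
      obtain ⟨d, hd⟩ := exists_add_of_le hm1.le
      refine ⟨m, hm2.trans_le (min_le_left _ _), hd ▸ hseen d ?_⟩
      rw [hd] at hm2
      exact lt_of_add_lt_add_left (hm2.trans_le (min_le_right _ _))
    · intro n hn hs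
      obtain ⟨t, ht, htn, -⟩ := hs.exists_meetTimes c₁ c₂
      have h1 : (TopologicalSpace.denseSeq ℝ≥0 n : ℝ) + (u - τ) < u := by
        rw [← NNReal.coe_sub hτu.le]
        exact_mod_cast hn
      have h2 : (τ : ℝ) ≤ TopologicalSpace.denseSeq ℝ≥0 n := by
        exact_mod_cast (hτ.2 ht).trans htn
      linarith

end

/-- Pathwise uniqueness: chains that agree before u have the same left limits at u, hence are
activated by the same point, if any, and move in the same way. -/
lemma eq_from_of_eq {X₁ X₂ : ℝ≥0 → 𝒳} {Y₁ Y₂ : ℝ≥0 → ℝ≥0}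
    (c₁ : ChainPath prec lam tlam S X₁ Y₁) (c₂ : ChainPath prec lam tlam S X₂ Y₂)
    {s : ℝ≥0} (hX : X₁ s = X₂ s) (hY : Y₁ s = Y₂ s) : ∀ t, s ≤ t → X₁ t = X₂ t ∧ Y₁ t = Y₂ t := by
  refine forall_ge_of_forall_lt ⟨hX, hY⟩ ?_ ?_
  · rintro t - ⟨h1, h2⟩
    obtain ⟨ε₁, hε₁, hr₁⟩ := c₁.right t
    obtain ⟨ε₂, hε₂, hr₂⟩ := c₂.right t
    refine ⟨min ε₁ ε₂, lt_min hε₁ hε₂, fun d hd => ?_⟩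
    obtain ⟨a1, b1⟩ := hr₁ d (hd.trans_le (min_le_left _ _))
    obtain ⟨a2, b2⟩ := hr₂ d (hd.trans_le (min_le_right _ _))
    rw [a1, a2, b1, b2, h1, h2]
    exact ⟨rfl, rfl⟩
  · intro t hst hall
    have ht := zero_le.trans_lt hst
    obtain ⟨w₁, hw₁, hl₁⟩ := c₁.left t ht
    obtain ⟨w₂, hw₂, hl₂⟩ := c₂.left t ht
    obtain ⟨r, hr, hrt⟩ := exists_between (max_lt (max_lt hw₁ hw₂) hst)
    obtain ⟨a1, b1⟩ := hl₁ r (((le_max_left _ _).trans (le_max_left _ _)).trans_lt hr) hrt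
    obtain ⟨a2, b2⟩ := hl₂ r (((le_max_right _ _).trans (le_max_left _ _)).trans_lt hr) hrt
    obtain ⟨a3, b3⟩ := hall r ((le_max_right _ _).trans_lt hr).le hrt
    have ha : Function.leftLim X₁ t = Function.leftLim X₂ t := by rw [a1, a2, a3]
    have hb : Function.leftLim Y₁ t = Function.leftLim Y₂ t := by rw [b1, b2, b3]
    by_cases hin : ∀ v, (t, v) ∈ S → ∀ k', ¬ Active prec lam (Function.leftLim X₁ t) k'
      ((Function.leftLim Y₁ t : ℝ≥0) : ℝ) v
    · have e1 := c₁.jump_inactive t ht hin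
      rw [ha, hb] at hin
      have e2 := c₂.jump_inactive t ht hin
      rw [e1.1, e1.2, e2.1, e2.2]
      exact ⟨ha, hb⟩
    · push Not at hin
      obtain ⟨v, hv, k', hk'⟩ := hin
      have e1 := c₁.jump_active t v hv k' hk'
      rw [e1.1, e1.2]
      rw [hb] at hk'
      -- The type of k' depends on the state, so the state becomes a variable before the two left
      -- limits are identified.
      generalize Function.leftLim X₁ t = x at ha k' hk'
      subst ha
      have e2 := c₂.jump_active t v hv k' hk'
      exact ⟨e2.1.symm, e2.2.symm⟩

end TwoChains

/-! ### The first hit after a meeting decides about merging -/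

section FirstHit

variable {𝒳 : Set ℝ}

/-- The heights at which one of the two chains of state `k` and ages `y₁`, `y₂` jumps. -/
def hitOr (prec : OffDiag 𝒳 → OffDiag 𝒳 → Prop) (lam : OffDiag 𝒳 → ℝ → ℝ) (k : 𝒳)
    (y₁ y₂ : ℝ) : Set ℝ :=
  {v | ∃ k', Active prec lam k k' y₁ v ∨ Active prec lam k k' y₂ v}

/-- The heights at which both chains of state `k` and ages `y₁`, `y₂` jump to the same state. -/
def hitAnd (prec : OffDiag 𝒳 → OffDiag 𝒳 → Prop) (lam : OffDiag 𝒳 → ℝ → ℝ) (k : 𝒳)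
    (y₁ y₂ : ℝ) : Set ℝ :=
  {v | ∃ k', Active prec lam k k' y₁ v ∧ Active prec lam k k' y₂ v}

variable {prec : OffDiag 𝒳 → OffDiag 𝒳 → Prop} {lam tlam : OffDiag 𝒳 → ℝ → ℝ}
  {S : Set (ℝ≥0 × ℝ)}

lemma hitOr_comm (k : 𝒳) (y₁ y₂ : ℝ) : hitOr prec lam k y₁ y₂ = hitOr prec lam k y₂ y₁ := by
  ext v; simp only [hitOr, mem_ofPred_eq, or_comm]

lemma hitAnd_comm (k : 𝒳) (y₁ y₂ : ℝ) : hitAnd prec lam k y₁ y₂ = hitAnd prec lam k y₂ y₁ := by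
  ext v; simp only [hitAnd, mem_ofPred_eq, and_comm]

lemma hitAnd_subset (k : 𝒳) (y₁ y₂ : ℝ) : hitAnd prec lam k y₁ y₂ ⊆ hitOr prec lam k y₁ y₂ :=
  fun _ ⟨k', h⟩ => ⟨k', Or.inl h.1⟩

namespace ChainPath

variable {X : ℝ≥0 → 𝒳} {Y : ℝ≥0 → ℝ≥0} (c : ChainPath prec lam tlam S X Y)

include c

lemma eq_of_active {u : ℝ≥0} {v : ℝ} (hz : (u, v) ∈ S) {k : 𝒳} (hk : Function.leftLim X u = k)
    {k' : {j : 𝒳 // j ≠ k}} (h : Active prec lam k k' ((Function.leftLim Y u : ℝ≥0) : ℝ) v) :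
    X u = k'.1 ∧ Y u = 0 := by
  subst hk
  exact c.jump_active u v hz k' h

lemma eq_of_inactive {u : ℝ≥0} (hu : 0 < u) {k : 𝒳} (hk : Function.leftLim X u = k)
    (h : ∀ v, (u, v) ∈ S → ∀ k', ¬ Active prec lam k k' ((Function.leftLim Y u : ℝ≥0) : ℝ) v) :
    X u = k ∧ Y u = Function.leftLim Y u := by
  subst hk
  exact c.jump_inactive u hu h

end ChainPath

/-- The position of two chains at a meeting time `τ` until they are separated or merge. -/
structure FirstHit (prec : OffDiag 𝒳 → OffDiag 𝒳 → Prop) (lam : OffDiag 𝒳 → ℝ → ℝ)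
    (S : Set (ℝ≥0 × ℝ)) (X₁ X₂ : ℝ≥0 → 𝒳) (Y₁ Y₂ : ℝ≥0 → ℝ≥0) (T : WithTop ℝ≥0) (τ ρ : ℝ≥0)
    (v : ℝ) : Prop where
  mem : (ρ, v) ∈ S
  lt : τ < ρ
  window_iff : ∀ u, Window X₁ X₂ Y₁ Y₂ T (min (Function.leftLim Y₁ u) (Function.leftLim Y₂ u)) u ↔
    u ∈ Ioc τ ρ
  hit : v ∈ hitOr prec lam (X₁ τ) ((Function.leftLim Y₁ ρ : ℝ≥0) : ℝ)
    ((Function.leftLim Y₂ ρ : ℝ≥0) : ℝ)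
  unique : ∀ z ∈ S, z.1 ∈ Ioc τ ρ → z.2 ∈ hitOr prec lam (X₁ τ)
    ((Function.leftLim Y₁ z.1 : ℝ≥0) : ℝ) ((Function.leftLim Y₂ z.1 : ℝ≥0) : ℝ) → z = (ρ, v)
  merged_iff : (∀ t, τ ≤ t → X₁ t = X₂ t) ↔ v ∈ hitAnd prec lam (X₁ τ)
    ((Function.leftLim Y₁ ρ : ℝ≥0) : ℝ) ((Function.leftLim Y₂ ρ : ℝ≥0) : ℝ)

variable {X₁ X₂ : ℝ≥0 → 𝒳} {Y₁ Y₂ : ℝ≥0 → ℝ≥0} {T : WithTop ℝ≥0}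
  (c₁ : ChainPath prec lam tlam S X₁ Y₁) (c₂ : ChainPath prec lam tlam S X₂ Y₂)
  {τ : ℝ≥0} (hτ : IsLeast (meetTimes X₁ X₂ Y₁ Y₂ T) τ)

include c₁ c₂ hτ

lemma leftLim_of_window {u : ℝ≥0}
    (hw : Window X₁ X₂ Y₁ Y₂ T (min (Function.leftLim Y₁ u) (Function.leftLim Y₂ u)) u) :
    τ < u ∧ Function.leftLim X₁ u = X₁ τ ∧ Function.leftLim X₂ u = X₁ τ ∧
      Function.leftLim Y₁ u = Y₁ τ + (u - τ) ∧ Function.leftLim Y₂ u = Y₂ τ + (u - τ) := by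
  obtain ⟨hτu, h1, h2⟩ := (window_iff c₁ c₂ hτ u).1 hw
  obtain ⟨a1, b1⟩ := c₁.leftLim_of_freeOn hτu h1
  obtain ⟨a2, b2⟩ := c₂.leftLim_of_freeOn hτu h2
  exact ⟨hτu, a1, a2.trans hτ.1.2.1.symm, b1, b2⟩

lemma eq_of_window {u u' : ℝ≥0} (hu : τ ≤ u) (huu : u < u')
    (hw : Window X₁ X₂ Y₁ Y₂ T (min (Function.leftLim Y₁ u') (Function.leftLim Y₂ u')) u') :
    X₁ u = X₁ τ ∧ X₂ u = X₁ τ := by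
  obtain ⟨-, h1, h2⟩ := (window_iff c₁ c₂ hτ u').1 hw
  exact ⟨(h1 u hu huu).1, (h2 u hu huu).1.trans hτ.1.2.1.symm⟩

lemma not_window_of_hit {u u' : ℝ≥0} {v : ℝ} (hz : (u, v) ∈ S)
    (hw : Window X₁ X₂ Y₁ Y₂ T (min (Function.leftLim Y₁ u) (Function.leftLim Y₂ u)) u)
    (hhit : v ∈ hitOr prec lam (X₁ τ) ((Function.leftLim Y₁ u : ℝ≥0) : ℝ)
      ((Function.leftLim Y₂ u : ℝ≥0) : ℝ)) (huu : u < u') :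
    ¬ Window X₁ X₂ Y₁ Y₂ T (min (Function.leftLim Y₁ u') (Function.leftLim Y₂ u')) u' := by
  intro hw'
  obtain ⟨hτu, hX1, hX2, -, -⟩ := leftLim_of_window c₁ c₂ hτ hw
  obtain ⟨e1, e2⟩ := eq_of_window c₁ c₂ hτ hτu.le huu hw'
  obtain ⟨k', hk' | hk'⟩ := hhit
  · exact k'.2 ((c₁.eq_of_active hz hX1 hk').1.symm.trans e1)
  · exact k'.2 ((c₂.eq_of_active hz hX2 hk').1.symm.trans e2)

/-- The chain that is hit leaves k for some k'. The other chain either stays in k, which separates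
the two, or is activated by the same point, and then `Active.unique` sends it to k' too. After a
joint jump both ages are zero, and pathwise uniqueness keeps the chains together. -/
lemma merged_iff_of_hit (hprec : IsStrictTotalOrder (OffDiag 𝒳) prec)
    (hsum : Summable fun p => supNorm (lam p)) (htlam : IsSpacing lam tlam)
    (hinj : InjOn Prod.fst S) {ρ : ℝ≥0} {v : ℝ} (hz : (ρ, v) ∈ S)
    (hw : Window X₁ X₂ Y₁ Y₂ T (min (Function.leftLim Y₁ ρ) (Function.leftLim Y₂ ρ)) ρ)
    (hhit : v ∈ hitOr prec lam (X₁ τ) ((Function.leftLim Y₁ ρ : ℝ≥0) : ℝ)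
      ((Function.leftLim Y₂ ρ : ℝ≥0) : ℝ)) :
    (∀ t, τ ≤ t → X₁ t = X₂ t) ↔ v ∈ hitAnd prec lam (X₁ τ)
      ((Function.leftLim Y₁ ρ : ℝ≥0) : ℝ) ((Function.leftLim Y₂ ρ : ℝ≥0) : ℝ) := by
  obtain ⟨hτρ, hX1, hX2, -, -⟩ := leftLim_of_window c₁ c₂ hτ hw
  have hρ : 0 < ρ := zero_le.trans_lt hτρ
  have hv : ∀ v', (ρ, v') ∈ S → v' = v := fun v' hv' => congrArg Prod.snd (hinj hv' hz rfl)
  constructor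
  · intro hm
    have hmρ := hm ρ hτρ.le
    obtain ⟨k', hk' | hk'⟩ := hhit
    · refine ⟨k', hk', ?_⟩
      have e1 := (c₁.eq_of_active hz hX1 hk').1
      by_contra hna
      by_cases hex : ∃ k'', Active prec lam (X₁ τ) k'' ((Function.leftLim Y₂ ρ : ℝ≥0) : ℝ) v
      · obtain ⟨k'', hk''⟩ := hex
        have := Active.unique hprec hsum htlam (c₁.good ρ v hz) (c₂.good ρ v hz) hk' hk''
        exact hna (this ▸ hk'')
      · push Not at hex
        have e2 := (c₂.eq_of_inactive hρ hX2 fun v' hv' => hv v' hv' ▸ hex).1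
        exact k'.2 (by rw [← e1, hmρ, e2])
    · refine ⟨k', ?_, hk'⟩
      have e1 := (c₂.eq_of_active hz hX2 hk').1
      by_contra hna
      by_cases hex : ∃ k'', Active prec lam (X₁ τ) k'' ((Function.leftLim Y₁ ρ : ℝ≥0) : ℝ) v
      · obtain ⟨k'', hk''⟩ := hex
        have := Active.unique hprec hsum htlam (c₂.good ρ v hz) (c₁.good ρ v hz) hk' hk''
        exact hna (this ▸ hk'')
      · push Not at hex
        have e2 := (c₁.eq_of_inactive hρ hX1 fun v' hv' => hv v' hv' ▸ hex).1
        exact k'.2 (by rw [← e1, ← hmρ, e2])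
  · rintro ⟨k', h1, h2⟩ t ht
    obtain ⟨a1, b1⟩ := c₁.eq_of_active hz hX1 h1
    obtain ⟨a2, b2⟩ := c₂.eq_of_active hz hX2 h2
    rcases lt_or_ge t ρ with htρ | htρ
    · obtain ⟨e1, e2⟩ := eq_of_window c₁ c₂ hτ ht htρ hw
      rw [e1, e2]
    · exact (eq_from_of_eq c₁ c₂ (a1.trans a2.symm) (b1.trans b2.symm) t htρ).1

lemma window_of_no_hit
    (hno : ∀ z ∈ S,
      Window X₁ X₂ Y₁ Y₂ T (min (Function.leftLim Y₁ z.1) (Function.leftLim Y₂ z.1)) z.1 →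
      z.2 ∉ hitOr prec lam (X₁ τ) ((Function.leftLim Y₁ z.1 : ℝ≥0) : ℝ)
        ((Function.leftLim Y₂ z.1 : ℝ≥0) : ℝ)) {u : ℝ≥0} (hu : τ < u) :
    Window X₁ X₂ Y₁ Y₂ T (min (Function.leftLim Y₁ u) (Function.leftLim Y₂ u)) u := by
  have key : ∀ t, τ ≤ t → (X₁ t = X₁ τ ∧ Y₁ t = Y₁ τ + (t - τ)) ∧
      (X₂ t = X₂ τ ∧ Y₂ t = Y₂ τ + (t - τ)) := by
    refine forall_ge_of_forall_lt (by simp) ?_ ?_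
    · rintro t hτt ⟨⟨h1, h2⟩, h3, h4⟩
      obtain ⟨ε₁, hε₁, hr₁⟩ := c₁.right t
      obtain ⟨ε₂, hε₂, hr₂⟩ := c₂.right t
      refine ⟨min ε₁ ε₂, lt_min hε₁ hε₂, fun d hd => ?_⟩
      obtain ⟨a1, b1⟩ := hr₁ d (hd.trans_le (min_le_left _ _))
      obtain ⟨a2, b2⟩ := hr₂ d (hd.trans_le (min_le_right _ _))
      rw [a1, a2, b1, b2, h1, h2, h3, h4, tsub_add_eq_add_tsub hτt |>.symm]
      simp [add_assoc]
    · intro t hτt hall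
      have hw := (window_iff c₁ c₂ hτ t).2 ⟨hτt, fun s h1 h2 => (hall s h1 h2).1,
        fun s h1 h2 => (hall s h1 h2).2⟩
      obtain ⟨-, hX1, hX2, hY1, hY2⟩ := leftLim_of_window c₁ c₂ hτ hw
      have ht := zero_le.trans_lt hτt
      have hv : ∀ v, (t, v) ∈ S → ∀ k',
          ¬ Active prec lam (X₁ τ) k' ((Function.leftLim Y₁ t : ℝ≥0) : ℝ) v ∧
          ¬ Active prec lam (X₁ τ) k' ((Function.leftLim Y₂ t : ℝ≥0) : ℝ) v := fun v hv k' =>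
        ⟨fun h => hno _ hv hw ⟨k', Or.inl h⟩, fun h => hno _ hv hw ⟨k', Or.inr h⟩⟩
      obtain ⟨a1, b1⟩ := c₁.eq_of_inactive ht hX1 fun v h k' => (hv v h k').1
      obtain ⟨a2, b2⟩ := c₂.eq_of_inactive ht hX2 fun v h k' => (hv v h k').2
      exact ⟨⟨a1, b1.trans hY1⟩, a2.trans hτ.1.2.1, b2.trans hY2⟩
  exact (window_iff c₁ c₂ hτ u).2 ⟨hu, fun s hs _ => (key s hs).1, fun s hs _ => (key s hs).2⟩

/-- A hit moves a chain out of the common state and so closes the window, whence there is at most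
one hit in it. Without a hit the window never closes; this alternative is excluded later, almost
surely, by the divergence of the rates. -/
theorem exists_firstHit_or (hprec : IsStrictTotalOrder (OffDiag 𝒳) prec)
    (hsum : Summable fun p => supNorm (lam p)) (htlam : IsSpacing lam tlam)
    (hinj : InjOn Prod.fst S) :
    (∃ ρ v, FirstHit prec lam S X₁ X₂ Y₁ Y₂ T τ ρ v) ∨
      (∀ u, Window X₁ X₂ Y₁ Y₂ T (min (Function.leftLim Y₁ u) (Function.leftLim Y₂ u)) u ↔
        u ∈ Ioi τ) ∧
      ∀ z ∈ S, z.1 ∈ Ioi τ → z.2 ∉ hitOr prec lam (X₁ τ)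
        ((Function.leftLim Y₁ z.1 : ℝ≥0) : ℝ) ((Function.leftLim Y₂ z.1 : ℝ≥0) : ℝ) := by
  by_cases hex : ∃ z ∈ S,
      Window X₁ X₂ Y₁ Y₂ T (min (Function.leftLim Y₁ z.1) (Function.leftLim Y₂ z.1)) z.1 ∧
      z.2 ∈ hitOr prec lam (X₁ τ) ((Function.leftLim Y₁ z.1 : ℝ≥0) : ℝ)
        ((Function.leftLim Y₂ z.1 : ℝ≥0) : ℝ)
  · obtain ⟨⟨ρ, v⟩, hz, hw, hhit⟩ := hex
    left
    have hiff : ∀ u, Window X₁ X₂ Y₁ Y₂ T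
        (min (Function.leftLim Y₁ u) (Function.leftLim Y₂ u)) u ↔ u ∈ Ioc τ ρ := by
      intro u
      constructor
      · intro hwu
        refine ⟨(leftLim_of_window c₁ c₂ hτ hwu).1, ?_⟩
        by_contra! hlt
        exact not_window_of_hit c₁ c₂ hτ hz hw hhit hlt hwu
      · rintro ⟨h1, h2⟩
        obtain ⟨-, h3, h4⟩ := (window_iff c₁ c₂ hτ ρ).1 hw
        exact (window_iff c₁ c₂ hτ u).2 ⟨h1, h3.mono h2, h4.mono h2⟩
    refine ⟨ρ, v, hz, (leftLim_of_window c₁ c₂ hτ hw).1, hiff, hhit, ?_,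
      merged_iff_of_hit c₁ c₂ hτ hprec hsum htlam hinj hz hw hhit⟩
    intro z hzS hzm hzh
    refine hinj hzS hz ?_
    rcases hzm.2.eq_or_lt with h | h
    · exact h
    · exact absurd hw (not_window_of_hit c₁ c₂ hτ hzS ((hiff _).2 hzm) hzh h)
  · right
    push Not at hex
    have hall : ∀ u, Window X₁ X₂ Y₁ Y₂ T
        (min (Function.leftLim Y₁ u) (Function.leftLim Y₂ u)) u ↔ u ∈ Ioi τ := fun u =>
      ⟨fun h => (leftLim_of_window c₁ c₂ hτ h).1, fun h => window_of_no_hit c₁ c₂ hτ hex h⟩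
    exact ⟨hall, fun z hz hzm => hex z hz ((hall _).2 hzm)⟩

end FirstHit

/-! ### Integrals over the window, against Lebesgue measure and over the points -/

section PathIntegrals

variable {𝒳 : Set ℝ} {prec : OffDiag 𝒳 → OffDiag 𝒳 → Prop} {lam tlam : OffDiag 𝒳 → ℝ → ℝ}

/-- A family of sets of heights at which something happens to two chains of the same state, with
the rate `r k y a` at the ages `a` and `y + a`. -/
structure IsHitRule (prec : OffDiag 𝒳 → OffDiag 𝒳 → Prop) (lam : OffDiag 𝒳 → ℝ → ℝ)
    (hit : 𝒳 → ℝ → ℝ → Set ℝ) (r : 𝒳 → ℝ → ℝ → ℝ) : Prop where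
  comm : ∀ k y₁ y₂, hit k y₁ y₂ = hit k y₂ y₁
  subset : ∀ k y₁ y₂, hit k y₁ y₂ ⊆ hitOr prec lam k y₁ y₂
  measurableSet : ∀ k, MeasurableSet {p : (ℝ × ℝ) × ℝ | p.2 ∈ hit k p.1.1 p.1.2}
  volume_eq : ∀ k y, 0 ≤ y → ∀ᵐ a : ℝ, 0 ≤ a → volume (hit k a (y + a)) = ENNReal.ofReal (r k y a)

lemma measurableSet_active (hlam : IsRateMatrix lam) (k : 𝒳) (k' : {j : 𝒳 // j ≠ k})
    {f : (ℝ × ℝ) → ℝ} (hf : Measurable f) :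
    MeasurableSet {p : (ℝ × ℝ) × ℝ | Active prec lam k k' (f p.1) p.2} := by
  refine (measurableSet_le measurable_const measurable_snd).inter
    (measurableSet_lt measurable_snd (measurable_const.add ?_))
  exact (hlam.measurable _).comp (hf.comp measurable_fst)

lemma isHitRule_or [Countable 𝒳] (hprec : IsStrictTotalOrder (OffDiag 𝒳) prec)
    (hlam : IsRateMatrix lam) (htlam : IsSpacing lam tlam)
    (hA3 : ∀ p, ∀ᵐ y ∂(volume.restrict (Ici (0 : ℝ))), tlam p y = supNorm (lam p)) :
    IsHitRule prec lam (hitOr prec lam) (maxRate lam) where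
  comm := hitOr_comm
  subset _ _ _ := le_rfl
  measurableSet k := by
    have : {p : (ℝ × ℝ) × ℝ | p.2 ∈ hitOr prec lam k p.1.1 p.1.2} =
        ⋃ k', ({p | Active prec lam k k' p.1.1 p.2} ∪ {p | Active prec lam k k' p.1.2 p.2}) := by
      ext p; simp [hitOr]
    rw [this]
    exact MeasurableSet.iUnion fun k' => (measurableSet_active hlam k k' measurable_fst).union
      (measurableSet_active hlam k k' measurable_snd)
  volume_eq k y hy := by
    filter_upwards [ae_mem_goodAges_add hA3 hy] with a ha ha0
    exact volume_active_or hprec hlam htlam k (ha ha0).1 (ha ha0).2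

lemma isHitRule_and [Countable 𝒳] (hprec : IsStrictTotalOrder (OffDiag 𝒳) prec)
    (hlam : IsRateMatrix lam) (htlam : IsSpacing lam tlam)
    (hA3 : ∀ p, ∀ᵐ y ∂(volume.restrict (Ici (0 : ℝ))), tlam p y = supNorm (lam p)) :
    IsHitRule prec lam (hitAnd prec lam) (minRate lam) where
  comm := hitAnd_comm
  subset := hitAnd_subset
  measurableSet k := by
    have : {p : (ℝ × ℝ) × ℝ | p.2 ∈ hitAnd prec lam k p.1.1 p.1.2} =
        ⋃ k', ({p | Active prec lam k k' p.1.1 p.2} ∩ {p | Active prec lam k k' p.1.2 p.2}) := by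
      ext p; simp [hitAnd]
    rw [this]
    exact MeasurableSet.iUnion fun k' => (measurableSet_active hlam k k' measurable_fst).inter
      (measurableSet_active hlam k k' measurable_snd)
  volume_eq k y hy := by
    filter_upwards [ae_mem_goodAges_add hA3 hy] with a ha ha0
    exact volume_active_and hprec hlam htlam k (ha ha0).1 (ha ha0).2

open Classical in
/-- The weight `f` of the time since the meeting, charged to the heights in `hit` as long as the
period `w` lasts; it is expressed through the state `k` and the ages `y₁`, `y₂`. -/
def hitTerm (hit : 𝒳 → ℝ → ℝ → Set ℝ) (f : (𝒳 × ℝ≥0) × ℝ → ℝ≥0∞) (w : Prop) (k : 𝒳)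
    (y₁ y₂ : ℝ≥0) (v : ℝ) : ℝ≥0∞ :=
  if w ∧ v ∈ hit k y₁ y₂ then f ((k, max y₁ y₂ - min y₁ y₂), (min y₁ y₂ : ℝ≥0)) else 0

lemma hitTerm_of_not (hit : 𝒳 → ℝ → ℝ → Set ℝ) (f : (𝒳 × ℝ≥0) × ℝ → ℝ≥0∞) {w : Prop} (hw : ¬ w)
    (k : 𝒳) (y₁ y₂ : ℝ≥0) (v : ℝ) : hitTerm hit f w k y₁ y₂ v = 0 :=
  if_neg fun h => hw h.1

lemma hitTerm_of_notMem {hit : 𝒳 → ℝ → ℝ → Set ℝ} (f : (𝒳 × ℝ≥0) × ℝ → ℝ≥0∞) (w : Prop)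
    {k : 𝒳} {y₁ y₂ : ℝ≥0} {v : ℝ} (hv : v ∉ hit k y₁ y₂) : hitTerm hit f w k y₁ y₂ v = 0 :=
  if_neg fun h => hv h.2

variable {hit : 𝒳 → ℝ → ℝ → Set ℝ} {r : 𝒳 → ℝ → ℝ → ℝ}

lemma IsHitRule.hit_shift (hh : IsHitRule prec lam hit r) (k : 𝒳) {b₁ b₂ : ℝ≥0}
    (hb : min b₁ b₂ = 0) (d : ℝ≥0) :
    hit k ((b₁ + d : ℝ≥0) : ℝ) ((b₂ + d : ℝ≥0) : ℝ) = hit k d ((max b₁ b₂ : ℝ≥0) + d) := by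
  rcases le_total b₁ b₂ with h | h
  · rw [min_eq_left h] at hb
    rw [max_eq_right h, hb, zero_add, NNReal.coe_add]
  · rw [min_eq_right h] at hb
    rw [max_eq_left h, hb, zero_add, hh.comm, NNReal.coe_add]

/-- The present ages determine the past: the smaller one is the time since the meeting, and their
difference is the larger age at the meeting. This is why the integrand can be written without τ. -/
lemma IsHitRule.hitTerm_of_window (hh : IsHitRule prec lam hit r) (f : (𝒳 × ℝ≥0) × ℝ → ℝ≥0∞)
    {w : Prop} (hw : w) (k : 𝒳) {b₁ b₂ : ℝ≥0} (hb : min b₁ b₂ = 0) (d : ℝ≥0) (v : ℝ) :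
    hitTerm hit f w k (b₁ + d) (b₂ + d) v =
      (hit k d ((max b₁ b₂ : ℝ≥0) + d)).indicator (fun _ => f ((k, max b₁ b₂), d)) v := by
  classical
  rw [hitTerm, indicator, hh.hit_shift k hb, min_add_add_right, max_add_add_right, hb, zero_add,
    add_tsub_cancel_right]
  simp [hw]

lemma lintegral_lebesgueHalfLine_shift (τ : ℝ≥0) {J : Set ℝ} (hJ : MeasurableSet J)
    (hJτ : J ⊆ Ioi (τ : ℝ)) (g : ℝ → ℝ≥0∞) :
    ∫⁻ u in ((↑) : ℝ≥0 → ℝ) ⁻¹' J, g ((u : ℝ) - τ) ∂lebesgueHalfLine =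
      ∫⁻ a in (· + (τ : ℝ)) ⁻¹' J, g a := by
  have hme : MeasurableEmbedding ((↑) : ℝ≥0 → ℝ) :=
    MeasurableEmbedding.subtype_coe (measurableSet_Ici (a := (0:ℝ)))
  have h1 : ∫⁻ u in ((↑) : ℝ≥0 → ℝ) ⁻¹' J, g ((u : ℝ) - τ) ∂lebesgueHalfLine =
      ∫⁻ x in J, g (x - τ) ∂(lebesgueHalfLine.map ((↑) : ℝ≥0 → ℝ)) :=
    by
    have := hme.lintegral_map (μ := lebesgueHalfLine.restrict (((↑) : ℝ≥0 → ℝ) ⁻¹' J))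
      (fun x => g (x - τ))
    rw [hme.restrict_map]
    exact this.symm
  rw [h1, map_coe_lebesgueHalfLine, Measure.restrict_restrict hJ,
    inter_eq_left.2 (show J ⊆ Ici 0 from hJτ.trans fun x hx => τ.2.trans (le_of_lt hx)),
    ← lintegral_indicator hJ, ← lintegral_add_right_eq_self _ (τ : ℝ),
    ← lintegral_indicator (measurable_add_const (τ : ℝ) hJ)]
  refine lintegral_congr fun a => ?_
  by_cases ha : a + τ ∈ J
  · rw [indicator_of_mem ha, indicator_of_mem (by exact ha), add_sub_cancel_right]
  · rw [indicator_of_notMem ha, indicator_of_notMem (by exact ha)]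

section

variable {X₁ X₂ : ℝ≥0 → 𝒳} {Y₁ Y₂ : ℝ≥0 → ℝ≥0} {T : WithTop ℝ≥0} {S : Set (ℝ≥0 × ℝ)}

/-- The term `hitTerm` along the left limits of two paths. -/
def pathTerm (hit : 𝒳 → ℝ → ℝ → Set ℝ) (f : (𝒳 × ℝ≥0) × ℝ → ℝ≥0∞) (X₁ X₂ : ℝ≥0 → 𝒳)
    (Y₁ Y₂ : ℝ≥0 → ℝ≥0) (T : WithTop ℝ≥0) (z : ℝ≥0 × ℝ) : ℝ≥0∞ :=
  hitTerm hit f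
    (Window X₁ X₂ Y₁ Y₂ T (min (Function.leftLim Y₁ z.1) (Function.leftLim Y₂ z.1)) z.1)
    (Function.leftLim X₁ z.1) (Function.leftLim Y₁ z.1) (Function.leftLim Y₂ z.1) z.2

variable (c₁ : ChainPath prec lam tlam S X₁ Y₁) (c₂ : ChainPath prec lam tlam S X₂ Y₂)
  {τ : ℝ≥0} (hτ : IsLeast (meetTimes X₁ X₂ Y₁ Y₂ T) τ)

include c₁ c₂ in
lemma pathTerm_of_empty (hne : ¬ (meetTimes X₁ X₂ Y₁ Y₂ T).Nonempty)
    (f : (𝒳 × ℝ≥0) × ℝ → ℝ≥0∞) (z : ℝ≥0 × ℝ) : pathTerm hit f X₁ X₂ Y₁ Y₂ T z = 0 := by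
  refine hitTerm_of_not _ _ (fun hw => hne ?_) _ _ _ _
  obtain ⟨⟨n, -, hn⟩, -⟩ := hw
  exact (meetTimes_nonempty_iff c₁ c₂).2 ⟨n, hn⟩

include c₁ c₂ hτ

lemma IsHitRule.pathTerm_of_window (hh : IsHitRule prec lam hit r) (f : (𝒳 × ℝ≥0) × ℝ → ℝ≥0∞)
    {z : ℝ≥0 × ℝ} (hw : Window X₁ X₂ Y₁ Y₂ T
      (min (Function.leftLim Y₁ z.1) (Function.leftLim Y₂ z.1)) z.1) :
    pathTerm hit f X₁ X₂ Y₁ Y₂ T z =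
      (hit (X₁ τ) ((z.1 : ℝ) - τ) ((max (Y₁ τ) (Y₂ τ) : ℝ≥0) + ((z.1 : ℝ) - τ))).indicator
        (fun _ => f ((X₁ τ, max (Y₁ τ) (Y₂ τ)), (z.1 : ℝ) - τ)) z.2 := by
  obtain ⟨hlt, h1, -, h3, h4⟩ := leftLim_of_window c₁ c₂ hτ hw
  have := hh.hitTerm_of_window f hw (X₁ τ) hτ.1.2.2 (z.1 - τ) z.2
  rw [pathTerm, h1]
  rw [← h3, ← h4, NNReal.coe_sub hlt.le] at this
  exact this

/-- Integrating over the heights first replaces the hit set by its length, which is the rate at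
almost every age; a shift of time by τ then turns times into elapsed times. -/
lemma IsHitRule.lintegral_pathTerm (hh : IsHitRule prec lam hit r)
    {f : (𝒳 × ℝ≥0) × ℝ → ℝ≥0∞} (hf : Measurable f) {J : Set ℝ} (hJ : MeasurableSet J)
    (hJτ : J ⊆ Ioi (τ : ℝ))
    (hw : ∀ u, Window X₁ X₂ Y₁ Y₂ T (min (Function.leftLim Y₁ u) (Function.leftLim Y₂ u)) u ↔
      (u : ℝ) ∈ J) :
    ∫⁻ z in Ioi 0 ×ˢ univ, pathTerm hit f X₁ X₂ Y₁ Y₂ T z ∂lebesgueHalfPlane =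
      ∫⁻ a in (· + (τ : ℝ)) ⁻¹' J, f ((X₁ τ, max (Y₁ τ) (Y₂ τ)), a) *
        ENNReal.ofReal (r (X₁ τ) (max (Y₁ τ) (Y₂ τ) : ℝ≥0) a) := by
  set k := X₁ τ
  set y := max (Y₁ τ) (Y₂ τ)
  set J' : Set ℝ≥0 := (↑) ⁻¹' J with hJ'
  have hJ'm : MeasurableSet J' := measurable_coe_nnreal_real hJ
  set A : Set (ℝ≥0 × ℝ) := {z | z.1 ∈ J' ∧ z.2 ∈ hit k ((z.1 : ℝ) - τ) (y + ((z.1 : ℝ) - τ))}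
  have hφ : Measurable fun z : ℝ≥0 × ℝ => (z.1 : ℝ) - τ :=
    (measurable_coe_nnreal_real.comp measurable_fst).sub_const _
  have hA : MeasurableSet A := by
    refine (measurable_fst hJ'm).inter ?_
    exact ((hφ.prodMk (hφ.const_add _)).prodMk measurable_snd) (hh.measurableSet k)
  have hG : ∀ z, pathTerm hit f X₁ X₂ Y₁ Y₂ T z =
      A.indicator (fun z => f ((k, y), (z.1 : ℝ) - τ)) z := by
    intro z
    by_cases hz : z.1 ∈ J'
    · rw [hh.pathTerm_of_window c₁ c₂ hτ f ((hw z.1).2 hz)]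
      by_cases hv : z.2 ∈ hit k ((z.1 : ℝ) - τ) (y + ((z.1 : ℝ) - τ))
      · rw [indicator_of_mem hv, indicator_of_mem (show z ∈ A from ⟨hz, hv⟩)]
      · rw [indicator_of_notMem hv, indicator_of_notMem (show z ∉ A from fun h => hv h.2)]
    · rw [indicator_of_notMem (show z ∉ A from fun h => hz h.1), pathTerm,
        hitTerm_of_not _ _ (fun h => hz ((hw z.1).1 h))]
  have hGm : Measurable (A.indicator fun z : ℝ≥0 × ℝ => f ((k, y), (z.1 : ℝ) - τ)) :=
    (hf.comp (measurable_const.prodMk hφ)).indicator hA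
  calc ∫⁻ z in Ioi 0 ×ˢ univ, pathTerm hit f X₁ X₂ Y₁ Y₂ T z ∂lebesgueHalfPlane
      = ∫⁻ u in Ioi 0, ∫⁻ v : ℝ, A.indicator (fun z => f ((k, y), (z.1 : ℝ) - τ)) (u, v) ∂volume
          ∂lebesgueHalfLine := by
        rw [lintegral_congr hG, lebesgueHalfPlane, ← Measure.prod_restrict,
          Measure.restrict_univ, lintegral_prod _ hGm.aemeasurable]
    _ = ∫⁻ u in Ioi 0, J'.indicator (fun u => f ((k, y), (u : ℝ) - τ) *
          volume (hit k ((u : ℝ) - τ) (y + ((u : ℝ) - τ)))) u ∂lebesgueHalfLine := by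
        refine lintegral_congr fun u => ?_
        by_cases hu : u ∈ J'
        · rw [indicator_of_mem hu]
          have : ∀ v, A.indicator (fun z => f ((k, y), (z.1 : ℝ) - τ)) (u, v) =
              (hit k ((u : ℝ) - τ) (y + ((u : ℝ) - τ))).indicator
                (fun _ => f ((k, y), (u : ℝ) - τ)) v := by
            intro v
            by_cases hv : v ∈ hit k ((u : ℝ) - τ) (y + ((u : ℝ) - τ))
            · rw [indicator_of_mem hv, indicator_of_mem (show (u, v) ∈ A from ⟨hu, hv⟩)]
            · rw [indicator_of_notMem hv, indicator_of_notMem (show (u, v) ∉ A from fun h => hv h.2)]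
          rw [lintegral_congr this, lintegral_indicator, setLIntegral_const]
          exact (measurable_prodMk_left (x := ((u : ℝ) - τ, y + ((u : ℝ) - τ))))
            (hh.measurableSet k)
        · rw [indicator_of_notMem hu]
          have : ∀ v, A.indicator (fun z => f ((k, y), (z.1 : ℝ) - τ)) (u, v) = 0 := fun v =>
            indicator_of_notMem (fun h => hu h.1) _
          rw [lintegral_congr this, lintegral_zero]
    _ = ∫⁻ u in J', f ((k, y), (u : ℝ) - τ) *
          volume (hit k ((u : ℝ) - τ) (y + ((u : ℝ) - τ))) ∂lebesgueHalfLine := by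
        rw [lintegral_indicator hJ'm, Measure.restrict_restrict hJ'm, inter_eq_left.2]
        exact fun u hu => zero_le.trans_lt (NNReal.coe_lt_coe.1 (hJτ hu))
    _ = ∫⁻ a in (· + (τ : ℝ)) ⁻¹' J, f ((k, y), a) * volume (hit k a (y + a)) :=
        lintegral_lebesgueHalfLine_shift τ hJ hJτ fun a => f ((k, y), a) * volume (hit k a (y + a))
    _ = _ := by
        refine setLIntegral_congr_fun_ae (measurable_add_const (τ : ℝ) hJ) ?_
        filter_upwards [hh.volume_eq k y y.2] with a ha haJ
        rw [ha]
        have := hJτ haJ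
        simp only [mem_Ioi] at this
        linarith

end

section

variable {X₁ X₂ : ℝ≥0 → 𝒳} {Y₁ Y₂ : ℝ≥0 → ℝ≥0} {T : WithTop ℝ≥0} {S : Set (ℝ≥0 × ℝ)}
  {μ : Measure (ℝ≥0 × ℝ)}

lemma IsStripPoints.setLIntegral_eq_tsum {C : ℝ} (hS : IsStripPoints μ C S) {H : ℝ≥0 × ℝ → ℝ≥0∞}
    (hH : ∀ᵐ z ∂μ, 0 < z.1 → z.2 ∉ Icc 0 C → H z = 0) :
    ∫⁻ z in Ioi 0 ×ˢ univ, H z ∂μ = ∑' z : S, H z := by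
  have h1 : ∫⁻ z in Ioi 0 ×ˢ univ, H z ∂μ = ∫⁻ z in Ioi 0 ×ˢ Icc 0 C, H z ∂μ := by
    rw [← lintegral_indicator (measurableSet_Ioi.prod .univ),
      ← lintegral_indicator (measurableSet_Ioi.prod measurableSet_Icc)]
    refine lintegral_congr_ae ?_
    filter_upwards [hH] with z hz
    by_cases h1 : 0 < z.1
    · by_cases h2 : z.2 ∈ Icc 0 C
      · rw [indicator_of_mem (show z ∈ Ioi 0 ×ˢ univ from ⟨h1, mem_univ _⟩),
          indicator_of_mem (show z ∈ Ioi 0 ×ˢ Icc 0 C from ⟨h1, h2⟩)]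
      · rw [indicator_of_mem (show z ∈ Ioi 0 ×ˢ univ from ⟨h1, mem_univ _⟩), hz h1 h2,
          indicator_of_notMem (fun h => h2 h.2)]
    · rw [indicator_of_notMem (fun h => h1 h.1), indicator_of_notMem (fun h => h1 h.1)]
  rw [h1, hS.restrict_eq, lintegral_countable _ hS.countable]
  simp

variable (hS : IsStripPoints μ (totalRate lam) S)
  (hprec : IsStrictTotalOrder (OffDiag 𝒳) prec) (hsum : Summable fun p => supNorm (lam p))
  (htlam : IsSpacing lam tlam)
  (hgood₁ : ∀ᵐ z ∂μ, 0 < z.1 → ((Function.leftLim Y₁ z.1 : ℝ≥0) : ℝ) ∈ goodAges lam tlam)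
  (hgood₂ : ∀ᵐ z ∂μ, 0 < z.1 → ((Function.leftLim Y₂ z.1 : ℝ≥0) : ℝ) ∈ goodAges lam tlam)

include hS hprec hsum htlam hgood₁ hgood₂

lemma IsHitRule.lintegral_points (hh : IsHitRule prec lam hit r) (f : (𝒳 × ℝ≥0) × ℝ → ℝ≥0∞) :
    ∫⁻ z in Ioi 0 ×ˢ univ, pathTerm hit f X₁ X₂ Y₁ Y₂ T z ∂μ =
      ∑' z : S, pathTerm hit f X₁ X₂ Y₁ Y₂ T z := by
  refine hS.setLIntegral_eq_tsum ?_
  filter_upwards [hgood₁, hgood₂] with z h1 h2 h0 hstrip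
  refine hitTerm_of_notMem f _ fun hv => hstrip ?_
  obtain ⟨k', hk' | hk'⟩ := hh.subset _ _ _ hv
  · exact hk'.mem_strip hprec hsum htlam (h1 h0)
  · exact hk'.mem_strip hprec hsum htlam (h2 h0)

variable (c₁ : ChainPath prec lam tlam S X₁ Y₁) (c₂ : ChainPath prec lam tlam S X₂ Y₂)
  {τ : ℝ≥0} (hτ : IsLeast (meetTimes X₁ X₂ Y₁ Y₂ T) τ)

include c₁ c₂ hτ

open Classical in
-- Among the points in the window only (ρ, v) is a hit, so the sum over the points has at most one
-- nonzero term.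
lemma IsHitRule.lintegral_points_of_firstHit (hh : IsHitRule prec lam hit r)
    (f : (𝒳 × ℝ≥0) × ℝ → ℝ≥0∞) {ρ : ℝ≥0} {v : ℝ}
    (hρ : FirstHit prec lam S X₁ X₂ Y₁ Y₂ T τ ρ v) :
    ∫⁻ z in Ioi 0 ×ˢ univ, pathTerm hit f X₁ X₂ Y₁ Y₂ T z ∂μ =
      if v ∈ hit (X₁ τ) ((Function.leftLim Y₁ ρ : ℝ≥0) : ℝ) ((Function.leftLim Y₂ ρ : ℝ≥0) : ℝ)
      then f ((X₁ τ, max (Y₁ τ) (Y₂ τ)), (ρ : ℝ) - τ) else 0 := by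
  rw [hh.lintegral_points hS hprec hsum htlam hgood₁ hgood₂,
    tsum_eq_single (⟨(ρ, v), hρ.mem⟩ : S)]
  · have hw := (hρ.window_iff ρ).2 ⟨hρ.lt, le_rfl⟩
    obtain ⟨-, h1, -, h3, h4⟩ := leftLim_of_window c₁ c₂ hτ hw
    have := hh.hitTerm_of_window f hw (X₁ τ) hτ.1.2.2 (ρ - τ) v
    rw [← hh.hit_shift _ hτ.1.2.2, ← h3, ← h4, NNReal.coe_sub hρ.lt.le, indicator] at this
    rw [pathTerm, h1]
    exact this
  · rintro ⟨z, hz⟩ hne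
    by_cases hw : Window X₁ X₂ Y₁ Y₂ T
      (min (Function.leftLim Y₁ z.1) (Function.leftLim Y₂ z.1)) z.1
    · refine hitTerm_of_notMem f _ fun hv => hne (Subtype.ext ?_)
      rw [(leftLim_of_window c₁ c₂ hτ hw).2.1] at hv
      exact hρ.unique z hz ((hρ.window_iff _).1 hw) (hh.subset _ _ _ hv)
    · exact hitTerm_of_not _ _ hw _ _ _ _

end

end PathIntegrals

/-! ### The accounting identity along a path -/

section Accounting

variable {𝒳 : Set ℝ} {prec : OffDiag 𝒳 → OffDiag 𝒳 → Prop} {lam tlam : OffDiag 𝒳 → ℝ → ℝ}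

lemma measurable_setIntegral_section {α : Type*} [MeasurableSpace α] {f : α × ℝ → ℝ}
    (hf : Measurable f) {s : Set (α × ℝ)} (hs : MeasurableSet s) :
    Measurable fun x => ∫ t in {t | (x, t) ∈ s}, f (x, t) := by
  have h := ((hf.indicator hs).stronglyMeasurable.integral_prod_right'
    (ν := (volume : Measure ℝ))).measurable
  have heq : (fun x => ∫ t in {t | (x, t) ∈ s}, f (x, t)) = fun x => ∫ t, s.indicator f (x, t) := by
    funext x
    exact (integral_indicator (measurable_prodMk_left hs)).symm
  rw [heq]
  exact h

/-- The probability that the chains merge at the next jump, if they met in the state `z.1` at the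
age `z.2` of the one that was there before, and have stayed together for the time `a`. -/
def mergeProb (lam : OffDiag 𝒳 → ℝ → ℝ) (z : 𝒳 × ℝ≥0) (a : ℝ) : ℝ :=
  successProb (maxRate lam z.1 z.2) (minRate lam z.1 z.2) a

lemma measurable_mergeProb [Countable 𝒳] (hlam : IsRateMatrix lam) :
    Measurable fun p : (𝒳 × ℝ≥0) × ℝ => mergeProb lam p.1 p.2 := by
  have key : ∀ k : 𝒳, Measurable fun p : ℝ × ℝ =>
      successProb (maxRate lam k p.1) (minRate lam k p.1) p.2 := by
    intro k
    have hcum : Measurable fun p : ℝ × ℝ => ∫ t in (0 : ℝ)..p.2, maxRate lam k p.1 t := by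
      have hf : Measurable fun p : (ℝ × ℝ) × ℝ => maxRate lam k p.1.1 p.2 :=
        (measurable_maxRate hlam k).comp ((measurable_fst.comp measurable_fst).prodMk measurable_snd)
      have h1 := measurable_setIntegral_section hf (s := {p : (ℝ × ℝ) × ℝ | 0 < p.2 ∧ p.2 ≤ p.1.2})
        ((measurableSet_lt measurable_const measurable_snd).inter
          (measurableSet_le measurable_snd (measurable_snd.comp measurable_fst)))
      have h2 := measurable_setIntegral_section hf (s := {p : (ℝ × ℝ) × ℝ | p.1.2 < p.2 ∧ p.2 ≤ 0})
        ((measurableSet_lt (measurable_snd.comp measurable_fst) measurable_snd).inter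
          (measurableSet_le measurable_snd measurable_const))
      exact h1.sub h2
    have hden : Measurable fun p : (ℝ × ℝ) × ℝ =>
        survival (maxRate lam k p.1.1) p.2 * minRate lam k p.1.1 p.2 := by
      have hφ : Measurable fun p : (ℝ × ℝ) × ℝ => (p.1.1, p.2) :=
        (measurable_fst.comp measurable_fst).prodMk measurable_snd
      exact (Real.measurable_exp.comp (hcum.comp hφ).neg).mul ((measurable_minRate hlam k).comp hφ)
    have h3 := measurable_setIntegral_section hden (s := {p : (ℝ × ℝ) × ℝ | p.1.2 < p.2})
      (measurableSet_lt (measurable_snd.comp measurable_fst) measurable_snd)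
    exact h3.mul (Real.measurable_exp.comp hcum)
  have h : Measurable fun p : 𝒳 × (ℝ × ℝ) =>
      successProb (maxRate lam p.1 p.2.1) (minRate lam p.1 p.2.1) p.2.2 :=
    measurable_from_prod_countable_right key
  exact h.comp ((measurable_fst.comp measurable_fst).prodMk
    ((measurable_coe_nnreal_real.comp (measurable_snd.comp measurable_fst)).prodMk measurable_snd))

/-- The weight of the merging probability on the event that the meeting data are in `A`. -/
def mergeWeight (lam : OffDiag 𝒳 → ℝ → ℝ) (A : Set (𝒳 × ℝ≥0)) (p : (𝒳 × ℝ≥0) × ℝ) : ℝ≥0∞ :=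
  A.indicator (fun z => ENNReal.ofReal (mergeProb lam z p.2)) p.1

/-- The indicator of the event that the meeting data are in `A`. -/
def dataWeight (A : Set (𝒳 × ℝ≥0)) (p : (𝒳 × ℝ≥0) × ℝ) : ℝ≥0∞ :=
  A.indicator (fun _ => 1) p.1

lemma measurable_mergeWeight [Countable 𝒳] (hlam : IsRateMatrix lam) {A : Set (𝒳 × ℝ≥0)}
    (hA : MeasurableSet A) : Measurable (mergeWeight lam A) := by
  have : mergeWeight lam A = (Prod.fst ⁻¹' A).indicator
      fun p : (𝒳 × ℝ≥0) × ℝ => ENNReal.ofReal (mergeProb lam p.1 p.2) := by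
    rfl
  rw [this]
  exact ((measurable_mergeProb hlam).ennreal_ofReal).indicator (measurable_fst hA)

lemma measurable_dataWeight {A : Set (𝒳 × ℝ≥0)} (hA : MeasurableSet A) :
    Measurable (dataWeight A) :=
  (measurable_const.indicator hA).comp measurable_fst

lemma lintegral_mergeWeight [Countable 𝒳] (hlam : IsRateMatrix lam) (htlam : IsSpacing lam tlam)
    (hA3 : ∀ p, ∀ᵐ y ∂(volume.restrict (Ici (0 : ℝ))), tlam p y = supNorm (lam p))
    (A : Set (𝒳 × ℝ≥0)) (z : 𝒳 × ℝ≥0) {x : ℝ} (hx : 0 ≤ x) :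
    (∫⁻ a in Ioc 0 x, mergeWeight lam A (z, a) * ENNReal.ofReal (maxRate lam z.1 z.2 a)) +
        mergeWeight lam A (z, 0) =
      mergeWeight lam A (z, x) +
        ∫⁻ a in Ioc 0 x, dataWeight A (z, a) * ENNReal.ofReal (minRate lam z.1 z.2 a) := by
  by_cases hz : z ∈ A
  · have h := isHazardPair_rates hlam htlam hA3 z.1 (NNReal.zero_le_coe (q := z.2))
    have := h.lintegral_mul_successProb hx
    simp only [mergeWeight, dataWeight, indicator_of_mem hz, one_mul, mergeProb]
    rw [← this]
    congr 1
    refine setLIntegral_congr_fun measurableSet_Ioc fun a ha => ?_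
    rw [mul_comm, ENNReal.ofReal_mul' (h.successProb_nonneg ha.1.le)]
  · simp [mergeWeight, dataWeight, indicator_of_notMem hz]

end Accounting

section PathAccounting

variable {𝒳 : Set ℝ} {prec : OffDiag 𝒳 → OffDiag 𝒳 → Prop} {lam tlam : OffDiag 𝒳 → ℝ → ℝ}
  {X₁ X₂ : ℝ≥0 → 𝒳} {Y₁ Y₂ : ℝ≥0 → ℝ≥0} {T : WithTop ℝ≥0} {S : Set (ℝ≥0 × ℝ)}
  {μ : Measure (ℝ≥0 × ℝ)}

/-- A pair of chains driven by the points of a measure, away from a null set of noises. -/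
structure ChainPair (prec : OffDiag 𝒳 → OffDiag 𝒳 → Prop) (lam tlam : OffDiag 𝒳 → ℝ → ℝ)
    (μ : Measure (ℝ≥0 × ℝ)) (S : Set (ℝ≥0 × ℝ)) (X₁ X₂ : ℝ≥0 → 𝒳) (Y₁ Y₂ : ℝ≥0 → ℝ≥0) : Prop where
  strip : IsStripPoints μ (totalRate lam) S
  good₁ : ∀ᵐ z ∂μ, 0 < z.1 → ((Function.leftLim Y₁ z.1 : ℝ≥0) : ℝ) ∈ goodAges lam tlam
  good₂ : ∀ᵐ z ∂μ, 0 < z.1 → ((Function.leftLim Y₂ z.1 : ℝ≥0) : ℝ) ∈ goodAges lam tlam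
  path₁ : ChainPath prec lam tlam S X₁ Y₁
  path₂ : ChainPath prec lam tlam S X₂ Y₂

/-- The state and the larger age at the time `t`. -/
def dataAt (X₁ : ℝ≥0 → 𝒳) (Y₁ Y₂ : ℝ≥0 → ℝ≥0) (t : ℝ≥0) : 𝒳 × ℝ≥0 := (X₁ t, max (Y₁ t) (Y₂ t))

variable [Countable 𝒳] (hc : ChainPair prec lam tlam μ S X₁ X₂ Y₁ Y₂)
  (hprec : IsStrictTotalOrder (OffDiag 𝒳) prec) (hlam : IsRateMatrix lam)
  (htlam : IsSpacing lam tlam)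

include hc hprec hlam htlam

/-- The integral counts the hits in the window, and the first one closes it. Via compensation this
bounds the expected cumulative rate over the window. -/
lemma ChainPair.lintegral_points_le_one
    (hA3 : ∀ p, ∀ᵐ y ∂(volume.restrict (Ici (0 : ℝ))), tlam p y = supNorm (lam p)) :
    ∫⁻ z in Ioi 0 ×ˢ univ, pathTerm (hitOr prec lam) (fun _ => 1) X₁ X₂ Y₁ Y₂ T z ∂μ ≤ 1 := by
  have hh := isHitRule_or hprec hlam htlam hA3
  by_cases hne : (meetTimes X₁ X₂ Y₁ Y₂ T).Nonempty
  · have hτ := isLeast_sInf_meetTimes hc.path₁ hc.path₂ hne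
    rcases exists_firstHit_or hc.path₁ hc.path₂ hτ hprec hlam.summable_supNorm htlam
      hc.strip.injOn with ⟨ρ, v, hρ⟩ | ⟨hw, hno⟩
    · rw [hh.lintegral_points_of_firstHit hc.strip hprec hlam.summable_supNorm htlam hc.good₁
        hc.good₂ hc.path₁ hc.path₂ hτ _ hρ]
      split_ifs <;> simp
    · rw [hh.lintegral_points hc.strip hprec hlam.summable_supNorm htlam hc.good₁ hc.good₂,
        ENNReal.tsum_eq_zero.2]
      · exact zero_le
      · rintro ⟨z, hz⟩
        by_cases hwz : Window X₁ X₂ Y₁ Y₂ T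
          (min (Function.leftLim Y₁ z.1) (Function.leftLim Y₂ z.1)) z.1
        · refine hitTerm_of_notMem _ _ ?_
          rw [(leftLim_of_window hc.path₁ hc.path₂ hτ hwz).2.1]
          exact hno z hz ((hw _).1 hwz)
        · exact hitTerm_of_not _ _ hwz _ _ _ _
  · simp [pathTerm_of_empty hc.path₁ hc.path₂ hne]

open Classical in
-- With a first hit at ρ the first identity is `lintegral_mergeWeight` at x = ρ - τ: the term at x
-- is the contribution of the only hit. The bound holds because the weight is a probability. The
-- last identity holds because the first hit is a joint one exactly when the chains merge. Without a
-- meeting all terms vanish.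
theorem ChainPair.accounting
    (hA3 : ∀ p, ∀ᵐ y ∂(volume.restrict (Ici (0 : ℝ))), tlam p y = supNorm (lam p))
    (hfin : ∫⁻ z in Ioi 0 ×ˢ univ, pathTerm (hitOr prec lam) (fun _ => 1) X₁ X₂ Y₁ Y₂ T z
      ∂lebesgueHalfPlane ≠ ⊤) {A : Set (𝒳 × ℝ≥0)} (hA : MeasurableSet A) :
    ∫⁻ z in Ioi 0 ×ˢ univ, pathTerm (hitOr prec lam) (mergeWeight lam A) X₁ X₂ Y₁ Y₂ T z
        ∂lebesgueHalfPlane +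
        (if (meetTimes X₁ X₂ Y₁ Y₂ T).Nonempty then
          mergeWeight lam A (dataAt X₁ Y₁ Y₂ (sInf (meetTimes X₁ X₂ Y₁ Y₂ T)), 0) else 0) =
      ∫⁻ z in Ioi 0 ×ˢ univ, pathTerm (hitOr prec lam) (mergeWeight lam A) X₁ X₂ Y₁ Y₂ T z ∂μ +
        ∫⁻ z in Ioi 0 ×ˢ univ, pathTerm (hitAnd prec lam) (dataWeight A) X₁ X₂ Y₁ Y₂ T z
          ∂lebesgueHalfPlane ∧
    ∫⁻ z in Ioi 0 ×ˢ univ, pathTerm (hitOr prec lam) (mergeWeight lam A) X₁ X₂ Y₁ Y₂ T z ∂μ ≤ 1 ∧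
    ∫⁻ z in Ioi 0 ×ˢ univ, pathTerm (hitAnd prec lam) (dataWeight A) X₁ X₂ Y₁ Y₂ T z ∂μ =
      if (meetTimes X₁ X₂ Y₁ Y₂ T).Nonempty ∧
        dataAt X₁ Y₁ Y₂ (sInf (meetTimes X₁ X₂ Y₁ Y₂ T)) ∈ A ∧
        ∀ t, sInf (meetTimes X₁ X₂ Y₁ Y₂ T) ≤ t → X₁ t = X₂ t then 1 else 0 := by
  have hor := isHitRule_or hprec hlam htlam hA3
  have hand := isHitRule_and hprec hlam htlam hA3
  by_cases hne : (meetTimes X₁ X₂ Y₁ Y₂ T).Nonempty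
  · have hτ := isLeast_sInf_meetTimes hc.path₁ hc.path₂ hne
    set τ := sInf (meetTimes X₁ X₂ Y₁ Y₂ T)
    rcases exists_firstHit_or hc.path₁ hc.path₂ hτ hprec hlam.summable_supNorm htlam
      hc.strip.injOn with ⟨ρ, v, hρ⟩ | ⟨hw, -⟩
    · have hpre : (· + (τ : ℝ)) ⁻¹' Ioc (τ : ℝ) ρ = Ioc 0 ((ρ : ℝ) - τ) := by
        ext a
        simp only [mem_preimage, mem_Ioc]
        constructor <;> rintro ⟨h1, h2⟩ <;> constructor <;> linarith
      have hwin : ∀ u : ℝ≥0, Window X₁ X₂ Y₁ Y₂ T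
          (min (Function.leftLim Y₁ u) (Function.leftLim Y₂ u)) u ↔
          (u : ℝ) ∈ Ioc (τ : ℝ) ρ := fun u => by
        rw [hρ.window_iff]; simp
      have hx : 0 ≤ (ρ : ℝ) - τ := sub_nonneg.2 (NNReal.coe_le_coe.2 hρ.lt.le)
      have hpt := fun (f : (𝒳 × ℝ≥0) × ℝ → ℝ≥0∞) => hor.lintegral_points_of_firstHit hc.strip hprec
        hlam.summable_supNorm htlam hc.good₁ hc.good₂ hc.path₁ hc.path₂ hτ f hρ
      have hpt' := fun (f : (𝒳 × ℝ≥0) × ℝ → ℝ≥0∞) => hand.lintegral_points_of_firstHit hc.strip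
        hprec hlam.summable_supNorm htlam hc.good₁ hc.good₂ hc.path₁ hc.path₂ hτ f hρ
      refine ⟨?_, ?_, ?_⟩
      · rw [hpt, if_pos hρ.hit, if_pos hne,
          hor.lintegral_pathTerm hc.path₁ hc.path₂ hτ (measurable_mergeWeight hlam hA)
            measurableSet_Ioc (fun x hx => hx.1) hwin,
          hand.lintegral_pathTerm hc.path₁ hc.path₂ hτ (measurable_dataWeight hA)
            measurableSet_Ioc (fun x hx => hx.1) hwin, hpre]
        exact lintegral_mergeWeight hlam htlam hA3 A (X₁ τ, max (Y₁ τ) (Y₂ τ)) hx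
      · rw [hpt, if_pos hρ.hit, mergeWeight]
        refine indicator_apply_le' (fun _ => ?_) (fun _ => zero_le)
        exact ENNReal.ofReal_le_one.2
          ((isHazardPair_rates hlam htlam hA3 _ NNReal.zero_le_coe).successProb_le_one hx)
      · rw [hpt', ← hρ.merged_iff, dataWeight, indicator]
        by_cases h1 : ∀ t, τ ≤ t → X₁ t = X₂ t
        · by_cases h2 : (X₁ τ, max (Y₁ τ) (Y₂ τ)) ∈ A
          · rw [if_pos h1, if_pos h2, if_pos ⟨hne, h2, h1⟩]
          · rw [if_pos h1, if_neg h2, if_neg fun h => h2 h.2.1]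
        · rw [if_neg h1, if_neg (fun h => h1 h.2.2)]
    -- Without a hit the window is (τ, ∞), over which the rate has infinite integral, contrary to
    -- `hfin`.
    · exfalso
      refine hfin ?_
      have hpre : (· + (τ : ℝ)) ⁻¹' Ioi (τ : ℝ) = Ioi 0 := by
        ext a; simp
      rw [hor.lintegral_pathTerm hc.path₁ hc.path₂ hτ measurable_const (J := Ioi (τ : ℝ))
        measurableSet_Ioi le_rfl (fun u => by rw [hw]; simp), hpre]
      simp only [one_mul]
      exact lintegral_maxRate hlam htlam hA3 _ NNReal.zero_le_coe
  · simp [pathTerm_of_empty hc.path₁ hc.path₂ hne, hne]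

end PathAccounting

/-! ### Predictability of the integrands -/

section Measurability

variable {𝒳 : Set ℝ} {prec : OffDiag 𝒳 → OffDiag 𝒳 → Prop} {lam tlam : OffDiag 𝒳 → ℝ → ℝ}

lemma measurable_hitTerm [Countable 𝒳] {hit : 𝒳 → ℝ → ℝ → Set ℝ} {r : 𝒳 → ℝ → ℝ → ℝ}
    (hh : IsHitRule prec lam hit r) {f : (𝒳 × ℝ≥0) × ℝ → ℝ≥0∞} (hf : Measurable f)
    {α : Type*} [MeasurableSpace α] {W : α → Prop} (hW : MeasurableSet {p | W p}) {x : α → 𝒳}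
    (hx : Measurable x) {y₁ y₂ : α → ℝ≥0} (hy₁ : Measurable y₁) (hy₂ : Measurable y₂) :
    Measurable fun p : α × ℝ => hitTerm hit f (W p.1) (x p.1) (y₁ p.1) (y₂ p.1) p.2 := by
  classical
  refine Measurable.ite ?_ (hf.comp ?_) measurable_const
  · have : {p : α × ℝ | W p.1 ∧ p.2 ∈ hit (x p.1) (y₁ p.1) (y₂ p.1)} =
        Prod.fst ⁻¹' {p | W p} ∩ ⋃ k, (Prod.fst ⁻¹' (x ⁻¹' {k}) ∩
          (fun p : α × ℝ => (((y₁ p.1 : ℝ), (y₂ p.1 : ℝ)), p.2)) ⁻¹'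
            {p | p.2 ∈ hit k p.1.1 p.1.2}) := by
      ext p
      simp only [mem_inter_iff, mem_iUnion, mem_preimage, mem_singleton_iff]
      refine and_congr Iff.rfl ⟨fun h => ⟨_, rfl, h⟩, ?_⟩
      rintro ⟨k, rfl, h⟩
      exact h
    rw [this]
    refine (measurable_fst hW).inter (MeasurableSet.iUnion fun k => ?_)
    refine (measurable_fst (hx (measurableSet_singleton k))).inter ?_
    refine Measurable.prodMk (Measurable.prodMk ?_ ?_) measurable_snd (hh.measurableSet k)
    · exact measurable_coe_nnreal_real.comp (hy₁.comp measurable_fst)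
    · exact measurable_coe_nnreal_real.comp (hy₂.comp measurable_fst)
  · have h1 : Measurable fun p : α × ℝ => y₁ p.1 := hy₁.comp measurable_fst
    have h2 : Measurable fun p : α × ℝ => y₂ p.1 := hy₂.comp measurable_fst
    exact ((hx.comp measurable_fst).prodMk ((h1.max h2).sub (h1.min h2))).prodMk
      (measurable_coe_nnreal_real.comp (h1.min h2))

/-- The second condition concerns only those n with D n < u, so both conditions can be expressed
through the sets where E n is combined with D n < u. These are predictable when E n is known at the
time D n. -/
lemma measurableSet_window {α : Type*} [MeasurableSpace α] {u a : α → ℝ≥0} (hu : Measurable u)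
    (ha : Measurable a) (D : ℕ → ℝ≥0) {E : ℕ → α → Prop}
    (hE : ∀ n, MeasurableSet {p | D n < u p ∧ E n p}) :
    MeasurableSet {p | (∃ n, D n < u p ∧ E n p) ∧ ∀ n, D n + a p < u p → ¬ E n p} := by
  have : {p | (∃ n, D n < u p ∧ E n p) ∧ ∀ n, D n + a p < u p → ¬ E n p} =
      (⋃ n, {p | D n < u p ∧ E n p}) ∩
        ⋂ n, ({p | D n + a p < u p} ∩ {p | D n < u p ∧ E n p})ᶜ := by
    ext p
    simp only [mem_inter_iff, mem_iUnion, mem_iInter, mem_compl_iff]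
    refine and_congr Iff.rfl (forall_congr' fun n => ?_)
    constructor
    · rintro h ⟨h1, h2⟩
      exact h h1 h2.2
    · intro h h1 h2
      exact h ⟨h1, (le_add_of_nonneg_right zero_le).trans_lt h1, h2⟩
  rw [this]
  exact (MeasurableSet.iUnion hE).inter (MeasurableSet.iInter fun n =>
    ((measurableSet_lt (measurable_const.add ha) hu).inter (hE n)).compl)

variable {Ω : Type*} [mΩ : MeasurableSpace Ω] {ℱ : Filtration ℝ≥0 mΩ}

lemma measurable_fst_predictable : Measurable[ℱ.predictable] (Prod.fst : ℝ≥0 × Ω → ℝ≥0) := by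
  refine measurable_of_Ioi fun i => ?_
  have : Prod.fst ⁻¹' Ioi i = Ioi i ×ˢ (univ : Set Ω) := by ext; simp
  rw [this]
  exact measurableSet_predictable_Ioi_prod .univ

variable {X₁ X₂ : ℝ≥0 → Ω → 𝒳} {Y₁ Y₂ : ℝ≥0 → Ω → ℝ≥0} {T : Ω → WithTop ℝ≥0}

/-- The inequality in `Seen` forces the dense time to be at most q, so whether T has occurred by
then is known at q. -/
lemma measurableSet_seen [Countable 𝒳] (hX₁ : Adapted ℱ X₁) (hX₂ : Adapted ℱ X₂)
    (hY₁ : Adapted ℱ Y₁) (hY₂ : Adapted ℱ Y₂) (hT : IsStoppingTime ℱ T) (q : ℝ≥0) :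
    MeasurableSet[ℱ q] {ω | Seen (X₁ · ω) (X₂ · ω) (Y₁ · ω) (Y₂ · ω) (T ω) q} := by
  have : {ω | Seen (X₁ · ω) (X₂ · ω) (Y₁ · ω) (Y₂ · ω) (T ω) q} =
      {ω | X₁ q ω = X₂ q ω} ∩ ⋃ n, ({ω | TopologicalSpace.denseSeq ℝ≥0 n ≤ q ∧
        T ω ≤ (TopologicalSpace.denseSeq ℝ≥0 n : ℝ≥0)} ∩
        {ω | TopologicalSpace.denseSeq ℝ≥0 n + min (Y₁ q ω) (Y₂ q ω) < q}) := by
    ext ω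
    simp only [Seen, mem_inter_iff, mem_iUnion]
    refine and_congr Iff.rfl (exists_congr fun n => ?_)
    constructor
    · rintro ⟨h1, h2⟩
      exact ⟨⟨(le_add_of_nonneg_right zero_le).trans h2.le, h1⟩, h2⟩
    · rintro ⟨⟨-, h1⟩, h2⟩
      exact ⟨h1, h2⟩
  rw [this]
  refine MeasurableSet.inter (measurableSet_eq_fun (m := ℱ q) (hX₁ q) (hX₂ q))
    (MeasurableSet.iUnion fun n => MeasurableSet.inter ?_ ?_)
  · by_cases h : TopologicalSpace.denseSeq ℝ≥0 n ≤ q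
    · simp only [h, true_and]
      exact ℱ.mono h _ (hT _)
    · simp [h]
  · exact measurableSet_lt (mδ := ℱ q)
      (Measurable.add (measurable_const) (Measurable.min (hY₁ q) (hY₂ q))) measurable_const

end Measurability

/-! ### Ages just before the points of the noise are typical -/

section Solutions

variable {Ω : Type*} [mΩ : MeasurableSpace Ω] {P : Measure Ω} {ℱ : Filtration ℝ≥0 mΩ}
  {N : Ω → Measure (ℝ≥0 × ℝ)} {𝒳 : Set ℝ} {prec : OffDiag 𝒳 → OffDiag 𝒳 → Prop}
  {lam tlam : OffDiag 𝒳 → ℝ → ℝ}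

lemma leftLim_coe {Y : ℝ≥0 → ℝ≥0} {u : ℝ≥0} (hY : ∃ l, Tendsto Y (𝓝[<] u) (𝓝 l)) :
    Function.leftLim (fun s => (Y s : ℝ)) u = (Function.leftLim Y u : ℝ≥0) := by
  rcases eq_or_neBot (𝓝[<] u) with h | h
  · rw [leftLim_eq_of_eq_bot _ h, leftLim_eq_of_eq_bot _ h]
  · obtain ⟨l, hl⟩ := hY
    rw [leftLim_eq_of_tendsto hl]
    exact leftLim_eq_of_tendsto (NNReal.tendsto_coe.2 hl)

lemma IsSolution.ae_solvesPath {X : ℝ≥0 → Ω → 𝒳} {Y : ℝ≥0 → Ω → ℝ≥0}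
    (h : IsSolution prec lam tlam N ℱ P X Y) :
    ∀ᵐ ω ∂P, SolvesPath prec lam tlam (N ω) (X · ω) (Y · ω) ∧
      (∀ t, ∃ l, Tendsto (X · ω) (𝓝[<] t) (𝓝 l)) ∧ ∀ t, ∃ l, Tendsto (Y · ω) (𝓝[<] t) (𝓝 l) := by
  filter_upwards [h.cadlag, h.eq_X, h.eq_Y] with ω hc hX hY
  have hl := fun u => leftLim_coe (hc.2 u).2
  simp only [hl] at hX hY
  exact ⟨⟨hX, hY⟩, fun t => (hc.1 t).2, fun t => (hc.2 t).2⟩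

/-- The left limits of the age are predictable. For almost every path they are atypical only at a
null set of times, so the Lebesgue integral of the corresponding indicator over the half-plane
vanishes; by compensation so does its expected integral over the noise. -/
lemma ae_leftLim_mem_goodAges [Countable 𝒳] (hcomplete : ∀ s : Set Ω, P s = 0 → MeasurableSet[ℱ 0] s)
    (hN : IsPoissonRandomMeasure N lebesgueHalfPlane P) (hNℱ : IsCompatible N ℱ P)
    (htlam : IsSpacing lam tlam)
    (hA3 : ∀ p, ∀ᵐ y ∂(volume.restrict (Ici (0 : ℝ))), tlam p y = supNorm (lam p))
    [IsProbabilityMeasure P]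
    {X : ℝ≥0 → Ω → 𝒳} {Y : ℝ≥0 → Ω → ℝ≥0} (h : IsSolution prec lam tlam N ℱ P X Y) :
    ∀ᵐ ω ∂P, ∀ᵐ z ∂(N ω), 0 < z.1 →
      ((Function.leftLim (Y · ω) z.1 : ℝ≥0) : ℝ) ∈ goodAges lam tlam := by
  obtain ⟨G, hG, hGP⟩ : ∃ G : Set Ω, (∀ ω ∈ G, SolvesPath prec lam tlam (N ω) (X · ω) (Y · ω) ∧
      (∀ t, ∃ l, Tendsto (Y · ω) (𝓝[<] t) (𝓝 l)) ∧
      ∃ D : Set ℝ≥0, D.Countable ∧ N ω ((Ioi 0 \ D) ×ˢ univ) = 0) ∧ P Gᶜ = 0 := by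
    refine ⟨_, fun ω hω => hω, ?_⟩
    have := h.ae_solvesPath.and (ae_exists_countable_times hN)
    filter_upwards [this] with ω hω
    exact ⟨hω.1.1, hω.1.2.2, hω.2⟩
  -- The defining property of G need not look measurable: its complement is null, and null sets
  -- belong to the initial σ-algebra.
  have hGm : MeasurableSet[ℱ 0] G := by
    have := (hcomplete _ hGP).compl
    rwa [compl_compl] at this
  have hLY := measurable_leftProcess h.adapted_Y hGm fun ω hω => (hG ω hω).2.1
  set B : Set ℝ := (goodAges lam tlam)ᶜ with hB
  have hBm : MeasurableSet B := (measurableSet_goodAges htlam).compl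
  set H : (ℝ≥0 × Ω) × ℝ → ℝ≥0∞ := fun p => ((↑) ⁻¹' B : Set ℝ≥0).indicator (fun _ => 1)
    (leftProcess Y G p.1) with hH
  have hHm : Measurable[predProd ℱ] H := by
    have h1 : Measurable (((↑) ⁻¹' B : Set ℝ≥0).indicator fun _ => (1 : ℝ≥0∞)) :=
      measurable_const.indicator (measurable_coe_nnreal_real hBm)
    exact h1.comp (hLY.comp (@measurable_fst _ _ ℱ.predictable _))
  have hHm' : Measurable H := hHm.mono (predProd_le ℱ) le_rfl
  obtain ⟨hae, heq⟩ := lintegral_compensation hN hNℱ hHm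
  have hzero : ∫⁻ ω, ∫⁻ z in Ioi 0 ×ˢ univ, H ((z.1, ω), z.2) ∂lebesgueHalfPlane ∂P = 0 := by
    refine (lintegral_congr_ae ?_).trans lintegral_zero
    filter_upwards [mem_ae_iff.2 hGP] with ω hω
    obtain ⟨hs, -, D, hD, hND⟩ := hG ω hω
    have hnull : volume (B ∩ Ici 0) = 0 := by
      have := ae_mem_goodAges hA3
      rw [ae_iff] at this
      refine measure_mono_null (fun y hy => ?_) this
      simp only [mem_ofPred_eq, Classical.not_imp]
      exact ⟨hy.2, hy.1⟩
    have hae := ae_leftLim_notMem hD hND (g := fun z => gFun prec lam tlam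
      (Function.leftLim (X · ω) z.1) ((Function.leftLim (Y · ω) z.1 : ℝ≥0) : ℝ) z.2)
      (fun z => gFun_nonneg _ NNReal.zero_le_coe _) (fun t => (hs.eq_Y t).1)
      (fun t => (hs.eq_Y t).2) hnull
    rw [lebesgueHalfPlane, ← Measure.prod_restrict, Measure.restrict_univ, lintegral_prod]
    · refine (lintegral_congr_ae ((ae_restrict_iff' measurableSet_Ioi).2 ?_)).trans lintegral_zero
      filter_upwards [hae] with u hu h0
      have : ∀ v : ℝ, H ((u, ω), v) = 0 := fun v => by
        rw [hH]
        refine indicator_of_notMem (fun hmem => ?_) _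
        rw [leftProcess_of_mem hω] at hmem
        exact hu h0 ⟨hmem, NNReal.zero_le_coe⟩
      simp [this]
    · exact (hHm'.comp (((measurable_fst.prodMk measurable_const)).prodMk measurable_snd)).aemeasurable
  rw [hzero, lintegral_eq_zero_iff' hae] at heq
  filter_upwards [heq, mem_ae_iff.2 hGP] with ω hω hωG
  have hsec : Measurable fun z : ℝ≥0 × ℝ => H ((z.1, ω), z.2) :=
    hHm'.comp ((measurable_fst.prodMk measurable_const).prodMk measurable_snd)
  rw [Pi.zero_apply, lintegral_eq_zero_iff hsec,
    EventuallyEq, ae_restrict_iff' (measurableSet_Ioi.prod .univ)] at hω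
  filter_upwards [hω] with z hz h0
  have h1 := hz ⟨h0, mem_univ _⟩
  by_contra hbad
  rw [hH] at h1
  simp only [leftProcess_of_mem hωG] at h1
  rw [indicator_of_mem (show Function.leftLim (Y · ω) z.1 ∈ ((↑) ⁻¹' B : Set ℝ≥0) from hbad)] at h1
  exact one_ne_zero h1

end Solutions

/-! ### Taking expectations -/

section DrivenPair

variable {Ω : Type*} [mΩ : MeasurableSpace Ω] {P : Measure Ω} {ℱ : Filtration ℝ≥0 mΩ}
  {N : Ω → Measure (ℝ≥0 × ℝ)} {𝒳 : Set ℝ} {prec : OffDiag 𝒳 → OffDiag 𝒳 → Prop}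
  {lam tlam : OffDiag 𝒳 → ℝ → ℝ} {X₁ X₂ : ℝ≥0 → Ω → 𝒳} {Y₁ Y₂ : ℝ≥0 → Ω → ℝ≥0}
  {T : Ω → WithTop ℝ≥0}

/-- Two solutions driven by the same noise, and a stopping time. -/
structure DrivenPair (P : Measure Ω) (ℱ : Filtration ℝ≥0 mΩ) (N : Ω → Measure (ℝ≥0 × ℝ))
    (prec : OffDiag 𝒳 → OffDiag 𝒳 → Prop) (lam tlam : OffDiag 𝒳 → ℝ → ℝ)
    (X₁ X₂ : ℝ≥0 → Ω → 𝒳) (Y₁ Y₂ : ℝ≥0 → Ω → ℝ≥0) (T : Ω → WithTop ℝ≥0) : Prop where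
  complete : ∀ s : Set Ω, P s = 0 → MeasurableSet[ℱ 0] s
  noise : IsPoissonRandomMeasure N lebesgueHalfPlane P
  compatible : IsCompatible N ℱ P
  order : IsStrictTotalOrder (OffDiag 𝒳) prec
  rates : IsRateMatrix lam
  spacing : IsSpacing lam tlam
  typical : ∀ p, ∀ᵐ y ∂(volume.restrict (Ici (0 : ℝ))), tlam p y = supNorm (lam p)
  sol₁ : IsSolution prec lam tlam N ℱ P X₁ Y₁
  sol₂ : IsSolution prec lam tlam N ℱ P X₂ Y₂
  stopping : IsStoppingTime ℱ T

namespace DrivenPair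

variable [IsProbabilityMeasure P] [Countable 𝒳]
  (h : DrivenPair P ℱ N prec lam tlam X₁ X₂ Y₁ Y₂ T)

include h

lemma ae_chainPair : ∀ᵐ ω ∂P, ∃ S,
    ChainPair prec lam tlam (N ω) S (X₁ · ω) (X₂ · ω) (Y₁ · ω) (Y₂ · ω) := by
  filter_upwards [h.sol₁.ae_solvesPath, h.sol₂.ae_solvesPath,
    ae_exists_strip_points h.noise (totalRate lam),
    ae_leftLim_mem_goodAges h.complete h.noise h.compatible h.spacing h.typical h.sol₁,
    ae_leftLim_mem_goodAges h.complete h.noise h.compatible h.spacing h.typical h.sol₂]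
    with ω h1 h2 ⟨S, hS⟩ h3 h4
  exact ⟨S, hS, h3, h4, h1.1.chainPath hS h.order h.rates.summable_supNorm h.spacing h3,
    h2.1.chainPath hS h.order h.rates.summable_supNorm h.spacing h4⟩

/-- On an event of full measure, known at time zero, all left limits exist, and the integrand agrees
with a predictable one built from `leftProcess`. -/
lemma compensation {hit : 𝒳 → ℝ → ℝ → Set ℝ} {r : 𝒳 → ℝ → ℝ → ℝ}
    (hh : IsHitRule prec lam hit r) {f : (𝒳 × ℝ≥0) × ℝ → ℝ≥0∞} (hf : Measurable f) :
    AEMeasurable (fun ω => ∫⁻ z in Ioi 0 ×ˢ univ,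
      pathTerm hit f (X₁ · ω) (X₂ · ω) (Y₁ · ω) (Y₂ · ω) (T ω) z ∂(N ω)) P ∧
    AEMeasurable (fun ω => ∫⁻ z in Ioi 0 ×ˢ univ,
      pathTerm hit f (X₁ · ω) (X₂ · ω) (Y₁ · ω) (Y₂ · ω) (T ω) z ∂lebesgueHalfPlane) P ∧
    ∫⁻ ω, ∫⁻ z in Ioi 0 ×ˢ univ,
      pathTerm hit f (X₁ · ω) (X₂ · ω) (Y₁ · ω) (Y₂ · ω) (T ω) z ∂(N ω) ∂P =
    ∫⁻ ω, ∫⁻ z in Ioi 0 ×ˢ univ,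
      pathTerm hit f (X₁ · ω) (X₂ · ω) (Y₁ · ω) (Y₂ · ω) (T ω) z ∂lebesgueHalfPlane ∂P := by
  obtain ⟨G, hG, hGP⟩ : ∃ G : Set Ω, (∀ ω ∈ G,
      ((∀ t, ∃ l, Tendsto (X₁ · ω) (𝓝[<] t) (𝓝 l)) ∧ ∀ t, ∃ l, Tendsto (Y₁ · ω) (𝓝[<] t) (𝓝 l)) ∧
      ∀ t, ∃ l, Tendsto (Y₂ · ω) (𝓝[<] t) (𝓝 l)) ∧ P Gᶜ = 0 := by
    refine ⟨_, fun ω hω => hω, ?_⟩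
    filter_upwards [h.sol₁.ae_solvesPath, h.sol₂.ae_solvesPath] with ω h1 h2
    exact ⟨h1.2, h2.2.2⟩
  have hGm : MeasurableSet[ℱ 0] G := by
    have := (h.complete _ hGP).compl
    rwa [compl_compl] at this
  have hx := measurable_leftProcess h.sol₁.adapted_X hGm fun ω hω => (hG ω hω).1.1
  have hy₁ := measurable_leftProcess h.sol₁.adapted_Y hGm fun ω hω => (hG ω hω).1.2
  have hy₂ := measurable_leftProcess h.sol₂.adapted_Y hGm fun ω hω => (hG ω hω).2
  set W : ℝ≥0 × Ω → Prop := fun p => Window (X₁ · p.2) (X₂ · p.2) (Y₁ · p.2) (Y₂ · p.2) (T p.2)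
    (min (leftProcess Y₁ G p) (leftProcess Y₂ G p)) p.1 with hW
  have hWm : MeasurableSet[ℱ.predictable] {p | W p} := by
    refine @measurableSet_window _ ℱ.predictable _ _ measurable_fst_predictable (hy₁.min hy₂)
      (TopologicalSpace.denseSeq ℝ≥0) (fun n p => Seen (X₁ · p.2) (X₂ · p.2) (Y₁ · p.2) (Y₂ · p.2)
        (T p.2) (TopologicalSpace.denseSeq ℝ≥0 n)) fun n => ?_
    exact measurableSet_predictable_Ioi_prod (measurableSet_seen h.sol₁.adapted_X h.sol₂.adapted_X
      h.sol₁.adapted_Y h.sol₂.adapted_Y h.stopping _)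
  set H : (ℝ≥0 × Ω) × ℝ → ℝ≥0∞ := fun p => hitTerm hit f (W p.1) (leftProcess X₁ G p.1)
    (leftProcess Y₁ G p.1) (leftProcess Y₂ G p.1) p.2 with hH
  have hHm : Measurable[predProd ℱ] H :=
    @measurable_hitTerm _ _ _ _ _ _ hh _ hf _ ℱ.predictable _ hWm _ hx _ _ hy₁ hy₂
  have hHm' : Measurable H := hHm.mono (predProd_le ℱ) le_rfl
  have hval : ∀ ω ∈ G, ∀ z : ℝ≥0 × ℝ, H ((z.1, ω), z.2) =
      pathTerm hit f (X₁ · ω) (X₂ · ω) (Y₁ · ω) (Y₂ · ω) (T ω) z := by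
    intro ω hω z
    simp only [hH, hW, leftProcess_of_mem hω, pathTerm]
  obtain ⟨h1, h2⟩ := lintegral_compensation h.noise h.compatible hHm
  have hGae : ∀ᵐ ω ∂P, ω ∈ G := mem_ae_iff.2 hGP
  have e1 : (fun ω => ∫⁻ z in Ioi 0 ×ˢ univ, H ((z.1, ω), z.2) ∂(N ω)) =ᵐ[P]
      fun ω => ∫⁻ z in Ioi 0 ×ˢ univ,
        pathTerm hit f (X₁ · ω) (X₂ · ω) (Y₁ · ω) (Y₂ · ω) (T ω) z ∂(N ω) := by
    filter_upwards [hGae] with ω hω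
    exact lintegral_congr fun z => hval ω hω z
  have e2 : (fun ω => ∫⁻ z in Ioi 0 ×ˢ univ, H ((z.1, ω), z.2) ∂lebesgueHalfPlane) =ᵐ[P]
      fun ω => ∫⁻ z in Ioi 0 ×ˢ univ,
        pathTerm hit f (X₁ · ω) (X₂ · ω) (Y₁ · ω) (Y₂ · ω) (T ω) z ∂lebesgueHalfPlane := by
    filter_upwards [hGae] with ω hω
    exact lintegral_congr fun z => hval ω hω z
  have h3 : Measurable fun ω => ∫⁻ z in Ioi 0 ×ˢ univ, H ((z.1, ω), z.2) ∂lebesgueHalfPlane := by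
    refine Measurable.lintegral_prod_right' (f := fun p : Ω × (ℝ≥0 × ℝ) =>
      H ((p.2.1, p.1), p.2.2)) (hHm'.comp ?_)
    exact ((measurable_fst.comp measurable_snd).prodMk measurable_fst).prodMk
      (measurable_snd.comp measurable_snd)
  refine ⟨h1.congr e1, h3.aemeasurable.congr e2, ?_⟩
  rw [← lintegral_congr_ae e1, ← lintegral_congr_ae e2, h2]

/-- The set of times of meeting after `T`. -/
abbrev meetTimesAt (X₁ X₂ : ℝ≥0 → Ω → 𝒳) (Y₁ Y₂ : ℝ≥0 → Ω → ℝ≥0) (T : Ω → WithTop ℝ≥0) (ω : Ω) :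
    Set ℝ≥0 :=
  meetTimes (X₁ · ω) (X₂ · ω) (Y₁ · ω) (Y₂ · ω) (T ω)

/-- By compensation the expectation of this integral is the expected number of hits in the window,
hence at most one. -/
lemma ae_lintegral_ne_top : ∀ᵐ ω ∂P, ∫⁻ z in Ioi 0 ×ˢ univ,
    pathTerm (hitOr prec lam) (fun _ => 1) (X₁ · ω) (X₂ · ω) (Y₁ · ω) (Y₂ · ω) (T ω) z
      ∂lebesgueHalfPlane ≠ ⊤ := by
  have hor := isHitRule_or h.order h.rates h.spacing h.typical
  obtain ⟨-, hm, heq⟩ := h.compensation hor (f := fun _ => 1) measurable_const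
  have hle : ∫⁻ ω, ∫⁻ z in Ioi 0 ×ˢ univ,
      pathTerm (hitOr prec lam) (fun _ => 1) (X₁ · ω) (X₂ · ω) (Y₁ · ω) (Y₂ · ω) (T ω) z
        ∂(N ω) ∂P ≤ ∫⁻ _, 1 ∂P := by
    refine lintegral_mono_ae ?_
    filter_upwards [h.ae_chainPair] with ω ⟨S, hc⟩
    exact hc.lintegral_points_le_one h.order h.rates h.spacing h.typical
  have hfin : ∫⁻ ω, ∫⁻ z in Ioi 0 ×ˢ univ,
      pathTerm (hitOr prec lam) (fun _ => 1) (X₁ · ω) (X₂ · ω) (Y₁ · ω) (Y₂ · ω) (T ω) z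
        ∂lebesgueHalfPlane ∂P ≠ ⊤ := by
    rw [← heq]
    exact (hle.trans_lt (by simp)).ne
  filter_upwards [ae_lt_top' hm hfin] with ω hω
  exact hω.ne

open Classical in
-- Take expectations in the accounting identity. Compensation for the hits makes one term on each
-- side equal; they cancel because they are at most one, hence finite. Compensation for the joint
-- hits turns the last term into the probability of merging.
theorem lintegral_mergeWeight_eq {A : Set (𝒳 × ℝ≥0)} (hA : MeasurableSet A) :
    ∫⁻ ω, (if (meetTimesAt X₁ X₂ Y₁ Y₂ T ω).Nonempty then mergeWeight lam A
      (dataAt (X₁ · ω) (Y₁ · ω) (Y₂ · ω) (sInf (meetTimesAt X₁ X₂ Y₁ Y₂ T ω)), 0) else 0) ∂P =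
    ∫⁻ ω, (if (meetTimesAt X₁ X₂ Y₁ Y₂ T ω).Nonempty ∧
      dataAt (X₁ · ω) (Y₁ · ω) (Y₂ · ω) (sInf (meetTimesAt X₁ X₂ Y₁ Y₂ T ω)) ∈ A ∧
      ∀ t, sInf (meetTimesAt X₁ X₂ Y₁ Y₂ T ω) ≤ t → X₁ t ω = X₂ t ω then 1 else 0) ∂P := by
  have hor := isHitRule_or h.order h.rates h.spacing h.typical
  have hand := isHitRule_and h.order h.rates h.spacing h.typical
  obtain ⟨m1, m2, e1⟩ := h.compensation hor (measurable_mergeWeight h.rates hA)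
  obtain ⟨m3, m4, e2⟩ := h.compensation hand (measurable_dataWeight hA)
  have hacc := (h.ae_chainPair.and h.ae_lintegral_ne_top).mono fun ω hω =>
    hω.1.choose_spec.accounting h.order h.rates h.spacing h.typical hω.2 hA
  have hsum := lintegral_congr_ae (hacc.mono fun ω hω => hω.1)
  rw [lintegral_add_left' m2, lintegral_add_left' m1, e1] at hsum
  have hfin : ∫⁻ ω, ∫⁻ z in Ioi 0 ×ˢ univ, pathTerm (hitOr prec lam) (mergeWeight lam A)
      (X₁ · ω) (X₂ · ω) (Y₁ · ω) (Y₂ · ω) (T ω) z ∂(N ω) ∂P ≤ ∫⁻ _, 1 ∂P :=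
    lintegral_mono_ae (hacc.mono fun ω hω => hω.2.1)
  rw [e1] at hfin
  have hcancel := (ENNReal.add_right_inj (hfin.trans_lt (by simp)).ne).1 hsum
  rw [hcancel, ← e2]
  exact lintegral_congr_ae (hacc.mono fun ω hω => hω.2.2)

end DrivenPair

end DrivenPair

/-! ### Meeting data and merging, read off at dense times -/

section DensePaths

variable {𝒳 : Set ℝ} {prec : OffDiag 𝒳 → OffDiag 𝒳 → Prop} {lam tlam : OffDiag 𝒳 → ℝ → ℝ}
  {S : Set (ℝ≥0 × ℝ)} {X₁ X₂ : ℝ≥0 → 𝒳} {Y₁ Y₂ : ℝ≥0 → ℝ≥0} {T : WithTop ℝ≥0}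

/-- The time `q` belongs to the first period in which the chains stay together. -/
def Fresh (X₁ X₂ : ℝ≥0 → 𝒳) (Y₁ Y₂ : ℝ≥0 → ℝ≥0) (T : WithTop ℝ≥0) (q : ℝ≥0) : Prop :=
  Seen X₁ X₂ Y₁ Y₂ T q ∧ ∀ m, TopologicalSpace.denseSeq ℝ≥0 m + min (Y₁ q) (Y₂ q) < q →
    ¬ Seen X₁ X₂ Y₁ Y₂ T (TopologicalSpace.denseSeq ℝ≥0 m)

variable (c₁ : ChainPath prec lam tlam S X₁ Y₁) (c₂ : ChainPath prec lam tlam S X₂ Y₂)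
  {τ : ℝ≥0} (hτ : IsLeast (meetTimes X₁ X₂ Y₁ Y₂ T) τ)

include c₁ c₂ hτ

lemma exists_seen_between {u : ℝ≥0} (hu : τ < u) :
    ∃ n, τ < TopologicalSpace.denseSeq ℝ≥0 n ∧ TopologicalSpace.denseSeq ℝ≥0 n < u ∧
      Seen X₁ X₂ Y₁ Y₂ T (TopologicalSpace.denseSeq ℝ≥0 n) := by
  obtain ⟨ε, hε, hseen⟩ := exists_seen_of_mem c₁ c₂ hτ.1
  obtain ⟨n, h1, h2⟩ := exists_denseSeq_between (lt_min hu (lt_add_of_pos_right τ hε))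
  refine ⟨n, h1, h2.trans_le (min_le_left _ _), ?_⟩
  obtain ⟨d, hd⟩ := exists_add_of_le h1.le
  rw [hd] at h2 ⊢
  exact hseen d (lt_of_add_lt_add_left (h2.trans_le (min_le_right _ _)))

lemma exists_fresh : ∃ n, Fresh X₁ X₂ Y₁ Y₂ T (TopologicalSpace.denseSeq ℝ≥0 n) := by
  obtain ⟨ε₁, hε₁, h1⟩ := c₁.right τ
  obtain ⟨ε₂, hε₂, h2⟩ := c₂.right τ
  obtain ⟨n, hn, hnε, hseen⟩ := exists_seen_between c₁ c₂ hτ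
    (lt_add_of_pos_right τ (lt_min hε₁ hε₂))
  refine ⟨n, hseen, fun m hm hs => ?_⟩
  obtain ⟨d, hd⟩ := exists_add_of_le hn.le
  rw [hd] at hnε hm
  have hdε := lt_of_add_lt_add_left hnε
  rw [(h1 d (hdε.trans_le (min_le_left _ _))).2, (h2 d (hdε.trans_le (min_le_right _ _))).2,
    min_add_add_right, hτ.1.2.2, zero_add] at hm
  obtain ⟨t, ht, htm, -⟩ := hs.exists_meetTimes c₁ c₂
  exact absurd (lt_of_add_lt_add_right hm) (not_lt.2 ((hτ.2 ht).trans htm))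

/-- Going back from q by the smaller age leads to a meeting t. If t were later than τ, some dense
time between them would already have seen the meeting at τ, which freshness forbids. So t = τ, and
since then both ages have only drifted. -/
lemma Fresh.dataAt_eq {q : ℝ≥0} (hq : Fresh X₁ X₂ Y₁ Y₂ T q) :
    dataAt X₁ Y₁ Y₂ τ = (X₁ q, max (Y₁ q) (Y₂ q) - min (Y₁ q) (Y₂ q)) := by
  obtain ⟨t, ht, htq, hta⟩ := hq.1.exists_meetTimes c₁ c₂
  have hle : t ≤ τ := by
    by_contra! hlt
    obtain ⟨m, -, hm, hs⟩ := exists_seen_between c₁ c₂ hτ hlt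
    refine hq.2 m ?_ hs
    calc _ < t + min (Y₁ q) (Y₂ q) := add_lt_add_left hm _
      _ = q := hta
  obtain rfl : t = τ := le_antisymm hle (hτ.2 ht)
  have h1 := c₁.eq_of_le_age (s := t) (d := min (Y₁ q) (Y₂ q)) (by rw [hta]; exact min_le_left _ _)
  have h2 := c₂.eq_of_le_age (s := t) (d := min (Y₁ q) (Y₂ q)) (by rw [hta]; exact min_le_right _ _)
  rw [hta] at h1 h2
  have h3 : max (Y₁ q) (Y₂ q) = max (Y₁ t) (Y₂ t) + min (Y₁ q) (Y₂ q) := by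
    rw [← max_add_add_right, ← h1.2, ← h2.2]
  rw [dataAt, h3, add_tsub_cancel_right, h1.1]

/-- States are constant for a short while after every time, so agreement at dense times suffices.
That a dense time lies after τ is expressed by an earlier dense time which has seen a meeting. -/
lemma forall_eq_iff_dense :
    (∀ t, τ ≤ t → X₁ t = X₂ t) ↔ ∀ n, (∃ m, TopologicalSpace.denseSeq ℝ≥0 m <
      TopologicalSpace.denseSeq ℝ≥0 n ∧ Seen X₁ X₂ Y₁ Y₂ T (TopologicalSpace.denseSeq ℝ≥0 m)) →
      X₁ (TopologicalSpace.denseSeq ℝ≥0 n) = X₂ (TopologicalSpace.denseSeq ℝ≥0 n) := by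
  constructor
  · rintro h n ⟨m, hmn, hm⟩
    obtain ⟨t, ht, htm, -⟩ := hm.exists_meetTimes c₁ c₂
    exact h _ ((hτ.2 ht).trans (htm.trans hmn.le))
  · intro h t ht
    obtain ⟨ε₁, hε₁, h1⟩ := c₁.right t
    obtain ⟨ε₂, hε₂, h2⟩ := c₂.right t
    obtain ⟨n, hn, hnε⟩ := exists_denseSeq_between (lt_add_of_pos_right t (lt_min hε₁ hε₂))
    obtain ⟨m, -, hm, hs⟩ := exists_seen_between c₁ c₂ hτ (ht.trans_lt hn)
    have := h n ⟨m, hm, hs⟩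
    obtain ⟨d, hd⟩ := exists_add_of_le hn.le
    rw [hd] at hnε this
    have hdε := lt_of_add_lt_add_left hnε
    rwa [(h1 d (hdε.trans_le (min_le_left _ _))).1,
      (h2 d (hdε.trans_le (min_le_right _ _))).1] at this

end DensePaths

section NextMeeting

variable {Ω : Type*} {𝒳 : Set ℝ} {X₁ X₂ : ℝ≥0 → Ω → 𝒳} {Y₁ Y₂ : ℝ≥0 → Ω → ℝ≥0}
  {T : Ω → WithTop ℝ≥0} {ω : Ω}

lemma nextMeeting_of_isLeast {τ : ℝ≥0} (h : IsLeast (DrivenPair.meetTimesAt X₁ X₂ Y₁ Y₂ T ω) τ) :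
    nextMeeting X₁ X₂ Y₁ Y₂ T ω = τ := by
  refine IsLeast.csInf_eq ⟨⟨τ, h.1, rfl⟩, ?_⟩
  rintro _ ⟨t, ht, rfl⟩
  exact WithTop.coe_le_coe.2 (h.2 ht)

lemma nextMeeting_of_empty (h : ¬ (DrivenPair.meetTimesAt X₁ X₂ Y₁ Y₂ T ω).Nonempty) :
    nextMeeting X₁ X₂ Y₁ Y₂ T ω = ⊤ := by
  have : DrivenPair.meetTimesAt X₁ X₂ Y₁ Y₂ T ω = ∅ := not_nonempty_iff_eq_empty.1 h
  rw [nextMeeting]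
  change sInf ((fun t : ℝ≥0 => (t : WithTop ℝ≥0)) '' DrivenPair.meetTimesAt X₁ X₂ Y₁ Y₂ T ω) = ⊤
  rw [this, image_empty, WithTop.sInf_empty]

lemma nextMeeting_lt_top_iff :
    nextMeeting X₁ X₂ Y₁ Y₂ T ω < ⊤ ↔ (DrivenPair.meetTimesAt X₁ X₂ Y₁ Y₂ T ω).Nonempty := by
  constructor
  · intro hlt
    by_contra hne
    rw [nextMeeting_of_empty hne] at hlt
    exact lt_irrefl _ hlt
  · rintro ⟨t, ht⟩
    have hle : nextMeeting X₁ X₂ Y₁ Y₂ T ω ≤ t := csInf_le (OrderBot.bddBelow _) ⟨t, ht, rfl⟩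
    exact hle.trans_lt (WithTop.coe_lt_top t)

lemma meetingData_of_eq {τ : Ω → WithTop ℝ≥0} {t : ℝ≥0} (h : τ ω = t) :
    meetingData X₁ Y₁ Y₂ τ ω = dataAt (X₁ · ω) (Y₁ · ω) (Y₂ · ω) t := by
  simp only [meetingData, dataAt, stoppedValue, h]
  rfl

lemma mergedFrom_iff_of_eq {τ : Ω → WithTop ℝ≥0} {t : ℝ≥0} (h : τ ω = t) :
    MergedFrom X₁ X₂ τ ω ↔ ∀ s, t ≤ s → X₁ s ω = X₂ s ω := by
  simp only [MergedFrom, h, WithTop.coe_le_coe]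

lemma mergedFrom_of_eq_top {τ : Ω → WithTop ℝ≥0} (h : τ ω = ⊤) : MergedFrom X₁ X₂ τ ω := by
  intro t ht
  rw [h] at ht
  exact absurd ht (not_le.2 (WithTop.coe_lt_top t))

end NextMeeting

/-! ### The regular conditional probability of merging -/

namespace DrivenPair

variable {Ω : Type*} [mΩ : MeasurableSpace Ω] {P : Measure Ω} {ℱ : Filtration ℝ≥0 mΩ}
  {N : Ω → Measure (ℝ≥0 × ℝ)} {𝒳 : Set ℝ} {prec : OffDiag 𝒳 → OffDiag 𝒳 → Prop}
  {lam tlam : OffDiag 𝒳 → ℝ → ℝ} {X₁ X₂ : ℝ≥0 → Ω → 𝒳} {Y₁ Y₂ : ℝ≥0 → Ω → ℝ≥0}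
  {T : Ω → WithTop ℝ≥0}
  (h : DrivenPair P ℱ N prec lam tlam X₁ X₂ Y₁ Y₂ T)

include h

/-- By completeness every null set is measurable. The descriptions through dense times are valid
only almost surely, and this turns them into genuine measurability. -/
lemma measurableSet_of_ae_eq {s t : Set Ω} (ht : MeasurableSet t)
    (hst : ∀ᵐ ω ∂P, ω ∈ s ↔ ω ∈ t) : MeasurableSet s := by
  have hnull : ∀ u : Set Ω, P u = 0 → MeasurableSet u := fun u hu =>
    ℱ.le 0 _ (h.complete u hu)
  have h1 : P (s \ t) = 0 := measure_mono_null (fun ω hω => fun hiff => hω.2 (hiff.1 hω.1)) hst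
  have h2 : P (t \ s) = 0 := measure_mono_null (fun ω hω => fun hiff => hω.2 (hiff.2 hω.1)) hst
  have : s = (t \ (t \ s)) ∪ (s \ t) := by
    rw [sdiff_sdiff_right_self, inter_comm]
    exact (inter_union_sdiff s t).symm
  rw [this]
  exact (ht.diff (hnull _ h2)).union (hnull _ h1)

lemma measurableSet_seen_event [Countable 𝒳] (q : ℝ≥0) :
    MeasurableSet {ω | Seen (X₁ · ω) (X₂ · ω) (Y₁ · ω) (Y₂ · ω) (T ω) q} :=
  ℱ.le q _ (measurableSet_seen h.sol₁.adapted_X h.sol₂.adapted_X h.sol₁.adapted_Y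
    h.sol₂.adapted_Y h.stopping q)

lemma measurable_X₁ (q : ℝ≥0) : Measurable (X₁ q) := (h.sol₁.adapted_X q).mono (ℱ.le q) le_rfl

lemma measurable_X₂ (q : ℝ≥0) : Measurable (X₂ q) := (h.sol₂.adapted_X q).mono (ℱ.le q) le_rfl

lemma measurable_Y₁ (q : ℝ≥0) : Measurable (Y₁ q) := (h.sol₁.adapted_Y q).mono (ℱ.le q) le_rfl

lemma measurable_Y₂ (q : ℝ≥0) : Measurable (Y₂ q) := (h.sol₂.adapted_Y q).mono (ℱ.le q) le_rfl

variable [IsProbabilityMeasure P] [Countable 𝒳]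

lemma measurableSet_nextMeeting_lt_top :
    MeasurableSet {ω | nextMeeting X₁ X₂ Y₁ Y₂ T ω < ⊤} := by
  refine h.measurableSet_of_ae_eq (MeasurableSet.iUnion fun n =>
    h.measurableSet_seen_event (TopologicalSpace.denseSeq ℝ≥0 n)) ?_
  filter_upwards [h.ae_chainPair] with ω ⟨S, hc⟩
  rw [nextMeeting_lt_top_iff, mem_iUnion]
  exact meetTimes_nonempty_iff hc.path₁ hc.path₂

/-- Away from a null set, the next meeting is attained if there is one. -/
lemma ae_isLeast : ∀ᵐ ω ∂P, nextMeeting X₁ X₂ Y₁ Y₂ T ω < ⊤ → ∃ S,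
    ChainPath prec lam tlam S (X₁ · ω) (Y₁ · ω) ∧ ChainPath prec lam tlam S (X₂ · ω) (Y₂ · ω) ∧
    IsLeast (meetTimesAt X₁ X₂ Y₁ Y₂ T ω) (sInf (meetTimesAt X₁ X₂ Y₁ Y₂ T ω)) ∧
    nextMeeting X₁ X₂ Y₁ Y₂ T ω = ((sInf (meetTimesAt X₁ X₂ Y₁ Y₂ T ω) : ℝ≥0) : WithTop ℝ≥0) := by
  filter_upwards [h.ae_chainPair] with ω ⟨S, hc⟩ hlt
  have hτ := isLeast_sInf_meetTimes hc.path₁ hc.path₂ (nextMeeting_lt_top_iff.1 hlt)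
  exact ⟨S, hc.path₁, hc.path₂, hτ, nextMeeting_of_isLeast hτ⟩

lemma measurableSet_meetingData {B : Set (𝒳 × ℝ≥0)} (hB : MeasurableSet B) :
    MeasurableSet ({ω | nextMeeting X₁ X₂ Y₁ Y₂ T ω < ⊤} ∩
      meetingData X₁ Y₁ Y₂ (nextMeeting X₁ X₂ Y₁ Y₂ T) ⁻¹' B) := by
  set D := TopologicalSpace.denseSeq ℝ≥0
  have hfresh : ∀ q, MeasurableSet {ω | Fresh (X₁ · ω) (X₂ · ω) (Y₁ · ω) (Y₂ · ω) (T ω) q} := by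
    intro q
    have hdec : {ω | ∀ m, D m + min (Y₁ q ω) (Y₂ q ω) < q →
        ¬ Seen (X₁ · ω) (X₂ · ω) (Y₁ · ω) (Y₂ · ω) (T ω) (D m)} =
        ⋂ m, ({ω | D m + min (Y₁ q ω) (Y₂ q ω) < q} ∩
          {ω | Seen (X₁ · ω) (X₂ · ω) (Y₁ · ω) (Y₂ · ω) (T ω) (D m)})ᶜ := by
      ext ω; simp
    refine (h.measurableSet_seen_event q).inter (s₂ := {ω | ∀ m, D m + min (Y₁ q ω) (Y₂ q ω) < q →
        ¬ Seen (X₁ · ω) (X₂ · ω) (Y₁ · ω) (Y₂ · ω) (T ω) (D m)}) ?_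
    rw [hdec]
    exact MeasurableSet.iInter fun m => ((measurableSet_lt (((h.measurable_Y₁ q).min
      (h.measurable_Y₂ q)).const_add _) measurable_const).inter
      (h.measurableSet_seen_event _)).compl
  have hval : ∀ q, Measurable fun ω =>
      (X₁ q ω, max (Y₁ q ω) (Y₂ q ω) - min (Y₁ q ω) (Y₂ q ω)) := fun q =>
    (h.measurable_X₁ q).prodMk (((h.measurable_Y₁ q).max (h.measurable_Y₂ q)).sub
      ((h.measurable_Y₁ q).min (h.measurable_Y₂ q)))
  refine h.measurableSet_of_ae_eq
    (t := {ω | nextMeeting X₁ X₂ Y₁ Y₂ T ω < ⊤} ∩ ⋃ n, ({ω | Fresh (X₁ · ω) (X₂ · ω) (Y₁ · ω)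
      (Y₂ · ω) (T ω) (D n)} ∩ (fun ω => (X₁ (D n) ω, max (Y₁ (D n) ω) (Y₂ (D n) ω) -
        min (Y₁ (D n) ω) (Y₂ (D n) ω))) ⁻¹' B))
    (h.measurableSet_nextMeeting_lt_top.inter (MeasurableSet.iUnion fun n =>
      (hfresh _).inter (hval _ hB))) ?_
  filter_upwards [h.ae_isLeast] with ω hω
  refine and_congr_right fun hlt => ?_
  obtain ⟨S, c₁, c₂, hτ, heq⟩ := hω hlt
  rw [mem_preimage, meetingData_of_eq heq, mem_iUnion]
  constructor
  · intro hmem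
    obtain ⟨n, hn⟩ := exists_fresh c₁ c₂ hτ
    refine ⟨n, hn, ?_⟩
    rw [hn.dataAt_eq c₁ c₂ hτ] at hmem
    exact hmem
  · rintro ⟨n, hn, hmem⟩
    rw [Fresh.dataAt_eq c₁ c₂ hτ hn]
    exact hmem

lemma measurableSet_mergedFrom :
    MeasurableSet {ω | MergedFrom X₁ X₂ (nextMeeting X₁ X₂ Y₁ Y₂ T) ω} := by
  set D := TopologicalSpace.denseSeq ℝ≥0
  have hm : MeasurableSet {ω | nextMeeting X₁ X₂ Y₁ Y₂ T ω < ⊤ → ∀ n, (∃ m, D m < D n ∧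
      Seen (X₁ · ω) (X₂ · ω) (Y₁ · ω) (Y₂ · ω) (T ω) (D m)) → X₁ (D n) ω = X₂ (D n) ω} := by
    refine h.measurableSet_nextMeeting_lt_top.imp ?_
    simp only [ofPred_forall]
    refine MeasurableSet.iInter fun n => MeasurableSet.imp ?_
      (measurableSet_eq_fun (h.measurable_X₁ _) (h.measurable_X₂ _))
    simp only [ofPred_exists]
    exact MeasurableSet.iUnion fun m => (MeasurableSet.const _).inter (h.measurableSet_seen_event _)
  refine h.measurableSet_of_ae_eq hm ?_
  filter_upwards [h.ae_isLeast] with ω hω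
  by_cases hlt : nextMeeting X₁ X₂ Y₁ Y₂ T ω < ⊤
  · obtain ⟨S, c₁, c₂, hτ, heq⟩ := hω hlt
    rw [mergedFrom_iff_of_eq heq, forall_eq_iff_dense c₁ c₂ hτ]
    exact ⟨fun h _ => h, fun h => h hlt⟩
  -- Without a meeting both conditions hold vacuously.
  · exact iff_of_true (mergedFrom_of_eq_top (not_lt_top_iff.1 hlt)) fun h => absurd h hlt

lemma aemeasurable_meetingData :
    AEMeasurable (meetingData X₁ Y₁ Y₂ (nextMeeting X₁ X₂ Y₁ Y₂ T))
      (cond P {ω | nextMeeting X₁ X₂ Y₁ Y₂ T ω < ⊤}) := by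
  have : NullMeasurable (meetingData X₁ Y₁ Y₂ (nextMeeting X₁ X₂ Y₁ Y₂ T))
      (cond P {ω | nextMeeting X₁ X₂ Y₁ Y₂ T ω < ⊤}) := by
    intro B hB
    refine ((h.measurableSet_meetingData hB).nullMeasurableSet).congr ?_
    filter_upwards [ae_cond_mem h.measurableSet_nextMeeting_lt_top] with ω hω
    exact propext ⟨fun hm => hm.2, fun hm => ⟨hω, hm⟩⟩
  exact this.aemeasurable

lemma lintegral_mergeProb_eq {B : Set (𝒳 × ℝ≥0)} (hB : MeasurableSet B) :
    ∫⁻ ω in {ω | nextMeeting X₁ X₂ Y₁ Y₂ T ω < ⊤}, mergeWeight lam B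
      (meetingData X₁ Y₁ Y₂ (nextMeeting X₁ X₂ Y₁ Y₂ T) ω, 0) ∂P =
    P ({ω | nextMeeting X₁ X₂ Y₁ Y₂ T ω < ⊤} ∩
      (meetingData X₁ Y₁ Y₂ (nextMeeting X₁ X₂ Y₁ Y₂ T) ⁻¹' B ∩
        {ω | MergedFrom X₁ X₂ (nextMeeting X₁ X₂ Y₁ Y₂ T) ω})) := by
  classical
  have hs := h.measurableSet_nextMeeting_lt_top
  rw [← inter_assoc, ← lintegral_indicator_one ((h.measurableSet_meetingData hB).inter
    h.measurableSet_mergedFrom), ← lintegral_indicator hs]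
  have key := h.lintegral_mergeWeight_eq hB
  refine (lintegral_congr_ae ?_).trans (key.trans (lintegral_congr_ae ?_))
  · filter_upwards [h.ae_isLeast] with ω hω
    by_cases hlt : nextMeeting X₁ X₂ Y₁ Y₂ T ω < ⊤
    · obtain ⟨-, -, -, -, heq⟩ := hω hlt
      have hmem : ω ∈ {ω | nextMeeting X₁ X₂ Y₁ Y₂ T ω < ⊤} := hlt
      rw [indicator_of_mem hmem, if_pos (nextMeeting_lt_top_iff.1 hlt), meetingData_of_eq heq]
    · have hmem : ω ∉ {ω | nextMeeting X₁ X₂ Y₁ Y₂ T ω < ⊤} := hlt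
      rw [indicator_of_notMem hmem, if_neg fun hne => hlt (nextMeeting_lt_top_iff.2 hne)]
  · filter_upwards [h.ae_isLeast] with ω hω
    by_cases hlt : nextMeeting X₁ X₂ Y₁ Y₂ T ω < ⊤
    · obtain ⟨-, -, -, -, heq⟩ := hω hlt
      rw [indicator_apply]
      refine if_congr ?_ rfl rfl
      rw [mem_inter_iff, mem_inter_iff, mem_preimage, meetingData_of_eq heq, mem_ofPred_eq,
        mem_ofPred_eq, mergedFrom_iff_of_eq heq, nextMeeting_lt_top_iff, and_assoc]
    · rw [indicator_of_notMem fun hmem => hlt hmem.1.1,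
        if_neg fun hmem => hlt (nextMeeting_lt_top_iff.2 hmem.1)]

/-- A conditional probability is determined by its integrals over sets B of meeting data. On both
sides these are the same multiple of the two sides of `lintegral_mergeProb_eq`. -/
theorem condDistrib_mergedFrom :
    ∀ᵐ z ∂((cond P {ω | nextMeeting X₁ X₂ Y₁ Y₂ T ω < ⊤}).map
        (meetingData X₁ Y₁ Y₂ (nextMeeting X₁ X₂ Y₁ Y₂ T))),
      condDistrib (MergedFrom X₁ X₂ (nextMeeting X₁ X₂ Y₁ Y₂ T))
          (meetingData X₁ Y₁ Y₂ (nextMeeting X₁ X₂ Y₁ Y₂ T))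
          (cond P {ω | nextMeeting X₁ X₂ Y₁ Y₂ T ω < ⊤}) z {merged : Prop | merged} =
        ENNReal.ofReal (mergeProb lam z 0) := by
  set s := {ω | nextMeeting X₁ X₂ Y₁ Y₂ T ω < ⊤}
  set Z := meetingData X₁ Y₁ Y₂ (nextMeeting X₁ X₂ Y₁ Y₂ T)
  set M := MergedFrom X₁ X₂ (nextMeeting X₁ X₂ Y₁ Y₂ T)
  have hs : MeasurableSet s := h.measurableSet_nextMeeting_lt_top
  have hZ : AEMeasurable Z (cond P s) := h.aemeasurable_meetingData
  have hM : AEMeasurable M (cond P s) :=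
    (measurableSet_setOfPred.1 h.measurableSet_mergedFrom).aemeasurable
  have hprob : Measurable fun z : 𝒳 × ℝ≥0 => ENNReal.ofReal (mergeProb lam z 0) :=
    ((measurable_mergeProb h.rates).comp (measurable_id.prodMk measurable_const)).ennreal_ofReal
  refine ae_eq_of_forall_setLIntegral_eq_of_sigmaFinite
    (Kernel.measurable_coe _ (MeasurableSet.of_discrete)) hprob fun B hB _ => ?_
  have hset : MeasurableSet {merged : Prop | merged} := MeasurableSet.of_discrete
  rw [← Measure.compProd_apply_prod hB hset, compProd_map_condDistrib hM,
    Measure.map_apply_of_aemeasurable (hZ.prodMk hM) (hB.prod hset), cond_apply hs,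
    ← lintegral_indicator hB, lintegral_map' (hprob.indicator hB).aemeasurable hZ,
    ProbabilityTheory.cond, lintegral_smul_measure, smul_eq_mul]
  congr 1
  exact (h.lintegral_mergeProb_eq hB).symm

end DrivenPair

end SemiMarkovFlow

end

theorem mainTheorem1 {Ω : Type*} [mΩ : MeasurableSpace Ω] (P : Measure Ω) [IsProbabilityMeasure P]
    (ℱ : Filtration ℝ≥0 mΩ)
    -- the usual hypotheses
    (hcomplete : ∀ s : Set Ω, P s = 0 → MeasurableSet[ℱ 0] s)
    (hright : ℱ.IsRightContinuous)
    -- the noise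
    (N : Ω → Measure (ℝ≥0 × ℝ))
    (hN : SemiMarkovFlow.IsPoissonRandomMeasure N SemiMarkovFlow.lebesgueHalfPlane P)
    (hNℱ : SemiMarkovFlow.IsCompatible N ℱ P)
    -- the state space, the ordering of its pairs, the rates and the spacing of the intervals
    (𝒳 : Set ℝ) (h𝒳 : 𝒳.Countable)
    (prec : SemiMarkovFlow.OffDiag 𝒳 → SemiMarkovFlow.OffDiag 𝒳 → Prop)
    (hprec : IsStrictTotalOrder (SemiMarkovFlow.OffDiag 𝒳) prec)
    (lam tlam : SemiMarkovFlow.OffDiag 𝒳 → ℝ → ℝ)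
    (hlam : SemiMarkovFlow.IsRateMatrix lam)
    (htlam : SemiMarkovFlow.IsSpacing lam tlam)
    (hA3 : ∀ p, ∀ᵐ y ∂(volume.restrict (Ici (0 : ℝ))), tlam p y = SemiMarkovFlow.supNorm (lam p))
    -- two solutions driven by the same noise, and a meeting time
    (X₁ X₂ : ℝ≥0 → Ω → 𝒳) (Y₁ Y₂ : ℝ≥0 → Ω → ℝ≥0)
    (hZ₁ : SemiMarkovFlow.IsSolution prec lam tlam N ℱ P X₁ Y₁)
    (hZ₂ : SemiMarkovFlow.IsSolution prec lam tlam N ℱ P X₂ Y₂)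
    (T : Ω → WithTop ℝ≥0) (hT : IsStoppingTime ℱ T)
    (τ : Ω → WithTop ℝ≥0) (hτ : τ = SemiMarkovFlow.nextMeeting X₁ X₂ Y₁ Y₂ T) :
    (∀ (k : 𝒳) (y : ℝ≥0), SemiMarkovFlow.FormulaConverges lam k y) ∧
    MeasurableSet {ω | τ ω < ⊤} ∧
    AEMeasurable (SemiMarkovFlow.meetingData X₁ Y₁ Y₂ τ) (cond P {ω | τ ω < ⊤}) ∧
    AEMeasurable (SemiMarkovFlow.MergedFrom X₁ X₂ τ) (cond P {ω | τ ω < ⊤}) ∧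
    ∀ᵐ z ∂((cond P {ω | τ ω < ⊤}).map (SemiMarkovFlow.meetingData X₁ Y₁ Y₂ τ)),
      condDistrib (SemiMarkovFlow.MergedFrom X₁ X₂ τ) (SemiMarkovFlow.meetingData X₁ Y₁ Y₂ τ)
          (cond P {ω | τ ω < ⊤}) z {merged : Prop | merged} =
        ENNReal.ofReal (∫ y' in Ioi (0 : ℝ), SemiMarkovFlow.mergeDensity lam z.1 z.2 y') := by
  subst hτ
  have : Countable 𝒳 := h𝒳.to_subtype
  have h : SemiMarkovFlow.DrivenPair P ℱ N prec lam tlam X₁ X₂ Y₁ Y₂ T :=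
    ⟨hcomplete, hN, hNℱ, hprec, hlam, htlam, hA3, hZ₁, hZ₂, hT⟩
  refine ⟨fun k y => SemiMarkovFlow.formulaConverges hlam htlam hA3 k NNReal.zero_le_coe,
    h.measurableSet_nextMeeting_lt_top, h.aemeasurable_meetingData,
    (measurableSet_setOfPred.1 h.measurableSet_mergedFrom).aemeasurable, ?_⟩
  filter_upwards [h.condDistrib_mergedFrom] with z hz
  -- At elapsed time zero the exponential factor in the probability of success is 1, and the
  -- integral of the density remains.
  rw [hz, SemiMarkovFlow.mergeProb, SemiMarkovFlow.IsHazardPair.successProb_zero]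
  rfl
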